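/- Let $\mathbb{T}^d=\mathbb{R}^d/\mathbb{Z}^d$, with $|x|$ the Euclidean length of the shortest representative of $x$, the metric $|x-y|$, and Lebesgue measure $|\cdot|$; for $E\subset\mathbb{T}^d$ let $E_r=\bigcup_{x\in E}B_r(x)$. For a Borel probability measure $\mu$ on $\mathbb{T}^d$ and $s\ge 0$ put $\|\mu\|_{M(s)}=\sup_{\xi\in\mathbb{Z}^d}|\widehat\mu(\xi)||\xi|^{s/2}$. The Fourier dimension of $\mu$ is the supremum of all $s\in[0,d]$ with $\|\mu\|_{M(s)}<\infty$; the Fourier dimension $\dim_{\mathbb{F}}(E)$ of a set $E$ is the supremum of the Fourier dimensions of the Borel probability measures $\mu$ with $\operatorname{supp}(\mu)\subset E$; and $E$ is Salem if $\dim_{\mathbb{F}}(E)$ equals the Hausdorff dimension of $E$. Let $\mathcal{E}$ be the family of compact subsets of $\mathbb{T}^d$ with the Hausdorff distance. For $\beta\in(0,d]$ let $\mathcal{X}_\beta$ be the set of pairs $(E,\mu)$ where $E\in\mathcal{E}$ and $\mu$ is a Borel probability measure with $\operatorname{supp}(\mu)\subset E$ and $\|\mu\|_{M(s)}<\infty$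 for all $s\in[0,\beta)$, with the topology in which $(E_k,\mu_k)\to(E,\mu)$ if and only if $E_k\to E$ in $\mathcal{E}$ and $\|\mu_k-\mu\|_{M(s)}\to0$ for all $s\in[0,\beta)$ (this is a completely metrizable topology). Let $d\ge1$ and $n\ge 2$ be integers, let $d(n-1)\le\alpha<dn$, let $a\in\mathbb{Q}\setminus\{0\}$, let $V\subset\mathbb{T}^{d(n-2)}$ be open, and let $T:V\to\mathcal{E}$ be locally Lipschitz. Suppose that the sets $T(x)$ locally uniformly have lower Minkowski dimension at most $\alpha-d(n-1)$, in the sense that for every $\gamma>\alpha$ and every closed set $W\subset\mathbb{T}^{d(n-2)}$ with $W\subset V$ there is a decreasing sequence $r_i>0$ with $r_i\to0$ such that $|T(x)_{r_i}|\le r_i^{nd-\gamma}$ for all $x\in W$ and all $i$. Set \[ \beta_0=\min\left(\frac{dn-\alpha}{n-1},\,d\right). \] Say that $E\subset\mathbb{T}^d$ avoids the pattern if for all distinct $x_1,\dots,x_n\in E$ with $(x_1,\dots,x_{n-2})\in V$, \[ x_n-ax_{n-1}\notin T(x_1,\dots,x_{n-2}), \] where, when $a$ is not an integer, this is required for each of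 the finitely many values of $ax_{n-1}\in\mathbb{T}^d$, that is, for the class of $at$ for every representative $t\in\mathbb{R}^d$ of $x_{n-1}$. Then there is a compact Salem set $E\subset\mathbb{T}^d$ with $\dim_{\mathbb{F}}(E)=\beta_0$ that avoids the pattern. Moreover, for every $0<\beta\le\beta_0$, the family of all $(E,\mu)\in\mathcal{X}_\beta$ such that $E$ is Salem and avoids the pattern is comeager in $\mathcal{X}_\beta$. -/

import Mathlib

open MeasureTheory Filter Topology TopologicalSpace
open scoped ENNReal NNReal

namespace SalemAvoid

noncomputable section

/-- The torus `𝕋ᵈ = ℝᵈ / ℤᵈ`, with Lebesgue measure `volume` of total mass one. Mathlib's metric on it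
is the sup metric, which is bi-Lipschitz equivalent to the Euclidean one, so that the Hausdorff
metric topology, the locally Lipschitz maps and the Hausdorff dimension are the same for both. -/
abbrev Torus (d : ℕ) : Type := UnitAddTorus (Fin d)

/-- The Euclidean distance on the torus. -/
def euclDist {d : ℕ} (x y : Torus d) : ℝ := Real.sqrt (∑ i, ‖x i - y i‖ ^ 2)

/-- The open `r`-thickening `E_r` for the Euclidean distance. -/
def thickening {d : ℕ} (r : ℝ) (E : Set (Torus d)) : Set (Torus d) :=
  {y | ∃ x ∈ E, euclDist x y < r}

/-- The Euclidean length of a frequency `ξ ∈ ℤᵈ`. -/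
def freqNorm {d : ℕ} (ξ : Fin d → ℤ) : ℝ := Real.sqrt (∑ i, (ξ i : ℝ) ^ 2)

/-- The Fourier coefficient `∫ exp(-2πi ξ·x) dμ(x)`. -/
def fourierCoeffMeasure {d : ℕ} (μ : ProbabilityMeasure (Torus d)) (ξ : Fin d → ℤ) : ℂ :=
  ∫ x, UnitAddTorus.mFourier (-ξ) x ∂(μ : Measure (Torus d))

/-- `sup_ξ |c(ξ)| |ξ|^{s/2}`, as an element of `[0, ∞]` (with `0 ^ 0 = 1`). -/
def weightedSup {d : ℕ} (s : ℝ) (c : (Fin d → ℤ) → ℂ) : ℝ≥0∞ :=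
  ⨆ ξ, ‖c ξ‖ₑ * ENNReal.ofReal (freqNorm ξ ^ (s / 2))

/-- The Fourier dimension of a probability measure: the supremum of all `s ∈ [0, d]` with
`sup_ξ |μ̂(ξ)| |ξ|^{s/2} < ∞`. -/
def fourierDimMeasure {d : ℕ} (μ : ProbabilityMeasure (Torus d)) : ℝ≥0∞ :=
  ⨆ (s : ℝ) (_ : 0 ≤ s ∧ s ≤ d ∧ weightedSup s (fourierCoeffMeasure μ) < ∞), ENNReal.ofReal s

/-- The Fourier dimension of a set: the supremum of the Fourier dimensions of the Borel probability
measures whose support is contained in the set. -/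
def fourierDim {d : ℕ} (E : Set (Torus d)) : ℝ≥0∞ :=
  ⨆ (μ : ProbabilityMeasure (Torus d)) (_ : (μ : Measure (Torus d)).support ⊆ E),
    fourierDimMeasure μ

/-- A set is Salem if its Fourier dimension agrees with its Hausdorff dimension. -/
def IsSalem {d : ℕ} (E : Set (Torus d)) : Prop := fourierDim E = dimH E

/-- The space `𝒳_β` of pairs `(E, μ)`, where `E` is compact and `μ` is a probability measure
supported in `E` such that `‖μ‖_{M(s)} = sup_ξ |μ̂(ξ)| |ξ|^{s/2} < ∞` for all `s ∈ [0, β)`. -/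
structure XSpace (d : ℕ) (β : ℝ) where
  set : Compacts (Torus d)
  measure : ProbabilityMeasure (Torus d)
  support_subset : (measure : Measure (Torus d)).support ⊆ set
  decay : ∀ s : ℝ, 0 ≤ s → s < β → weightedSup s (fourierCoeffMeasure measure) < ∞

/-- The pseudometric `‖μ - ν‖_{M(s)}` on `𝒳_β`. -/
abbrev XSpace.seminormDist (d : ℕ) (β s : ℝ) : PseudoEMetricSpace (XSpace d β) where
  edist p q := weightedSup s (fourierCoeffMeasure p.measure - fourierCoeffMeasure q.measure)
  edist_self p := by simp [weightedSup]
  edist_comm p q := by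
    simp only [weightedSup, Pi.sub_apply]
    congr 1
    ext ξ
    rw [← enorm_neg, neg_sub]
  edist_triangle p q r := by
    refine iSup_le fun ξ => ?_
    calc ‖(fourierCoeffMeasure p.measure - fourierCoeffMeasure r.measure) ξ‖ₑ
            * ENNReal.ofReal (freqNorm ξ ^ (s / 2))
        ≤ (‖(fourierCoeffMeasure p.measure - fourierCoeffMeasure q.measure) ξ‖ₑ
            + ‖(fourierCoeffMeasure q.measure - fourierCoeffMeasure r.measure) ξ‖ₑ)
            * ENNReal.ofReal (freqNorm ξ ^ (s / 2)) := by
          gcongr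
          refine le_trans (le_of_eq ?_) (enorm_add_le _ _)
          simp
      _ ≤ _ := by
          rw [add_mul]
          exact add_le_add
            (le_iSup (fun ξ => ‖(fourierCoeffMeasure p.measure
              - fourierCoeffMeasure q.measure) ξ‖ₑ * ENNReal.ofReal (freqNorm ξ ^ (s / 2))) ξ)
            (le_iSup (fun ξ => ‖(fourierCoeffMeasure q.measure
              - fourierCoeffMeasure r.measure) ξ‖ₑ * ENNReal.ofReal (freqNorm ξ ^ (s / 2))) ξ)

/-- The topology of `𝒳_β`: the product of the Hausdorff metric topology on the compact sets and of
the topology given by the seminorms `‖·‖_{M(s)}`, `s ∈ [0, β)`, on the measures. -/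
instance XSpace.instTopologicalSpace (d : ℕ) (β : ℝ) : TopologicalSpace (XSpace d β) :=
  TopologicalSpace.induced XSpace.set inferInstance ⊓
    ⨅ s : Set.Ico (0 : ℝ) β, (XSpace.seminormDist d β s).toUniformSpace.toTopologicalSpace

/-- The sets `T(x)`, `x ∈ V`, locally uniformly have lower Minkowski dimension at most
`α - d(n-1)`. -/
def LocUnifLowerMinkowski {d : ℕ} (n : ℕ) (α : ℝ) (V : Set (Fin (n - 2) → Torus d))
    (T : (Fin (n - 2) → Torus d) → Compacts (Torus d)) : Prop :=
  ∀ γ : ℝ, α < γ → ∀ W : Set (Fin (n - 2) → Torus d), IsClosed W → W ⊆ V →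
    ∃ r : ℕ → ℝ, (∀ i, 0 < r i) ∧ Antitone r ∧ Tendsto r atTop (𝓝 0) ∧
      ∀ x ∈ W, ∀ i, volume (thickening (r i) (T x : Set (Torus d))) ≤
        ENNReal.ofReal (r i ^ ((n : ℝ) * d - γ))

/-- All the values of `a x` for a rational number `a` and a point `x` of the torus: the classes of
`a t`, where `t ∈ ℝᵈ` is any representative of `x`. For an integer `a` this is a single point. -/
def ratMul {d : ℕ} (a : ℚ) (x : Torus d) : Set (Torus d) :=
  {y | ∃ t : Fin d → ℝ, (∀ i, (t i : UnitAddCircle) = x i) ∧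
    ∀ i, y i = (((a : ℝ) * t i : ℝ) : UnitAddCircle)}

/-- `E` has no distinct points `x₁, …, xₙ` such that `(x₁, …, xₙ₋₂) ∈ V` and
`xₙ - a xₙ₋₁ ∈ T(x₁, …, xₙ₋₂)`, for any of the values of `a xₙ₋₁`. -/
def Avoids {d n : ℕ} (hn : 2 ≤ n) (a : ℚ) (V : Set (Fin (n - 2) → Torus d))
    (T : (Fin (n - 2) → Torus d) → Compacts (Torus d)) (E : Set (Torus d)) : Prop :=
  ∀ x : Fin n → Torus d, (∀ i, x i ∈ E) → Function.Injective x →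
    (fun i : Fin (n - 2) => x (i.castLE (Nat.sub_le n 2))) ∈ V →
    ∀ y ∈ ratMul a (x ⟨n - 2, by omega⟩),
      x ⟨n - 1, by omega⟩ - y ∉ T (fun i : Fin (n - 2) => x (i.castLE (Nat.sub_le n 2)))

end

end SalemAvoid

namespace SalemAvoid

noncomputable section

open scoped SchwartzMap FourierTransform

/-! The proof is a Baire category argument in `XSpace d β`, which is completely metrizable
(`XSpace.baireSpace`). Each pair already has Fourier dimension at least `β`
(`XSpace.le_fourierDim`), and Fourier dimension never exceeds Hausdorff dimension
(`fourierDim_le_dimH`). So the Salem property only needs `dimH ≤ β`, which follows from countably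
many open covering conditions `FewBalls`. Avoidance is likewise a countable intersection of open
conditions `LocalAvoid`, in which the tuple lies in a closed piece of `V`, the last two points lie
near two fixed centres, and the other points stay away from these centres.

Density of such conditions reduces to approximating mollified measures (`dense_of_smoothApprox`).
The engine is `eventually_exists_discretization`: for every small scale `r`, a smooth density can be
replaced by about `r ^ (-lam)` points, `lam > s`, and mollified again at a scale comparable to `r`,
with small error in the norm with weight `|ξ| ^ (s / 2)`. Square-root cancellation leaves an error
of about `r ^ (lam / 2)`, which beats the weight up to frequencies slightly beyond `1 / r`; above
that the mollifier decays faster than any power.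

For avoidance write `a = p / q` and cut the measure into a part near the first centre, a part near
the second, and the rest. The rest becomes a list of points, the first part becomes points `q z`,
and from the density of the second part the sets `p z + 𝒯` are removed, where `𝒯` consists of
`r`-neighbourhoods of the sets `T(X)`, with `X` built from the first list. There are at most `r ^
(-lam (n - 2))` tuples `X`, each costing volume about `r ^ (dn - α)`, and `r ^ (-lam)` translates.
The removed mass is about `r ^ (dn - α - lam (n - 1))`, which tends to zero since `lam < β ≤ (dn -
α) / (n - 1)`; this is the origin of `β₀`. A bound on volumes along a sequence of scales suffices
because the discretization works at all small scales.

Small removed mass does not by itself control weighted Fourier coefficients. The expected loss has a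
small absolutely convergent Fourier series (`absRep_hitProb`, `AbsRep.one_sub_one_sub_pow`), while
the deviation from it is a martingale in the sampled points (`removalMart`). All frequencies are
controlled at once by choosing the points greedily so that a sum of hyperbolic cosines stays bounded
(`exists_path`, `exists_sample`). -/

instance isProbabilityMeasure_volume_unitAddCircle :
    IsProbabilityMeasure (volume : Measure UnitAddCircle) :=
  ⟨UnitAddCircle.measure_univ⟩

instance isProbabilityMeasure_volume_torus (d : ℕ) :
    IsProbabilityMeasure (volume : Measure (Torus d)) := by
  change IsProbabilityMeasure (Measure.pi _)
  infer_instance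

/-! ### A smooth bump on the line and its Fourier transform -/

/-- A fixed smooth bump function on the line with integral one. -/
def lineBump : ℝ → ℝ := (⟨1 / 2, 1, by norm_num, by norm_num⟩ : ContDiffBump (0 : ℝ)).normed volume

lemma lineBump_nonneg (x : ℝ) : 0 ≤ lineBump x := ContDiffBump.nonneg_normed _ _

lemma integral_lineBump : ∫ x, lineBump x = 1 := ContDiffBump.integral_normed _

lemma contDiff_lineBump : ContDiff ℝ (⊤ : ℕ∞) lineBump := ContDiffBump.contDiff_normed _

lemma hasCompactSupport_lineBump : HasCompactSupport lineBump :=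
  ContDiffBump.hasCompactSupport_normed _

lemma integrable_lineBump : Integrable lineBump :=
  contDiff_lineBump.continuous.integrable_of_hasCompactSupport hasCompactSupport_lineBump

lemma abs_lt_one_of_lineBump_ne_zero {x : ℝ} (h : lineBump x ≠ 0) : |x| < 1 := by
  have : x ∈ Function.support lineBump := h
  rw [lineBump, ContDiffBump.support_normed_eq] at this
  simpa using this

lemma exists_le_lineBump : ∃ c > 0, ∀ x, |x| ≤ 1 / 2 → c ≤ lineBump x := by
  set b : ContDiffBump (0 : ℝ) := ⟨1 / 2, 1, by norm_num, by norm_num⟩ with hb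
  refine ⟨1 / ∫ x, b x, by have := b.integral_pos (μ := volume); positivity, fun x hx => ?_⟩
  have h1 : b x = 1 := b.one_of_mem_closedBall (by simpa [hb] using hx)
  change _ ≤ b.normed volume x
  rw [ContDiffBump.normed_def, h1]

/-- The rescaled bump function `x ↦ ρ⁻¹ ψ(x / ρ)`. -/
def scaledBump (ρ : ℝ) (x : ℝ) : ℝ := ρ⁻¹ * lineBump (ρ⁻¹ * x)

lemma hasCompactSupport_scaledBump {ρ : ℝ} (hρ : 0 < ρ) :
    HasCompactSupport (fun x => (scaledBump ρ x : ℂ)) := by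
  have h : HasCompactSupport (fun x => lineBump (ρ⁻¹ * x)) :=
    hasCompactSupport_lineBump.comp_homeomorph (Homeomorph.mulLeft₀ ρ⁻¹ (by positivity))
  exact h.comp_left (g := fun y : ℝ => ((ρ⁻¹ * y : ℝ) : ℂ)) (by simp)

lemma contDiff_scaledBump (ρ : ℝ) :
    ContDiff ℝ (⊤ : ℕ∞) (fun x => (scaledBump ρ x : ℂ)) := by
  unfold scaledBump
  exact Complex.ofRealCLM.contDiff.comp
    (contDiff_const.mul (contDiff_lineBump.comp (contDiff_const.mul contDiff_id)))

/-- The rescaled bump function as a Schwartz function. -/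
def scaledBumpSchwartz {ρ : ℝ} (hρ : 0 < ρ) : 𝓢(ℝ, ℂ) :=
  (hasCompactSupport_scaledBump hρ).toSchwartzMap (contDiff_scaledBump ρ)

lemma scaledBumpSchwartz_apply {ρ : ℝ} (hρ : 0 < ρ) (x : ℝ) :
    scaledBumpSchwartz hρ x = scaledBump ρ x := rfl

/-- The Fourier transform of the bump function. -/
def bumpHat (t : ℝ) : ℂ := 𝓕 (fun x => (lineBump x : ℂ)) t

lemma bumpHat_eq (t : ℝ) :
    bumpHat t = ∫ x : ℝ, Complex.exp (↑(-2 * Real.pi * x * t) * Complex.I) * lineBump x := by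
  rw [bumpHat, Real.fourier_eq']
  congr 1
  ext x
  simp only [smul_eq_mul, RCLike.inner_apply, conj_trivial]
  congr 4
  simp
  ring

lemma fourier_scaledBump {ρ : ℝ} (hρ : 0 < ρ) (k : ℝ) :
    𝓕 (scaledBumpSchwartz hρ) k = bumpHat (ρ * k) := by
  rw [SchwartzMap.fourier_coe, Real.fourier_eq', bumpHat_eq]
  have h := Measure.integral_comp_mul_left
    (fun x : ℝ => Complex.exp (↑(-2 * Real.pi * x * (ρ * k)) * Complex.I) * lineBump x) ρ⁻¹
  rw [inv_inv, abs_of_pos hρ] at h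
  have h2 : ∫ x : ℝ, Complex.exp (↑(-2 * Real.pi * x * (ρ * k)) * Complex.I) * lineBump x
      = ρ⁻¹ • ∫ x : ℝ, Complex.exp (↑(-2 * Real.pi * (ρ⁻¹ * x) * (ρ * k)) * Complex.I)
        * lineBump (ρ⁻¹ * x) := by
    rw [h, smul_smul, inv_mul_cancel₀ hρ.ne', one_smul]
  rw [h2, ← integral_smul]
  congr 1
  ext x
  have h3 : -2 * Real.pi * (ρ⁻¹ * x) * (ρ * k) = -2 * Real.pi * inner ℝ x k := by
    simp
    field_simp
  rw [h3, scaledBumpSchwartz_apply, scaledBump]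
  simp only [smul_eq_mul, Complex.real_smul]
  push_cast
  ring

lemma bumpHat_zero : bumpHat 0 = 1 := by
  rw [bumpHat_eq]
  simp only [mul_zero, Complex.ofReal_zero, zero_mul, Complex.exp_zero, one_mul]
  rw [integral_complex_ofReal, integral_lineBump]
  simp

lemma norm_bumpHat_le_one (t : ℝ) : ‖bumpHat t‖ ≤ 1 := by
  rw [bumpHat_eq]
  refine (norm_integral_le_integral_norm _).trans (le_of_eq ?_)
  rw [← integral_lineBump]
  congr 1
  ext x
  rw [norm_mul, Complex.norm_exp_ofReal_mul_I, one_mul, Complex.norm_real,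
    Real.norm_of_nonneg (lineBump_nonneg x)]

/-- The bump has integral one and lives on `|x| < 1`, so `|1 - e^{iu}| ≤ |u|` can be averaged. This
controls the effect of mollification at low frequencies. -/
lemma norm_one_sub_bumpHat_le (t : ℝ) : ‖1 - bumpHat t‖ ≤ 2 * Real.pi * |t| := by
  have hi : Integrable (fun x : ℝ =>
      Complex.exp (↑(-2 * Real.pi * x * t) * Complex.I) * lineBump x) := by
    refine integrable_lineBump.ofReal.bdd_mul (c := 1) ?_ ?_
    · exact (by fun_prop : Continuous fun x : ℝ =>
        Complex.exp (↑(-2 * Real.pi * x * t) * Complex.I)).aestronglyMeasurable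
    · exact ae_of_all _ fun x => by rw [Complex.norm_exp_ofReal_mul_I]
  have h1 : (1 : ℂ) = ∫ x : ℝ, (lineBump x : ℂ) := by
    rw [integral_complex_ofReal, integral_lineBump]; simp
  have hl : Integrable (fun x : ℝ => (lineBump x : ℂ)) := integrable_lineBump.ofReal
  rw [bumpHat_eq, h1, ← integral_sub hl hi]
  calc _ ≤ ∫ x : ℝ, 2 * Real.pi * |t| * lineBump x := by
        refine norm_integral_le_of_norm_le (integrable_lineBump.const_mul _) (ae_of_all _ fun x => ?_)
        have : (lineBump x : ℂ) - Complex.exp (↑(-2 * Real.pi * x * t) * Complex.I) * lineBump x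
            = -(Complex.exp (Complex.I * ↑(-2 * Real.pi * x * t)) - 1) * lineBump x := by
          rw [mul_comm Complex.I]; ring
        rw [this, norm_mul, norm_neg, Complex.norm_real, Real.norm_of_nonneg (lineBump_nonneg x)]
        by_cases hx : lineBump x = 0
        · simp [hx]
        refine mul_le_mul_of_nonneg_right (Real.norm_exp_I_mul_ofReal_sub_one_le.trans ?_)
          (lineBump_nonneg x)
        have := abs_lt_one_of_lineBump_ne_zero hx
        rw [Real.norm_eq_abs, abs_mul, abs_mul, abs_mul, abs_of_pos Real.pi_pos]
        norm_num
        nlinarith [mul_nonneg Real.pi_pos.le (abs_nonneg t)]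
    _ = 2 * Real.pi * |t| := by rw [integral_const_mul, integral_lineBump, mul_one]

/-- The Fourier transform of a Schwartz function is again Schwartz. -/
lemma exists_norm_bumpHat_le (K : ℕ) : ∃ C : ℝ, ∀ t, ‖bumpHat t‖ * (1 + |t|) ^ K ≤ C := by
  have h0 := SchwartzMap.one_add_le_sup_seminorm_apply (𝕜 := ℝ) (m := (K, 0)) (k := K) (n := 0)
    le_rfl le_rfl (𝓕 (scaledBumpSchwartz one_pos))
  generalize 2 ^ (K, 0).1 * ((Finset.Iic (K, 0)).sup fun m => SchwartzMap.seminorm ℝ m.1 m.2)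
    (𝓕 (scaledBumpSchwartz one_pos)) = C at h0
  refine ⟨C, fun t => ?_⟩
  have h := h0 t
  rw [norm_iteratedFDeriv_zero, fourier_scaledBump, one_mul, Real.norm_eq_abs, mul_comm] at h
  exact h

/-! ### The periodic bump on the circle -/

/-- The periodization of the rescaled bump function. -/
def circleBump (ρ : ℝ) (x : UnitAddCircle) : ℝ :=
  (∑' k : ℤ, bumpHat (ρ * k) * fourier k x).re

lemma summable_norm_bumpHat {ρ : ℝ} (hρ : 0 < ρ) : Summable fun k : ℤ => ‖bumpHat (ρ * k)‖ := by
  obtain ⟨C, hC⟩ := exists_norm_bumpHat_le 2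
  -- The extra summand supported at `k = 0` is needed because `1 / 0 ^ 2` evaluates to `0`.
  refine Summable.of_nonneg_of_le (fun _ => norm_nonneg _) (fun k => ?_)
    ((Real.summable_one_div_int_pow.2 one_lt_two).mul_left (C * (1 / ρ ^ 2)) |>.add
      (summable_of_hasFiniteSupport (f := fun k : ℤ => if k = 0 then (1 : ℝ) else 0)
        ((Set.finite_singleton 0).subset fun k hk => by
          by_contra h; simp_all)))
  by_cases hk : k = 0
  · simp only [hk, if_true]
    simpa using norm_bumpHat_le_one 0
  · simp only [hk, if_false, add_zero]
    have hk' : (0 : ℝ) < (k : ℝ) ^ 2 := by positivity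
    have h := hC (ρ * k)
    have h2 : ρ ^ 2 * (k : ℝ) ^ 2 ≤ (1 + |ρ * k|) ^ 2 := by
      have : ρ ^ 2 * (k : ℝ) ^ 2 = |ρ * k| ^ 2 := by rw [sq_abs]; ring
      rw [this]; gcongr; linarith
    have h3 : ‖bumpHat (ρ * k)‖ * (ρ ^ 2 * (k : ℝ) ^ 2) ≤ C :=
      (mul_le_mul_of_nonneg_left h2 (norm_nonneg _)).trans h
    have : C * (1 / ρ ^ 2) * (1 / (k : ℝ) ^ 2) = C / (ρ ^ 2 * (k : ℝ) ^ 2) := by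
      field_simp
    rw [this, le_div_iff₀ (by positivity)]
    exact h3

/-- Poisson summation. The bump is defined by its Fourier series; positivity, support and lower
bounds are read off from the periodization on the other side. -/
lemma circleBump_coe {ρ : ℝ} (hρ : 0 < ρ) (t : ℝ) :
    ∑' k : ℤ, bumpHat (ρ * k) * fourier k (t : UnitAddCircle)
      = ((∑' n : ℤ, scaledBump ρ (t + n) : ℝ) : ℂ) := by
  have h := SchwartzMap.tsum_eq_tsum_fourier (scaledBumpSchwartz hρ) t
  simp only [fourier_scaledBump, scaledBumpSchwartz_apply] at h
  rw [← h, Complex.ofReal_tsum]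

lemma circleBump_coe_eq {ρ : ℝ} (hρ : 0 < ρ) (t : ℝ) :
    circleBump ρ t = ∑' n : ℤ, scaledBump ρ (t + n) := by
  rw [circleBump, circleBump_coe hρ, Complex.ofReal_re]

lemma scaledBump_nonneg {ρ : ℝ} (hρ : 0 < ρ) (x : ℝ) : 0 ≤ scaledBump ρ x :=
  mul_nonneg (by positivity) (lineBump_nonneg _)

lemma circleBump_nonneg {ρ : ℝ} (hρ : 0 < ρ) (x : UnitAddCircle) : 0 ≤ circleBump ρ x := by
  induction x using QuotientAddGroup.induction_on with
  | H t => exact (circleBump_coe_eq hρ t).symm ▸ tsum_nonneg fun n => scaledBump_nonneg hρ _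

lemma hasSum_circleBump {ρ : ℝ} (hρ : 0 < ρ) (x : UnitAddCircle) :
    HasSum (fun k : ℤ => bumpHat (ρ * k) * fourier k x) (circleBump ρ x : ℂ) := by
  have hs : Summable fun k : ℤ => bumpHat (ρ * k) * fourier k x := by
    refine Summable.of_norm ((summable_norm_bumpHat hρ).congr fun k => ?_)
    rw [norm_mul, fourier_apply, Circle.norm_coe, mul_one]
  convert hs.hasSum
  induction x using QuotientAddGroup.induction_on with
  | H t =>
    change ((circleBump ρ (t : UnitAddCircle) : ℝ) : ℂ)
      = ∑' k : ℤ, bumpHat (ρ * k) * fourier k (t : UnitAddCircle)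
    rw [circleBump_coe_eq hρ, circleBump_coe hρ]

lemma abs_lt_of_scaledBump_ne_zero {ρ : ℝ} (hρ : 0 < ρ) {x : ℝ} (h : scaledBump ρ x ≠ 0) :
    |x| < ρ := by
  have := abs_lt_one_of_lineBump_ne_zero (right_ne_zero_of_mul h)
  rwa [abs_mul, abs_of_pos (inv_pos.2 hρ), inv_mul_lt_iff₀ hρ, mul_one] at this

lemma norm_lt_of_circleBump_ne_zero {ρ : ℝ} (hρ : 0 < ρ) {x : UnitAddCircle}
    (h : circleBump ρ x ≠ 0) : ‖x‖ < ρ := by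
  induction x using QuotientAddGroup.induction_on with
  | H t =>
    change circleBump ρ (t : UnitAddCircle) ≠ 0 at h
    rw [circleBump_coe_eq hρ] at h
    obtain ⟨n, hn⟩ : ∃ n : ℤ, scaledBump ρ (t + n) ≠ 0 := by
      by_contra! hc
      exact h (by simp [hc])
    have h1 := abs_lt_of_scaledBump_ne_zero hρ hn
    have h2 : ((t : ℝ) : UnitAddCircle) = ((t + n : ℝ) : UnitAddCircle) := by
      rw [AddCircle.coe_add]
      have : ((n : ℝ) : UnitAddCircle) = 0 := by
        rw [AddCircle.coe_eq_zero_iff]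
        exact ⟨n, by simp⟩
      rw [this, add_zero]
    change ‖((t : ℝ) : UnitAddCircle)‖ < ρ
    rw [h2]
    exact (QuotientAddGroup.norm_mk_le_norm (m := t + n) (S := AddSubgroup.zmultiples (1 : ℝ))).trans_lt h1

lemma exists_le_circleBump : ∃ c > 0, ∀ ρ > 0, ∀ x : UnitAddCircle, ‖x‖ ≤ ρ / 2 →
    c / ρ ≤ circleBump ρ x := by
  obtain ⟨c, hc, hb⟩ := exists_le_lineBump
  refine ⟨c, hc, fun ρ hρ x hx => ?_⟩
  induction x using QuotientAddGroup.induction_on with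
  | H t =>
    rw [circleBump_coe_eq hρ]
    change ‖((t : ℝ) : UnitAddCircle)‖ ≤ ρ / 2 at hx
    rw [AddCircle.norm_eq] at hx
    set n : ℤ := -round ((1 : ℝ)⁻¹ * t)
    have hn : |t + n| ≤ ρ / 2 := by simpa [n, sub_eq_add_neg] using hx
    have hs : Summable fun n : ℤ => scaledBump ρ (t + n) := by
      refine summable_of_hasFiniteSupport ?_
      refine (Set.finite_Icc ⌊-ρ - t⌋ ⌈ρ - t⌉).subset fun k hk => ?_
      have := abs_lt.1 (abs_lt_of_scaledBump_ne_zero hρ hk)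
      constructor
      · exact_mod_cast (Int.floor_le (-ρ - t)).trans (by linarith : -ρ - t ≤ (k : ℝ))
      · exact_mod_cast (by linarith : (k : ℝ) ≤ ρ - t).trans (Int.le_ceil _)
    refine le_trans ?_ (hs.le_tsum n fun k _ => scaledBump_nonneg hρ _)
    rw [scaledBump, div_eq_inv_mul]
    refine mul_le_mul_of_nonneg_left (hb _ ?_) (by positivity)
    rw [abs_mul, abs_of_pos (inv_pos.2 hρ), inv_mul_le_iff₀ hρ]
    linarith

/-! ### The mollifier on the torus -/

open UnitAddTorus

/-- Induction on the dimension, splitting off the first coordinate; absolute summability has to be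
carried along in order to multiply the series. -/
lemma hasSum_prod_pi (d : ℕ) (a : Fin d → ℤ → ℂ) (A : Fin d → ℂ)
    (hs : ∀ i, Summable fun k => ‖a i k‖) (hA : ∀ i, HasSum (a i) (A i)) :
    HasSum (fun ξ : Fin d → ℤ => ∏ i, a i (ξ i)) (∏ i, A i) ∧
      Summable (fun ξ : Fin d → ℤ => ‖∏ i, a i (ξ i)‖) := by
  induction d with
  | zero =>
    refine ⟨?_, .of_finite⟩
    simp [hasSum_unique]
  | succ d ih =>
    obtain ⟨h1, h2⟩ := ih (fun i => a i.succ) (fun i => A i.succ) (fun i => hs _) (fun i => hA _)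
    have hp : ∀ p : ℤ × (Fin d → ℤ), ∏ i, a i ((Fin.consEquiv fun _ : Fin (d + 1) => ℤ) p i)
        = a 0 p.1 * ∏ i, a (Fin.succ i) (p.2 i) := by
      intro p
      rw [Fin.prod_univ_succ]
      rfl
    constructor
    · rw [← (Fin.consEquiv fun _ : Fin (d + 1) => ℤ).hasSum_iff, Fin.prod_univ_succ]
      have h4 : Summable fun p : ℤ × (Fin d → ℤ) => a 0 p.1 * ∏ i, a (Fin.succ i) (p.2 i) :=
        summable_mul_of_summable_norm (f := a 0) (g := fun η : Fin d → ℤ => ∏ i, a (Fin.succ i) (η i))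
          (hs 0) h2
      have h3 := HasSum.mul (f := a 0) (g := fun η : Fin d → ℤ => ∏ i, a (Fin.succ i) (η i))
        (hA 0) h1 h4
      exact h3.congr_fun fun p => hp p
    · rw [← (Fin.consEquiv fun _ : Fin (d + 1) => ℤ).summable_iff]
      have h3 := Summable.mul_norm (f := a 0) (g := fun η : Fin d → ℤ => ∏ i, a (Fin.succ i) (η i))
        (hs 0) h2
      exact h3.congr fun p => congr_arg norm (hp p).symm

/-- The lattice sums `∑ ‖ξ‖ ^ r` over `ℤᵈ` converge for `r < -d`. -/
lemma summable_norm_rpow_int (d : ℕ) {r : ℝ} (hr : r < -d) :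
    Summable fun ξ : Fin d → ℤ => ‖ξ‖ ^ r := by
  classical
  let L : Submodule ℤ (Fin d → ℝ) := Submodule.span ℤ (Set.range (Pi.basisFun ℝ (Fin d)))
  have hfr : Module.finrank ℤ L = d := by
    rw [ZLattice.rank ℝ L]; simp
  have h := ZLattice.summable_norm_rpow L r (by rw [hfr]; exact hr)
  have hmem : ∀ ξ : Fin d → ℤ, (fun i => (ξ i : ℝ)) ∈ L := by
    intro ξ
    rw [Module.Basis.mem_span_iff_repr_mem ℤ (Pi.basisFun ℝ (Fin d))]
    intro i
    exact ⟨ξ i, by simp⟩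
  have hinj : Function.Injective (fun ξ : Fin d → ℤ => (⟨fun i => (ξ i : ℝ), hmem ξ⟩ : L)) := by
    intro ξ η h
    ext i
    have h' : ((ξ i : ℤ) : ℝ) = η i := congr_fun (congr_arg Subtype.val h) i
    exact_mod_cast h'
  have hn : ∀ ξ : Fin d → ℤ, ‖(fun i => (ξ i : ℝ))‖ = ‖ξ‖ := by
    intro ξ
    simp only [Pi.norm_def]
    congr 2
  refine (h.comp_injective hinj).congr fun ξ => ?_
  rw [← hn ξ]
  rfl

lemma summable_one_add_norm_int (d : ℕ) :
    Summable fun ξ : Fin d → ℤ => ((1 + ‖ξ‖) ^ (d + 1))⁻¹ := by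
  have h := summable_norm_rpow_int d (r := -(d + 1 : ℝ)) (by linarith)
  have h0 : Summable fun ξ : Fin d → ℤ => if ξ = 0 then (1 : ℝ) else 0 :=
    summable_of_hasFiniteSupport ((Set.finite_singleton (0 : Fin d → ℤ)).subset fun k hk => by
          by_contra h; simp_all)
  refine Summable.of_nonneg_of_le (fun _ => by positivity) (fun ξ => ?_) (h.add h0)
  by_cases hξ : ξ = 0
  · simp [hξ]
    positivity
  · have hp : 0 < ‖ξ‖ := norm_pos_iff.2 hξ
    simp only [hξ, if_false, add_zero]
    rw [Real.rpow_neg hp.le]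
    have : ‖ξ‖ ^ ((d : ℝ) + 1) = ‖ξ‖ ^ (d + 1) := by exact_mod_cast Real.rpow_natCast ‖ξ‖ (d + 1)
    rw [this]
    gcongr
    linarith

variable {d : ℕ}

/-- The periodic mollifier at scale `ρ`. -/
def torusBump (ρ : ℝ) (x : Torus d) : ℝ := ∏ i, circleBump ρ (x i)

/-- The Fourier coefficients of the mollifier. -/
def bumpCoeff (ρ : ℝ) (ξ : Fin d → ℤ) : ℂ := ∏ i, bumpHat (ρ * ξ i)

lemma norm_mFourier_apply (ξ : Fin d → ℤ) (x : Torus d) : ‖mFourier ξ x‖ = 1 := by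
  simp only [mFourier, ContinuousMap.coe_mk, norm_prod, fourier_apply, Circle.norm_coe,
    Finset.prod_const_one]

lemma torusBump_nonneg {ρ : ℝ} (hρ : 0 < ρ) (x : Torus d) : 0 ≤ torusBump ρ x :=
  Finset.prod_nonneg fun _ _ => circleBump_nonneg hρ _

lemma norm_le_of_torusBump_ne_zero {ρ : ℝ} (hρ : 0 < ρ) {x : Torus d} (h : torusBump ρ x ≠ 0) :
    ‖x‖ ≤ ρ := by
  rw [pi_norm_le_iff_of_nonneg hρ.le]
  intro i
  exact (norm_lt_of_circleBump_ne_zero hρ (Finset.prod_ne_zero_iff.1 h i (Finset.mem_univ i))).le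

variable (d) in
lemma exists_le_torusBump : ∃ c > 0, ∀ ρ > 0, ∀ x : Torus d, ‖x‖ ≤ ρ / 2 →
    c / ρ ^ d ≤ torusBump ρ x := by
  obtain ⟨c, hc, h⟩ := exists_le_circleBump
  refine ⟨c ^ d, by positivity, fun ρ hρ x hx => ?_⟩
  have : c ^ d / ρ ^ d = ∏ _i : Fin d, (c / ρ) := by simp
  rw [this]
  exact Finset.prod_le_prod (fun _ _ => by positivity) fun i _ =>
    h ρ hρ _ ((norm_le_pi_norm x i).trans hx)

lemma bumpCoeff_zero (ρ : ℝ) : bumpCoeff ρ (0 : Fin d → ℤ) = 1 := by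
  simp [bumpCoeff, bumpHat_zero]

lemma norm_bumpCoeff_le_one (ρ : ℝ) (ξ : Fin d → ℤ) : ‖bumpCoeff ρ ξ‖ ≤ 1 := by
  rw [bumpCoeff, norm_prod]
  exact Finset.prod_le_one (fun _ _ => norm_nonneg _) fun _ _ => norm_bumpHat_le_one _

lemma norm_int_cast_apply_le (ξ : Fin d → ℤ) (i : Fin d) : |(ξ i : ℝ)| ≤ ‖ξ‖ := by
  have := norm_le_pi_norm ξ i
  rwa [Int.norm_eq_abs] at this

lemma norm_one_sub_prod_le {ι : Type*} (s : Finset ι) (a : ι → ℂ) (h : ∀ i ∈ s, ‖a i‖ ≤ 1) :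
    ‖1 - ∏ i ∈ s, a i‖ ≤ ∑ i ∈ s, ‖1 - a i‖ := by
  classical
  induction s using Finset.induction_on with
  | empty => simp
  | insert i s hi ih =>
    rw [Finset.prod_insert hi, Finset.sum_insert hi]
    have : 1 - a i * ∏ j ∈ s, a j = (1 - a i) + a i * (1 - ∏ j ∈ s, a j) := by ring
    rw [this]
    refine (norm_add_le _ _).trans (add_le_add le_rfl ?_)
    rw [norm_mul]
    refine (mul_le_of_le_one_left (norm_nonneg _) (h i (by simp))).trans ?_
    exact ih fun j hj => h j (by simp [hj])

lemma norm_one_sub_bumpCoeff_le {ρ : ℝ} (hρ : 0 < ρ) (ξ : Fin d → ℤ) :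
    ‖1 - bumpCoeff ρ ξ‖ ≤ 2 * Real.pi * d * ρ * ‖ξ‖ := by
  refine (norm_one_sub_prod_le _ _ fun _ _ => norm_bumpHat_le_one _).trans ?_
  calc ∑ i, ‖1 - bumpHat (ρ * ξ i)‖ ≤ ∑ _i : Fin d, 2 * Real.pi * (ρ * ‖ξ‖) := by
        refine Finset.sum_le_sum fun i _ => (norm_one_sub_bumpHat_le _).trans ?_
        rw [abs_mul, abs_of_pos hρ]
        have := norm_int_cast_apply_le ξ i
        have := Real.pi_pos
        gcongr
    _ = _ := by simp; ring

/-- The decay of the coefficients of the mollifier, uniform in the scale. -/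
lemma exists_norm_bumpCoeff_le (d K : ℕ) : ∃ C : ℝ, 0 < C ∧ ∀ ρ > 0, ∀ ξ : Fin d → ℤ,
    ‖bumpCoeff ρ ξ‖ * (1 + ρ * ‖ξ‖) ^ K ≤ C := by
  obtain ⟨C, hC⟩ := exists_norm_bumpHat_le K
  refine ⟨max C 1, by positivity, fun ρ hρ ξ => ?_⟩
  by_cases hξ : ξ = 0
  · subst hξ
    simp [bumpCoeff_zero]
  have hd : Nonempty (Fin d) := by
    by_contra h
    rw [not_nonempty_iff] at h
    exact hξ (Subsingleton.elim _ _)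
  obtain ⟨i, -, hi⟩ := Finset.exists_max_image Finset.univ (fun i => ‖ξ i‖) Finset.univ_nonempty
  have hn : ‖ξ‖ = |(ξ i : ℝ)| := by
    refine le_antisymm ?_ (norm_int_cast_apply_le ξ i)
    rw [pi_norm_le_iff_of_nonneg (abs_nonneg _)]
    intro j
    simpa [Int.norm_eq_abs] using hi j (Finset.mem_univ j)
  refine le_trans ?_ (le_max_left C 1)
  refine le_trans ?_ (hC (ρ * ξ i))
  rw [abs_mul, abs_of_pos hρ, hn]
  gcongr
  rw [bumpCoeff, norm_prod, ← Finset.mul_prod_erase _ _ (Finset.mem_univ i)]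
  exact mul_le_of_le_one_right (norm_nonneg _)
    (Finset.prod_le_one (fun _ _ => norm_nonneg _) fun _ _ => norm_bumpHat_le_one _)

lemma summable_bumpCoeff_mul {ρ : ℝ} (hρ : 0 < ρ) (K : ℕ) :
    Summable fun ξ : Fin d → ℤ => ‖bumpCoeff ρ ξ‖ * (1 + ‖ξ‖) ^ K := by
  obtain ⟨C, hC0, hC⟩ := exists_norm_bumpCoeff_le d (K + (d + 1))
  -- The factor `m` turns the decay in `ρ ‖ξ‖` into decay in `1 + ‖ξ‖`, at the price of a constant
  -- depending on `ρ`.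
  set m := min 1 ρ with hm
  have hm0 : 0 < m := by positivity
  refine Summable.of_nonneg_of_le (fun _ => by positivity) (fun ξ => ?_)
    ((summable_one_add_norm_int d).mul_left (C / m ^ (K + (d + 1))))
  have h1 : m * (1 + ‖ξ‖) ≤ 1 + ρ * ‖ξ‖ := by
    have : m ≤ 1 := min_le_left _ _
    have h2 : m ≤ ρ := min_le_right _ _
    nlinarith [norm_nonneg ξ]
  have h2 : ‖bumpCoeff ρ ξ‖ * (m * (1 + ‖ξ‖)) ^ (K + (d + 1)) ≤ C := by
    refine le_trans ?_ (hC ρ hρ ξ)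
    gcongr
  rw [← div_eq_mul_inv, div_div, le_div_iff₀ (by positivity)]
  refine le_trans (le_of_eq ?_) h2
  rw [mul_pow, pow_add (1 + ‖ξ‖)]
  ring

lemma summable_norm_bumpCoeff {ρ : ℝ} (hρ : 0 < ρ) :
    Summable fun ξ : Fin d → ℤ => ‖bumpCoeff ρ ξ‖ := by
  simpa using summable_bumpCoeff_mul (d := d) hρ 0

lemma hasSum_torusBump {ρ : ℝ} (hρ : 0 < ρ) (x : Torus d) :
    HasSum (fun ξ => bumpCoeff ρ ξ * mFourier ξ x) (torusBump ρ x : ℂ) := by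
  have h := (hasSum_prod_pi d (fun i k => bumpHat (ρ * k) * fourier k (x i))
    (fun i => (circleBump ρ (x i) : ℂ)) (fun i => ?_) (fun i => hasSum_circleBump hρ _)).1
  · simpa [torusBump, bumpCoeff, mFourier, Finset.prod_mul_distrib] using h
  · refine (summable_norm_bumpHat hρ).congr fun k => ?_
    rw [norm_mul, fourier_apply, Circle.norm_coe, mul_one]

lemma continuous_torusBump {ρ : ℝ} (hρ : 0 < ρ) : Continuous (torusBump ρ : Torus d → ℝ) := by
  have h : Continuous fun x : Torus d => ∑' ξ, bumpCoeff ρ ξ * mFourier ξ x := by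
    refine continuous_tsum (fun ξ => by fun_prop) (summable_norm_bumpCoeff hρ) fun ξ x => ?_
    rw [norm_mul, norm_mFourier_apply, mul_one]
  have h2 : (torusBump ρ : Torus d → ℝ) = fun x => (∑' ξ, bumpCoeff ρ ξ * mFourier ξ x).re := by
    ext x
    rw [(hasSum_torusBump hρ x).tsum_eq, Complex.ofReal_re]
  rw [h2]
  exact Complex.continuous_re.comp h

/-! ### Characters and Fourier coefficients of measures -/

lemma mFourier_apply_add (ξ : Fin d → ℤ) (x y : Torus d) :
    mFourier ξ (x + y) = mFourier ξ x * mFourier ξ y := by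
  simp only [mFourier, ContinuousMap.coe_mk, ← Finset.prod_mul_distrib, fourier_apply, Pi.add_apply,
    smul_add, AddCircle.toCircle_add, Circle.coe_mul]

lemma mFourier_apply_zsmul (ξ : Fin d → ℤ) (n : ℤ) (x : Torus d) :
    mFourier ξ (n • x) = mFourier (n • ξ) x := by
  simp only [mFourier, ContinuousMap.coe_mk, fourier_apply, Pi.smul_apply, smul_smul, smul_eq_mul]
  refine Finset.prod_congr rfl fun i _ => ?_
  rw [mul_comm]

lemma mFourier_apply_neg (ξ : Fin d → ℤ) (x : Torus d) :
    mFourier ξ (-x) = mFourier (-ξ) x := by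
  simpa using mFourier_apply_zsmul ξ (-1) x

lemma mFourier_apply_sub (ξ : Fin d → ℤ) (x y : Torus d) :
    mFourier ξ (x - y) = mFourier ξ x * mFourier (-ξ) y := by
  rw [sub_eq_add_neg, mFourier_apply_add, mFourier_apply_neg]

lemma mFourier_neg_mul_self (ξ : Fin d → ℤ) (x : Torus d) :
    mFourier (-ξ) x * mFourier ξ x = 1 := by
  rw [← mFourier_add, neg_add_cancel, mFourier_zero]; rfl

lemma exists_mFourier_ne_one {ξ : Fin d → ℤ} (h : ξ ≠ 0) : ∃ x : Torus d, mFourier ξ x ≠ 1 := by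
  obtain ⟨i, hi⟩ := Function.ne_iff.1 h
  have hi' : ((ξ i : ℤ) : ℝ) ≠ 0 := by exact_mod_cast hi
  -- At this point the character takes the value `exp (π i) = -1`.
  refine ⟨Pi.single i (((1 / (2 * (ξ i : ℝ)) : ℝ)) : UnitAddCircle), ?_⟩
  have : mFourier ξ (Pi.single i (((1 / (2 * (ξ i : ℝ)) : ℝ)) : UnitAddCircle))
      = fourier (ξ i) (((1 / (2 * (ξ i : ℝ)) : ℝ)) : UnitAddCircle) := by
    simp only [mFourier, ContinuousMap.coe_mk]
    rw [Finset.prod_eq_single i]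
    · simp
    · intro j _ hj
      simp [Pi.single_eq_of_ne hj]
    · simp
  rw [this, fourier_coe_apply]
  have h2 : 2 * (Real.pi : ℂ) * Complex.I * (ξ i : ℂ) * ((1 / (2 * (ξ i : ℝ)) : ℝ) : ℂ) / (1 : ℝ)
      = Real.pi * Complex.I := by
    have : ((ξ i : ℤ) : ℂ) ≠ 0 := by exact_mod_cast hi
    push_cast
    field_simp
  rw [h2, Complex.exp_pi_mul_I]
  norm_num

/-- For a nontrivial character, a suitable translation multiplies the integral by a number other
than one, so the integral vanishes. -/
lemma integral_mFourier (ξ : Fin d → ℤ) :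
    ∫ x : Torus d, mFourier ξ x = if ξ = 0 then 1 else 0 := by
  split_ifs with h
  · subst h
    simp [mFourier_zero]
  · obtain ⟨t, ht⟩ := exists_mFourier_ne_one h
    have h1 := integral_add_right_eq_self (μ := (volume : Measure (Torus d)))
      (fun x => mFourier ξ x) t
    simp only [mFourier_apply_add] at h1
    rw [integral_mul_const] at h1
    have h2 : (∫ x : Torus d, mFourier ξ x) * (mFourier ξ t - 1) = 0 := by
      rw [mul_sub, h1]; ring
    exact (mul_eq_zero.1 h2).resolve_right (sub_ne_zero.2 ht)

/-- The Fourier coefficients of a measure. -/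
def hat (κ : Measure (Torus d)) (ξ : Fin d → ℤ) : ℂ := ∫ x, mFourier (-ξ) x ∂κ

/-- The Fourier coefficients of a function. -/
def coeff (f : Torus d → ℂ) (ξ : Fin d → ℤ) : ℂ := ∫ x, f x * mFourier (-ξ) x

lemma integrable_mFourier (κ : Measure (Torus d)) [IsFiniteMeasure κ] (ξ : Fin d → ℤ) :
    Integrable (fun x => mFourier ξ x) κ :=
  Integrable.of_bound (C := 1) ((mFourier ξ).continuous.aestronglyMeasurable)
    (ae_of_all _ fun x => (norm_mFourier_apply ξ x).le)

lemma norm_hat_le (κ : Measure (Torus d)) [IsFiniteMeasure κ] (ξ : Fin d → ℤ) :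
    ‖hat κ ξ‖ ≤ κ.real Set.univ := by
  refine (norm_integral_le_of_norm_le_const (C := 1)
    (ae_of_all _ fun x => (norm_mFourier_apply _ x).le)).trans ?_
  rw [one_mul]

lemma hat_add (κ κ' : Measure (Torus d)) [IsFiniteMeasure κ] [IsFiniteMeasure κ']
    (ξ : Fin d → ℤ) : hat (κ + κ') ξ = hat κ ξ + hat κ' ξ :=
  integral_add_measure (integrable_mFourier _ _) (integrable_mFourier _ _)

lemma hat_zero_measure (ξ : Fin d → ℤ) : hat (0 : Measure (Torus d)) ξ = 0 := by simp [hat]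

lemma hat_zero_freq (κ : Measure (Torus d)) : hat κ 0 = κ.real Set.univ := by
  simp [hat, mFourier_zero]

lemma hat_smul (κ : Measure (Torus d)) (c : ℝ≥0∞) (ξ : Fin d → ℤ) :
    hat (c • κ) ξ = c.toReal * hat κ ξ := by
  simp [hat, integral_smul_measure]

lemma hat_dirac (x : Torus d) (ξ : Fin d → ℤ) : hat (Measure.dirac x) ξ = mFourier (-ξ) x := by
  simp [hat]

lemma hat_withDensity {f : Torus d → ℝ} (hf : Measurable f) (h0 : ∀ x, 0 ≤ f x) (ξ : Fin d → ℤ) :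
    hat (volume.withDensity fun x => ENNReal.ofReal (f x)) ξ = coeff (fun x => (f x : ℂ)) ξ := by
  rw [hat, coeff]
  have := integral_withDensity_eq_integral_smul (μ := (volume : Measure (Torus d)))
    (f := fun x => Real.toNNReal (f x)) hf.real_toNNReal (fun x => mFourier (-ξ) x)
  refine this.trans (integral_congr_ae (ae_of_all _ fun x => ?_))
  simp only [NNReal.smul_def, Real.coe_toNNReal _ (h0 x), Complex.real_smul]

/-! ### Functions with weighted absolutely convergent Fourier series -/

/-- `f` is the sum of an absolutely convergent trigonometric series `∑ c i e(ξ i · x)` with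
`∑ |c i| (1 + |ξ i|) ^ m ≤ C`. -/
def AbsRep (m : ℕ) (f : Torus d → ℂ) (C : ℝ) : Prop :=
  ∃ (ι : Type) (_ : Countable ι) (c : ι → ℂ) (ξ : ι → Fin d → ℤ),
    (Summable fun i => ‖c i‖ * (1 + ‖ξ i‖) ^ m) ∧ ∑' i, ‖c i‖ * (1 + ‖ξ i‖) ^ m ≤ C ∧
      ∀ x, HasSum (fun i => c i * mFourier (ξ i) x) (f x)

lemma summable_norm_of_weighted {ι : Type*} {m : ℕ} {c : ι → ℂ} {ξ : ι → Fin d → ℤ}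
    (h : Summable fun i => ‖c i‖ * (1 + ‖ξ i‖) ^ m) : Summable fun i => ‖c i‖ := by
  refine Summable.of_nonneg_of_le (fun _ => norm_nonneg _) (fun i => ?_) h
  refine le_mul_of_one_le_right (norm_nonneg _) (one_le_pow₀ ?_)
  linarith [norm_nonneg (ξ i)]

lemma hasSum_integral_mul {ι : Type*} [Countable ι] {c : ι → ℂ} {F : ι → Torus d → ℂ}
    {f : Torus d → ℂ} (hc : Summable fun i => ‖c i‖) (hF : ∀ i, Measurable (F i))
    (hF1 : ∀ i x, ‖F i x‖ ≤ 1) (hf : ∀ x, HasSum (fun i => c i * F i x) (f x))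
    (κ : Measure (Torus d)) [IsFiniteMeasure κ] {u : Torus d → ℂ} (hu : Integrable u κ) :
    HasSum (fun i => c i * ∫ x, F i x * u x ∂κ) (∫ x, f x * u x ∂κ) := by
  have hi : ∀ i, Integrable (fun x => F i x * u x) κ := fun i =>
    hu.bdd_mul (c := 1) (hF i).aestronglyMeasurable (ae_of_all _ (hF1 i))
  have h := hasSum_integral_of_summable_integral_norm (μ := κ)
    (F := fun i x => c i * (F i x * u x)) (fun i => (hi i).const_mul _) ?_
  · have h2 : (fun x => ∑' i, c i * (F i x * u x)) = fun x => f x * u x := by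
      ext x
      rw [← ((hf x).mul_right (u x)).tsum_eq]
      simp only [mul_assoc]
    rw [h2] at h
    exact h.congr_fun fun i => (integral_const_mul _ _).symm
  · refine Summable.of_nonneg_of_le (fun i => integral_nonneg fun _ => norm_nonneg _) (fun i => ?_)
      (hc.mul_right (∫ x, ‖u x‖ ∂κ))
    simp only [norm_mul]
    rw [integral_const_mul]
    refine mul_le_mul_of_nonneg_left (integral_mono ?_ hu.norm fun x => ?_) (norm_nonneg _)
    · simpa only [norm_mul] using (hi i).norm
    · exact mul_le_of_le_one_left (norm_nonneg _) (hF1 i x)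

lemma AbsRep.continuous {m : ℕ} {f : Torus d → ℂ} {C : ℝ} (h : AbsRep m f C) : Continuous f := by
  obtain ⟨ι, _, c, ξ, hs, -, hf⟩ := h
  have h2 : f = fun x => ∑' i, c i * mFourier (ξ i) x := by
    ext x; rw [(hf x).tsum_eq]
  rw [h2]
  refine continuous_tsum (fun i => by fun_prop) (summable_norm_of_weighted hs) fun i x => ?_
  rw [norm_mul, norm_mFourier_apply, mul_one]

lemma AbsRep.nonneg {m : ℕ} {f : Torus d → ℂ} {C : ℝ} (h : AbsRep m f C) : 0 ≤ C := by
  obtain ⟨ι, _, c, ξ, hs, h2, hf⟩ := h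
  exact (tsum_nonneg fun i => by positivity).trans h2

/-- Termwise integration and orthogonality. The frequencies `ξ i` need not be distinct, so the
coefficient at `η` is a sum over all `i` with `ξ i = η`. -/
lemma AbsRep.norm_coeff_le {m : ℕ} {f : Torus d → ℂ} {C : ℝ} (h : AbsRep m f C)
    (η : Fin d → ℤ) : ‖coeff f η‖ * (1 + ‖η‖) ^ m ≤ C := by
  obtain ⟨ι, _, c, ξ, hs, h2, hf⟩ := h
  have hs' := summable_norm_of_weighted hs
  have h3 := hasSum_integral_mul hs' (fun i => (mFourier (ξ i)).continuous.measurable)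
    (fun i x => (norm_mFourier_apply _ _).le) hf volume (integrable_mFourier volume (-η))
  have h4 : ∀ i, ∫ x, mFourier (ξ i) x * mFourier (-η) x = if ξ i = η then 1 else 0 := by
    intro i
    simp only [← mFourier_add, integral_mFourier, add_neg_eq_zero]
  simp only [h4] at h3
  have h5 : ∀ i, ‖c i * (if ξ i = η then 1 else 0)‖ * (1 + ‖η‖) ^ m
      ≤ ‖c i‖ * (1 + ‖ξ i‖) ^ m := by
    intro i
    split_ifs with hi
    · simp [hi]
    · simp only [mul_zero, norm_zero, zero_mul]; positivity
  have h6 : Summable fun i => ‖c i * (if ξ i = η then 1 else 0)‖ := by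
    refine Summable.of_nonneg_of_le (fun _ => norm_nonneg _) (fun i => ?_) hs'
    split_ifs <;> simp
  rw [coeff, ← h3.tsum_eq]
  refine (mul_le_mul_of_nonneg_right (norm_tsum_le_tsum_norm h6) (by positivity)).trans ?_
  rw [← tsum_mul_right]
  exact ((h6.mul_right _).tsum_le_tsum h5 hs).trans h2

lemma AbsRep.add {m : ℕ} {f g : Torus d → ℂ} {C C' : ℝ} (h : AbsRep m f C) (h' : AbsRep m g C') :
    AbsRep m (fun x => f x + g x) (C + C') := by
  obtain ⟨ι, _, c, ξ, hs, h2, hf⟩ := h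
  obtain ⟨ι', _, c', ξ', hs', h2', hf'⟩ := h'
  have hsum := HasSum.sum (f := fun i => ‖Sum.elim c c' i‖ * (1 + ‖Sum.elim ξ ξ' i‖) ^ m)
    hs.hasSum hs'.hasSum
  refine ⟨ι ⊕ ι', inferInstance, Sum.elim c c', Sum.elim ξ ξ', hsum.summable, ?_, fun x => ?_⟩
  · rw [hsum.tsum_eq]; exact add_le_add h2 h2'
  · exact HasSum.sum (f := fun i => Sum.elim c c' i * mFourier (Sum.elim ξ ξ' i) x) (hf x) (hf' x)

lemma one_add_norm_add_le (ξ η : Fin d → ℤ) : 1 + ‖ξ + η‖ ≤ (1 + ‖ξ‖) * (1 + ‖η‖) := by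
  nlinarith [norm_add_le ξ η, mul_nonneg (norm_nonneg ξ) (norm_nonneg η)]

/-- The weight is submultiplicative by `one_add_norm_add_le`, so these functions form a Banach
algebra, as needed for powers of the hitting probability. -/
lemma AbsRep.mul {m : ℕ} {f g : Torus d → ℂ} {C C' : ℝ} (h : AbsRep m f C) (h' : AbsRep m g C') :
    AbsRep m (fun x => f x * g x) (C * C') := by
  have hC := h.nonneg
  obtain ⟨ι, _, c, ξ, hs, h2, hf⟩ := h
  obtain ⟨ι', _, c', ξ', hs', h2', hf'⟩ := h'
  have hle : ∀ p : ι × ι', ‖c p.1 * c' p.2‖ * (1 + ‖ξ p.1 + ξ' p.2‖) ^ m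
      ≤ (‖c p.1‖ * (1 + ‖ξ p.1‖) ^ m) * (‖c' p.2‖ * (1 + ‖ξ' p.2‖) ^ m) := by
    intro p
    rw [norm_mul, mul_mul_mul_comm, ← mul_pow]
    gcongr
    exact one_add_norm_add_le _ _
  have hprod : Summable fun p : ι × ι' =>
      (‖c p.1‖ * (1 + ‖ξ p.1‖) ^ m) * (‖c' p.2‖ * (1 + ‖ξ' p.2‖) ^ m) :=
    hs.mul_of_nonneg hs' (fun _ => by positivity) (fun _ => by positivity)
  have hsum : Summable fun p : ι × ι' => ‖c p.1 * c' p.2‖ * (1 + ‖ξ p.1 + ξ' p.2‖) ^ m :=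
    Summable.of_nonneg_of_le (fun _ => by positivity) hle hprod
  refine ⟨ι × ι', inferInstance, fun p => c p.1 * c' p.2, fun p => ξ p.1 + ξ' p.2, hsum, ?_,
    fun x => ?_⟩
  · refine (hsum.tsum_le_tsum hle hprod).trans ?_
    rw [← (hs.hasSum.mul hs'.hasSum hprod).tsum_eq.symm]
    exact mul_le_mul h2 h2' (tsum_nonneg fun _ => by positivity) hC
  · have h3 := (hf x).mul (hf' x) ?_
    · refine h3.congr_fun fun p => ?_
      rw [mFourier_add]; ring
    · refine summable_mul_of_summable_norm (f := fun i => c i * mFourier (ξ i) x)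
        (g := fun i => c' i * mFourier (ξ' i) x) ?_ ?_
      · simpa only [norm_mul, norm_mFourier_apply, mul_one] using summable_norm_of_weighted hs
      · simpa only [norm_mul, norm_mFourier_apply, mul_one] using summable_norm_of_weighted hs'

lemma AbsRep.const_mul {m : ℕ} {f : Torus d → ℂ} {C : ℝ} (h : AbsRep m f C) (a : ℂ) :
    AbsRep m (fun x => a * f x) (‖a‖ * C) := by
  obtain ⟨ι, h0, c, ξ, hs, h2, hf⟩ := h
  refine ⟨ι, h0, fun i => a * c i, ξ, ?_, ?_, fun x => ?_⟩
  · simpa only [norm_mul, mul_assoc] using hs.mul_left ‖a‖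
  · simp only [norm_mul, mul_assoc, tsum_mul_left]
    gcongr
  · simpa only [mul_assoc] using (hf x).mul_left a

/-! ### Mollification of measures -/

/-- The mollification at scale `ρ` of a measure. -/
def smooth (ρ : ℝ) (κ : Measure (Torus d)) (x : Torus d) : ℝ := ∫ y, torusBump ρ (x - y) ∂κ

lemma hasSum_smooth {ρ : ℝ} (hρ : 0 < ρ) (κ : Measure (Torus d)) [IsFiniteMeasure κ] (x : Torus d) :
    HasSum (fun ξ => (bumpCoeff ρ ξ * hat κ ξ) * mFourier ξ x) (smooth ρ κ x : ℂ) := by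
  have h := hasSum_integral_mul (c := bumpCoeff ρ) (F := fun ξ y => mFourier ξ (x - y))
    (f := fun y => (torusBump ρ (x - y) : ℂ)) (summable_norm_bumpCoeff hρ)
    (fun ξ => by fun_prop) (fun ξ y => (norm_mFourier_apply _ _).le)
    (fun y => hasSum_torusBump hρ _) κ (u := fun _ => 1) (integrable_const _)
  simp only [mul_one] at h
  rw [integral_complex_ofReal] at h
  refine h.congr_fun fun ξ => ?_
  simp only [mFourier_apply_sub]
  rw [integral_const_mul, hat]
  ring

lemma absRep_smooth {ρ : ℝ} (hρ : 0 < ρ) (κ : Measure (Torus d)) [IsFiniteMeasure κ]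
    (m : ℕ) : ∃ C, AbsRep m (fun x => (smooth ρ κ x : ℂ)) C := by
  have hs : Summable fun ξ : Fin d → ℤ => ‖bumpCoeff ρ ξ * hat κ ξ‖ * (1 + ‖ξ‖) ^ m := by
    refine Summable.of_nonneg_of_le (fun _ => by positivity) (fun ξ => ?_)
      ((summable_bumpCoeff_mul hρ m).mul_right (κ.real Set.univ))
    rw [norm_mul, mul_right_comm]
    gcongr
    exact norm_hat_le κ ξ
  exact ⟨_, _, inferInstance, _, fun ξ => ξ, hs, le_rfl, hasSum_smooth hρ κ⟩

lemma coeff_smooth {ρ : ℝ} (hρ : 0 < ρ) (κ : Measure (Torus d)) [IsFiniteMeasure κ]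
    (ξ : Fin d → ℤ) :
    coeff (fun x => (smooth ρ κ x : ℂ)) ξ = bumpCoeff ρ ξ * hat κ ξ := by
  have hs : Summable fun ξ : Fin d → ℤ => ‖bumpCoeff ρ ξ * hat κ ξ‖ := by
    refine Summable.of_nonneg_of_le (fun _ => by positivity) (fun ξ => ?_)
      ((summable_norm_bumpCoeff hρ).mul_right (κ.real Set.univ))
    rw [norm_mul]
    gcongr
    exact norm_hat_le κ ξ
  have h3 := hasSum_integral_mul hs (fun η => (mFourier η).continuous.measurable)
    (fun i x => (norm_mFourier_apply _ _).le) (hasSum_smooth hρ κ) volume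
    (integrable_mFourier volume (-ξ))
  simp only [← mFourier_add, integral_mFourier, add_neg_eq_zero] at h3
  rw [coeff, ← h3.tsum_eq, tsum_eq_single ξ]
  · simp
  · intro η hη
    simp [hη]

lemma smooth_nonneg {ρ : ℝ} (hρ : 0 < ρ) (κ : Measure (Torus d)) (x : Torus d) : 0 ≤ smooth ρ κ x :=
  integral_nonneg fun _ => torusBump_nonneg hρ _

lemma continuous_smooth {ρ : ℝ} (hρ : 0 < ρ) (κ : Measure (Torus d)) [IsFiniteMeasure κ]
    : Continuous (smooth ρ κ) := by
  obtain ⟨C, hC⟩ := absRep_smooth hρ κ 0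
  exact Complex.continuous_re.comp hC.continuous

/-- The mollification lives on the closed `ρ`-neighbourhood of any set carrying the measure. -/
lemma exists_dist_le_of_smooth_ne_zero {ρ : ℝ} (hρ : 0 < ρ) (κ : Measure (Torus d))
    {K : Set (Torus d)} (hK : κ Kᶜ = 0) {x : Torus d}
    (h : smooth ρ κ x ≠ 0) : ∃ y ∈ K, dist x y ≤ ρ := by
  by_contra! hc
  refine h (integral_eq_zero_of_ae ?_)
  have : ∀ᵐ y ∂κ, y ∈ K := hK
  filter_upwards [this] with y hy
  by_contra hne
  have := norm_le_of_torusBump_ne_zero hρ hne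
  rw [← dist_eq_norm] at this
  exact absurd (hc y hy) (not_lt.2 this)

/-! ### Greedy choice of paths with small sums -/

/-- The sum of history-dependent increments along a list (the head being the most recent entry). -/
def pathSum {Ω E : Type*} [AddCommMonoid E] (D : List Ω → Ω → E) : List Ω → E
  | [] => 0
  | ω :: l => pathSum D l + D l ω

lemma exp_le_one_add_add_sq {x : ℝ} (hx : |x| ≤ 1) : Real.exp x ≤ 1 + x + x ^ 2 := by
  have := (abs_le.1 (Real.abs_exp_sub_one_sub_id_le hx)).2
  linarith

/-- Second-order expansion in one increment. The term linear in `D` averages to zero when `D` has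
mean zero, so one step costs only a factor `1 + θ ^ 2` on average. -/
lemma cosh_mul_add_le {θ S D : ℝ} (hθ0 : 0 ≤ θ) (hθ : θ ≤ 1) (hD : |D| ≤ 1) :
    Real.cosh (θ * (S + D)) ≤
      Real.cosh (θ * S) * (1 + θ ^ 2) + θ * Real.sinh (θ * S) * D := by
  have hx : |θ * D| ≤ 1 := by
    rw [abs_mul, abs_of_nonneg hθ0]
    exact mul_le_one₀ hθ (abs_nonneg _) hD
  have hD2 : D ^ 2 ≤ 1 := by
    rw [← sq_abs]; exact pow_le_one₀ (abs_nonneg _) hD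
  have h1 := exp_le_one_add_add_sq hx
  have h2 := exp_le_one_add_add_sq (x := -(θ * D)) (by rwa [abs_neg])
  have h3 : (θ * D) ^ 2 ≤ θ ^ 2 := by
    rw [mul_pow]; exact mul_le_of_le_one_right (sq_nonneg _) hD2
  have e1 : Real.exp (θ * (S + D)) ≤ Real.exp (θ * S) * (1 + θ * D + θ ^ 2) := by
    rw [mul_add, Real.exp_add]
    exact mul_le_mul_of_nonneg_left (by linarith) (Real.exp_pos _).le
  have e2 : Real.exp (-(θ * (S + D))) ≤ Real.exp (-(θ * S)) * (1 - θ * D + θ ^ 2) := by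
    rw [mul_add, neg_add, Real.exp_add]
    exact mul_le_mul_of_nonneg_left (by nlinarith) (Real.exp_pos _).le
  rw [Real.cosh_eq, Real.cosh_eq, Real.sinh_eq]
  linarith

/-- A path along which all the sums of mean-zero bounded increments stay within the size that
exponential moments predict. -/
lemma exists_path_real {Ω : Type*} [MeasurableSpace Ω] (P : Measure Ω) [IsProbabilityMeasure P]
    {K : Type*} [Fintype K] (D : K → List Ω → Ω → ℝ)
    (hmeas : ∀ k l, Measurable (D k l)) (hb : ∀ k l ω, |D k l ω| ≤ 1)
    (hmean : ∀ k l, ∫ ω, D k l ω ∂P = 0) {G : Set Ω} (hG : ∀ᵐ ω ∂P, ω ∈ G) (M : ℕ) (hM : 1 ≤ M) :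
    ∃ l : List Ω, l.length = M ∧ (∀ ω ∈ l, ω ∈ G) ∧
      ∀ k, |pathSum (D k) l| ≤ √M * Real.log (2 * Real.exp 1 * Fintype.card K) := by
  set θ : ℝ := 1 / √M with hθ
  have hM' : (1 : ℝ) ≤ √M := by
    rw [Real.one_le_sqrt]; exact_mod_cast hM
  have hθ0 : 0 ≤ θ := by positivity
  have hθ1 : θ ≤ 1 := by rw [hθ, div_le_one (by linarith)]; exact hM'
  have h_int : ∀ k l, Integrable (D k l) P := fun k l =>
    Integrable.of_bound (C := 1) (hmeas k l).aestronglyMeasurable (ae_of_all _ fun ω => hb k l ω)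
  have key : ∀ j : ℕ, ∃ l : List Ω, l.length = j ∧ (∀ ω ∈ l, ω ∈ G) ∧
      ∑ k, Real.cosh (θ * pathSum (D k) l) ≤ Fintype.card K * (1 + θ ^ 2) ^ j := by
    intro j
    induction j with
    | zero => exact ⟨[], rfl, by simp, by simp [pathSum]⟩
    | succ j ih =>
      obtain ⟨l, hl, hlG, hle⟩ := ih
      set Φ : Ω → ℝ := fun ω => ∑ k, (Real.cosh (θ * pathSum (D k) l) * (1 + θ ^ 2)
        + θ * Real.sinh (θ * pathSum (D k) l) * D k l ω) with hΦ
      have hki : ∀ k, Integrable (fun ω => Real.cosh (θ * pathSum (D k) l) * (1 + θ ^ 2)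
          + θ * Real.sinh (θ * pathSum (D k) l) * D k l ω) P := fun k =>
        (integrable_const _).add ((h_int k l).const_mul _)
      have hΦi : Integrable Φ P := integrable_finsetSum _ fun k _ => hki k
      have hΦv : ∫ ω, Φ ω ∂P = (∑ k, Real.cosh (θ * pathSum (D k) l)) * (1 + θ ^ 2) := by
        rw [hΦ, integral_finsetSum _ fun k _ => hki k, Finset.sum_mul]
        refine Finset.sum_congr rfl fun k _ => ?_
        rw [integral_add (integrable_const _) ((h_int k l).const_mul _)]
        simp [integral_const_mul, hmean k l]
      -- Some point off the exceptional null set has `Φ` at most its mean; it serves all `k`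
      -- simultaneously.
      obtain ⟨ω, hωG, hω⟩ := exists_notMem_null_le_integral (μ := P) (N := Gᶜ) hΦi hG
      refine ⟨ω :: l, by simp [hl], ?_, ?_⟩
      · intro x hx
        rcases List.mem_cons.1 hx with rfl | hx
        · exact not_not.1 hωG
        · exact hlG x hx
      · calc ∑ k, Real.cosh (θ * pathSum (D k) (ω :: l)) ≤ Φ ω := by
              rw [hΦ]
              exact Finset.sum_le_sum fun k _ => cosh_mul_add_le hθ0 hθ1 (hb k l ω)
          _ ≤ _ := hω
          _ ≤ Fintype.card K * (1 + θ ^ 2) ^ j * (1 + θ ^ 2) := by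
              rw [hΦv]; gcongr
          _ = _ := by ring
  obtain ⟨l, hl, hlG, hle⟩ := key M
  refine ⟨l, hl, hlG, fun k => ?_⟩
  have hpow : (1 + θ ^ 2) ^ M ≤ Real.exp 1 := by
    have h1 : θ ^ 2 = 1 / M := by
      rw [hθ, div_pow, one_pow, Real.sq_sqrt (by positivity)]
    have hM0 : (0 : ℝ) < M := by exact_mod_cast hM
    calc (1 + θ ^ 2) ^ M ≤ (Real.exp (θ ^ 2)) ^ M := by
          gcongr; linarith [Real.add_one_le_exp (θ ^ 2)]
      _ = Real.exp 1 := by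
          rw [← Real.exp_nat_mul, h1]; congr 1; field_simp
  have h1 : Real.cosh (θ * pathSum (D k) l) ≤ Fintype.card K * Real.exp 1 := by
    calc Real.cosh (θ * pathSum (D k) l) ≤ ∑ k, Real.cosh (θ * pathSum (D k) l) :=
          Finset.single_le_sum (f := fun k => Real.cosh (θ * pathSum (D k) l))
            (fun _ _ => (Real.cosh_pos _).le) (Finset.mem_univ k)
      _ ≤ _ := hle
      _ ≤ _ := by gcongr
  have h2 : Real.exp |θ * pathSum (D k) l| ≤ 2 * Real.exp 1 * Fintype.card K := by
    rw [← Real.cosh_abs, Real.cosh_eq] at h1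
    linarith [Real.exp_pos (-|θ * pathSum (D k) l|)]
  have h3 : |θ * pathSum (D k) l| ≤ Real.log (2 * Real.exp 1 * Fintype.card K) := by
    rw [← Real.log_exp |θ * pathSum (D k) l|]
    exact Real.log_le_log (Real.exp_pos _) h2
  rw [abs_mul, abs_of_nonneg hθ0, hθ, one_div, inv_mul_le_iff₀ (by linarith)] at h3
  exact h3

lemma re_pathSum {Ω : Type*} (D : List Ω → Ω → ℂ) (l : List Ω) :
    (pathSum D l).re = pathSum (fun l ω => (D l ω).re) l := by
  induction l with
  | nil => rfl
  | cons ω l ih => simp [pathSum, ih]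

lemma im_pathSum {Ω : Type*} (D : List Ω → Ω → ℂ) (l : List Ω) :
    (pathSum D l).im = pathSum (fun l ω => (D l ω).im) l := by
  induction l with
  | nil => rfl
  | cons ω l ih => simp [pathSum, ih]

lemma exists_path {Ω : Type*} [MeasurableSpace Ω] (P : Measure Ω) [IsProbabilityMeasure P]
    {K : Type*} [Fintype K] (D : K → List Ω → Ω → ℂ)
    (hmeas : ∀ k l, Measurable (D k l)) (hb : ∀ k l ω, ‖D k l ω‖ ≤ 1)
    (hmean : ∀ k l, ∫ ω, D k l ω ∂P = 0) {G : Set Ω} (hG : ∀ᵐ ω ∂P, ω ∈ G) (M : ℕ) (hM : 1 ≤ M) :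
    ∃ l : List Ω, l.length = M ∧ (∀ ω ∈ l, ω ∈ G) ∧
      ∀ k, ‖pathSum (D k) l‖ ≤ 2 * √M * Real.log (4 * Real.exp 1 * Fintype.card K) := by
  have h_int : ∀ k l, Integrable (D k l) P := fun k l =>
    Integrable.of_bound (C := 1) (hmeas k l).aestronglyMeasurable (ae_of_all _ fun ω => hb k l ω)
  -- Real and imaginary parts are treated as separate members of one family, indexed by the Boolean.
  obtain ⟨l, hl, hlG, hle⟩ := exists_path_real P (K := K × Bool)
    (fun k l ω => if k.2 then (D k.1 l ω).re else (D k.1 l ω).im)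
    (fun k l => by
      rcases k with ⟨k, _ | _⟩
      · exact Complex.measurable_im.comp (hmeas k l)
      · exact Complex.measurable_re.comp (hmeas k l))
    (fun k l ω => by
      rcases k with ⟨k, _ | _⟩
      · exact (Complex.abs_im_le_norm _).trans (hb k l ω)
      · exact (Complex.abs_re_le_norm _).trans (hb k l ω))
    (fun k l => by
      rcases k with ⟨k, _ | _⟩
      · have := integral_im (h_int k l)
        simpa [hmean k l] using this
      · have := integral_re (h_int k l)
        simpa [hmean k l] using this) hG M hM
  refine ⟨l, hl, hlG, fun k => ?_⟩
  have hc : 2 * Real.exp 1 * (Fintype.card (K × Bool) : ℝ) = 4 * Real.exp 1 * Fintype.card K := by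
    simp; ring
  rw [hc] at hle
  have h1 := hle (k, true)
  have h2 := hle (k, false)
  simp only [if_true, Bool.false_eq_true, if_false] at h1 h2
  rw [← re_pathSum] at h1
  rw [← im_pathSum] at h2
  have := Complex.norm_le_abs_re_add_abs_im (pathSum (D k) l)
  linarith

/-! ### Random removal of translates -/

/-- The indicator function of a set, with real values. -/
abbrev ind (𝒯 : Set (Torus d)) (x : Torus d) : ℝ := 𝒯.indicator (fun _ => (1 : ℝ)) x

lemma ind_nonneg (𝒯 : Set (Torus d)) (x : Torus d) : 0 ≤ ind 𝒯 x :=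
  Set.indicator_nonneg (fun _ _ => zero_le_one) x

lemma ind_le_one (𝒯 : Set (Torus d)) (x : Torus d) : ind 𝒯 x ≤ 1 :=
  Set.indicator_le_self' (fun _ _ => zero_le_one) x

lemma measurable_ind {𝒯 : Set (Torus d)} (h𝒯 : MeasurableSet 𝒯) : Measurable (ind 𝒯) :=
  measurable_const.indicator h𝒯

/-- The probability that `x` lies in the random set `p z + 𝒯`. -/
def hitProb (P : Measure (Torus d)) (p : ℤ) (𝒯 : Set (Torus d)) (x : Torus d) : ℝ :=
  ∫ z, ind 𝒯 (x - p • z) ∂P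

lemma hitProb_nonneg (P : Measure (Torus d)) (p : ℤ) {𝒯 : Set (Torus d)} (x : Torus d) :
    0 ≤ hitProb P p 𝒯 x :=
  integral_nonneg fun _ => ind_nonneg _ _

section Hit

variable (P : Measure (Torus d)) [IsProbabilityMeasure P] (p : ℤ) {𝒯 : Set (Torus d)}

lemma measurable_ind_sub (h𝒯 : MeasurableSet 𝒯) :
    Measurable fun w : Torus d × Torus d => ind 𝒯 (w.1 - p • w.2) := by
  refine (measurable_ind h𝒯).comp (Continuous.measurable ?_)
  fun_prop

lemma measurable_hitProb (h𝒯 : MeasurableSet 𝒯) : Measurable (hitProb P p 𝒯) :=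
  ((measurable_ind_sub p h𝒯).stronglyMeasurable.integral_prod_right (ν := P)).measurable

lemma integrable_ind_sub (h𝒯 : MeasurableSet 𝒯) (x : Torus d) :
    Integrable (fun z => ind 𝒯 (x - p • z)) P :=
  Integrable.of_bound (C := 1)
    ((measurable_ind_sub p h𝒯).comp measurable_prodMk_left).aestronglyMeasurable
    (ae_of_all _ fun z => by
      rw [Real.norm_of_nonneg (ind_nonneg _ _)]; exact ind_le_one _ _)

lemma hitProb_le_one (h𝒯 : MeasurableSet 𝒯) (x : Torus d) : hitProb P p 𝒯 x ≤ 1 := by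
  calc hitProb P p 𝒯 x ≤ ∫ _z, (1 : ℝ) ∂P :=
        integral_mono (integrable_ind_sub P p h𝒯 x) (integrable_const _) fun z => ind_le_one _ _
    _ = 1 := by simp

lemma integral_ind_sub (h𝒯 : MeasurableSet 𝒯) (z : Torus d) :
    ∫ x, ind 𝒯 (x - p • z) = volume.real 𝒯 := by
  rw [integral_sub_right_eq_self (fun x => ind 𝒯 x)]
  simp [ind, integral_indicator h𝒯]

lemma integrable_ind_sub_prod (h𝒯 : MeasurableSet 𝒯) :
    Integrable (fun w : Torus d × Torus d => ind 𝒯 (w.1 - p • w.2)) (volume.prod P) :=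
  Integrable.of_bound (C := 1) (measurable_ind_sub p h𝒯).aestronglyMeasurable
    (ae_of_all _ fun z => by
      rw [Real.norm_of_nonneg (ind_nonneg _ _)]; exact ind_le_one _ _)

lemma integral_hitProb (h𝒯 : MeasurableSet 𝒯) :
    ∫ x, hitProb P p 𝒯 x = volume.real 𝒯 := by
  simp only [hitProb]
  rw [integral_integral_swap (integrable_ind_sub_prod P p h𝒯)]
  simp [integral_ind_sub p h𝒯]

/-- The increments that record the removal of one more random set `p z + 𝒯`. -/
def removalStep (P : Measure (Torus d)) (p : ℤ) (𝒯 : Set (Torus d)) (Ψ : Torus d → ℂ)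
    (z : Torus d) : ℂ := ∫ x, Ψ x * ((hitProb P p 𝒯 x - ind 𝒯 (x - p • z) : ℝ) : ℂ)

lemma measurable_removal_integrand (h𝒯 : MeasurableSet 𝒯) {Ψ : Torus d → ℂ} (hΨ : Measurable Ψ) :
    Measurable fun w : Torus d × Torus d =>
      Ψ w.1 * ((hitProb P p 𝒯 w.1 - ind 𝒯 (w.1 - p • w.2) : ℝ) : ℂ) :=
  (hΨ.comp measurable_fst).mul (Complex.measurable_ofReal.comp
    (((measurable_hitProb P p h𝒯).comp measurable_fst).sub (measurable_ind_sub p h𝒯)))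

lemma measurable_removalStep (h𝒯 : MeasurableSet 𝒯) {Ψ : Torus d → ℂ} (hΨ : Measurable Ψ) :
    Measurable (removalStep P p 𝒯 Ψ) :=
  ((measurable_removal_integrand P p h𝒯 hΨ).stronglyMeasurable.integral_prod_left
    (μ := volume)).measurable

/-- The hitting probability and the indicator both integrate to the volume of `𝒯`, so an increment
is bounded by the small volume and not merely by the size of `Ψ`. -/
lemma norm_removalStep_le (h𝒯 : MeasurableSet 𝒯) {Ψ : Torus d → ℂ} {G : ℝ}
    (hG : ∀ x, ‖Ψ x‖ ≤ G) (z : Torus d) :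
    ‖removalStep P p 𝒯 Ψ z‖ ≤ 2 * G * volume.real 𝒯 := by
  have hG0 : 0 ≤ G := (norm_nonneg _).trans (hG 0)
  have h1 : Integrable (hitProb P p 𝒯) :=
    Integrable.of_bound (C := 1) (measurable_hitProb P p h𝒯).aestronglyMeasurable
      (ae_of_all _ fun x => by
        rw [Real.norm_of_nonneg (hitProb_nonneg P p x)]; exact hitProb_le_one P p h𝒯 x)
  have h2 : Integrable (fun x => ind 𝒯 (x - p • z)) :=
    Integrable.of_bound (C := 1)
      ((measurable_ind_sub p h𝒯).comp measurable_prodMk_right).aestronglyMeasurable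
      (ae_of_all _ fun x => by
        rw [Real.norm_of_nonneg (ind_nonneg _ _)]; exact ind_le_one _ _)
  calc ‖removalStep P p 𝒯 Ψ z‖ ≤ ∫ x, G * (hitProb P p 𝒯 x + ind 𝒯 (x - p • z)) := by
        refine norm_integral_le_of_norm_le ((h1.add h2).const_mul G) (ae_of_all _ fun x => ?_)
        rw [norm_mul, Complex.norm_real]
        refine mul_le_mul (hG x) ?_ (norm_nonneg _) hG0
        refine (norm_sub_le _ _).trans ?_
        rw [Real.norm_of_nonneg (hitProb_nonneg P p x), Real.norm_of_nonneg (ind_nonneg _ _)]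
    _ = _ := by
        rw [integral_const_mul, integral_add h1 h2, integral_hitProb P p h𝒯,
          integral_ind_sub p h𝒯]
        ring

/-- After exchanging the integrals, the average of the indicator over `z` is the hitting probability
by definition. -/
lemma integral_removalStep (h𝒯 : MeasurableSet 𝒯) {Ψ : Torus d → ℂ} (hΨ : Measurable Ψ) {G : ℝ}
    (hG : ∀ x, ‖Ψ x‖ ≤ G) : ∫ z, removalStep P p 𝒯 Ψ z ∂P = 0 := by
  have hG0 : 0 ≤ G := (norm_nonneg _).trans (hG 0)
  have hi : Integrable (fun w : Torus d × Torus d =>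
      Ψ w.1 * ((hitProb P p 𝒯 w.1 - ind 𝒯 (w.1 - p • w.2) : ℝ) : ℂ)) (volume.prod P) := by
    refine Integrable.of_bound (C := G * 1)
      (measurable_removal_integrand P p h𝒯 hΨ).aestronglyMeasurable (ae_of_all _ fun w => ?_)
    rw [norm_mul, Complex.norm_real]
    refine mul_le_mul (hG _) ?_ (norm_nonneg _) hG0
    rw [Real.norm_eq_abs, abs_le]
    have := hitProb_nonneg P p (𝒯 := 𝒯) w.1
    have := hitProb_le_one P p h𝒯 w.1
    have := ind_nonneg 𝒯 (w.1 - p • w.2)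
    have := ind_le_one 𝒯 (w.1 - p • w.2)
    constructor <;> linarith
  simp only [removalStep]
  rw [← integral_integral_swap hi]
  refine integral_eq_zero_of_ae (ae_of_all _ fun x => ?_)
  simp only [Pi.zero_apply]
  rw [integral_const_mul, integral_complex_ofReal,
    integral_sub (integrable_const _) (integrable_ind_sub P p h𝒯 x)]
  simp [hitProb]

end Hit

/-- The indicator function of the complement of the sets `p z + 𝒯`, `z ∈ l`. -/
def keep (p : ℤ) (𝒯 : Set (Torus d)) : List (Torus d) → Torus d → ℝ
  | [], _ => 1
  | z :: l, x => keep p 𝒯 l x * (1 - ind 𝒯 (x - p • z))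

lemma keep_eq_indicator (p : ℤ) (𝒯 : Set (Torus d)) (l : List (Torus d)) (x : Torus d) :
    keep p 𝒯 l x = {x | ∀ z ∈ l, x - p • z ∉ 𝒯}.indicator (fun _ => 1) x := by
  classical
  induction l with
  | nil => simp [keep]
  | cons z l ih =>
    rw [keep, ih]
    simp only [ind, Set.indicator_apply, Set.mem_ofPred_eq, List.forall_mem_cons]
    by_cases h1 : x - p • z ∈ 𝒯 <;> by_cases h2 : ∀ z ∈ l, x - p • z ∉ 𝒯 <;> simp [h1, h2]

lemma measurable_keep (p : ℤ) {𝒯 : Set (Torus d)} (h𝒯 : MeasurableSet 𝒯) (l : List (Torus d)) :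
    Measurable (keep p 𝒯 l) := by
  induction l with
  | nil => exact measurable_const
  | cons z l ih =>
    exact ih.mul (measurable_const.sub ((measurable_ind_sub p h𝒯).comp measurable_prodMk_right))

lemma keep_nonneg (p : ℤ) (𝒯 : Set (Torus d)) (l : List (Torus d)) (x : Torus d) :
    0 ≤ keep p 𝒯 l x := by
  rw [keep_eq_indicator]; exact Set.indicator_nonneg (fun _ _ => zero_le_one) x

lemma keep_le_one (p : ℤ) (𝒯 : Set (Torus d)) (l : List (Torus d)) (x : Torus d) :
    keep p 𝒯 l x ≤ 1 := by
  rw [keep_eq_indicator]; exact Set.indicator_le_self' (fun _ _ => zero_le_one) x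

/-- The martingale interpolating between the expected and the actual Fourier coefficient of `g`
after the removal of `M` random sets. -/
def removalMart (P : Measure (Torus d)) (p : ℤ) (𝒯 : Set (Torus d)) (g : Torus d → ℝ) (M : ℕ)
    (ξ : Fin d → ℤ) (l : List (Torus d)) : ℂ :=
  ∫ x, ((g x * keep p 𝒯 l x * (1 - hitProb P p 𝒯 x) ^ (M - l.length) : ℝ) : ℂ) * mFourier (-ξ) x

/-- The weight of the increment of `removalMart`. -/
def removalWeight (P : Measure (Torus d)) (p : ℤ) (𝒯 : Set (Torus d)) (g : Torus d → ℝ) (M : ℕ)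
    (ξ : Fin d → ℤ) (l : List (Torus d)) (x : Torus d) : ℂ :=
  ((g x * keep p 𝒯 l x * (1 - hitProb P p 𝒯 x) ^ (M - 1 - l.length) : ℝ) : ℂ) * mFourier (-ξ) x

section Mart

variable (P : Measure (Torus d)) [IsProbabilityMeasure P] (p : ℤ) {𝒯 : Set (Torus d)}
  {g : Torus d → ℝ} {G : ℝ} (M : ℕ) (ξ : Fin d → ℤ) (l : List (Torus d))

lemma measurable_removalWeight (h𝒯 : MeasurableSet 𝒯) (hg : Measurable g) :
    Measurable (removalWeight P p 𝒯 g M ξ l) :=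
  (Complex.measurable_ofReal.comp ((hg.mul (measurable_keep p h𝒯 l)).mul
    ((measurable_const.sub (measurable_hitProb P p h𝒯)).pow_const _))).mul
    (mFourier (-ξ)).continuous.measurable

lemma norm_mart_integrand_le (h𝒯 : MeasurableSet 𝒯) (hG : ∀ x, |g x| ≤ G) (k : ℕ) (x : Torus d) :
    ‖((g x * keep p 𝒯 l x * (1 - hitProb P p 𝒯 x) ^ k : ℝ) : ℂ) * mFourier (-ξ) x‖ ≤ G := by
  have h1 := hitProb_nonneg P p (𝒯 := 𝒯) x
  have h2 := hitProb_le_one P p h𝒯 x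
  rw [norm_mul, norm_mFourier_apply, mul_one, Complex.norm_real, Real.norm_eq_abs, abs_mul, abs_mul,
    abs_of_nonneg (keep_nonneg _ _ _ _),
    abs_of_nonneg (pow_nonneg (by linarith : 0 ≤ 1 - hitProb P p 𝒯 x) k)]
  calc _ ≤ |g x| * 1 * 1 := by
        gcongr
        · exact keep_le_one _ _ _ _
        · exact pow_le_one₀ (by linarith) (by linarith)
    _ ≤ G := by simpa using hG x

/-- One more removal replaces one factor `1 - hitProb` by the actual factor `1 - ind`; the remaining
factors form the weight of the step. -/
lemma removalMart_cons (h𝒯 : MeasurableSet 𝒯) (hg : Measurable g) (hG : ∀ x, |g x| ≤ G)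
    (z : Torus d) (hl : l.length < M) :
    removalMart P p 𝒯 g M ξ (z :: l) = removalMart P p 𝒯 g M ξ l
      + removalStep P p 𝒯 (removalWeight P p 𝒯 g M ξ l) z := by
  have hi : ∀ (l : List (Torus d)) (k : ℕ), Integrable (fun x =>
      ((g x * keep p 𝒯 l x * (1 - hitProb P p 𝒯 x) ^ k : ℝ) : ℂ) * mFourier (-ξ) x) := by
    intro l k
    refine Integrable.of_bound (C := G) (Measurable.aestronglyMeasurable ?_)
      (ae_of_all _ fun x => norm_mart_integrand_le P p ξ l h𝒯 hG k x)
    exact (Complex.measurable_ofReal.comp ((hg.mul (measurable_keep p h𝒯 l)).mul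
      ((measurable_const.sub (measurable_hitProb P p h𝒯)).pow_const _))).mul
      (mFourier (-ξ)).continuous.measurable
  rw [← sub_eq_iff_eq_add', removalMart, removalMart, ← integral_sub (hi _ _) (hi _ _), removalStep]
  congr 1
  ext x
  -- Naming the number `k` of removals still to come eliminates the truncated subtractions in the
  -- exponents.
  obtain ⟨k, hk⟩ : ∃ k, M = l.length + 1 + k := ⟨M - (l.length + 1), by omega⟩
  have e1 : M - (z :: l).length = k := by simp; omega
  have e2 : M - l.length = k + 1 := by omega
  have e3 : M - 1 - l.length = k := by omega
  rw [removalWeight, e1, e2, e3, keep]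
  push_cast
  ring

lemma pathSum_removalStep (h𝒯 : MeasurableSet 𝒯) (hg : Measurable g) (hG : ∀ x, |g x| ≤ G) (A : ℂ)
    (hl : l.length ≤ M) :
    pathSum (fun l z => A * removalStep P p 𝒯 (removalWeight P p 𝒯 g M ξ l) z) l
      = A * (removalMart P p 𝒯 g M ξ l - removalMart P p 𝒯 g M ξ []) := by
  induction l with
  | nil => simp [pathSum]
  | cons z l ih =>
    rw [pathSum, ih (by simp at hl; omega), removalMart_cons P p M ξ l h𝒯 hg hG z (by simpa using hl)]
    ring

end Mart

lemma AbsRep.norm_apply_le {m : ℕ} {f : Torus d → ℂ} {C : ℝ} (h : AbsRep m f C) (x : Torus d) :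
    ‖f x‖ ≤ C := by
  obtain ⟨ι, _, c, ξ, hs, h2, hf⟩ := h
  rw [← (hf x).tsum_eq]
  have h0 : ∀ i, ‖c i * mFourier (ξ i) x‖ = ‖c i‖ := fun i => by
    rw [norm_mul, norm_mFourier_apply, mul_one]
  have hs' := summable_norm_of_weighted hs
  refine (norm_tsum_le_tsum_norm (by simpa only [h0] using hs')).trans ?_
  simp only [h0]
  refine le_trans (hs'.tsum_le_tsum (fun i => ?_) hs) h2
  exact le_mul_of_one_le_right (norm_nonneg _) (one_le_pow₀ (by linarith [norm_nonneg (ξ i)]))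

/-! ### The sampling law and its hitting probabilities -/

lemma measurePreserving_zsmul_torus {n : ℤ} (hn : n ≠ 0) :
    MeasurePreserving (fun x : Torus d => n • x) volume volume :=
  MeasureTheory.Measure.measurePreserving_zsmul _ hn

lemma measurePreserving_sub_zsmul {n : ℤ} (hn : n ≠ 0) (x : Torus d) :
    MeasurePreserving (fun z : Torus d => x - n • z) volume volume := by
  have h := (measurePreserving_add_left volume x).comp
    (measurePreserving_zsmul_torus (d := d) (neg_ne_zero.2 hn))
  simpa only [Function.comp_def, neg_smul, ← sub_eq_add_neg] using h

lemma integral_comp_of_measurePreserving {φ : Torus d → Torus d}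
    (h : MeasurePreserving φ volume volume) {u : Torus d → ℂ} (hu : Measurable u) :
    ∫ z, u (φ z) = ∫ x, u x := by
  have := integral_map (μ := volume) h.measurable.aemeasurable (f := u)
    hu.aestronglyMeasurable
  rw [h.map_eq] at this
  exact this.symm

/-- The law of the sampled points: the density is `f (q z) / m`. -/
def sampleLaw (f : Torus d → ℝ) (q : ℤ) (m : ℝ) : Measure (Torus d) :=
  volume.withDensity fun z => ENNReal.ofReal (f (q • z) / m)

section Sample

variable {f : Torus d → ℝ} {q : ℤ} {m : ℝ}

lemma integral_sampleLaw (hf : Continuous f) (hf0 : ∀ x, 0 ≤ f x) (hm0 : 0 < m)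
    (u : Torus d → ℂ) :
    ∫ z, u z ∂(sampleLaw f q m) = ∫ z, ((f (q • z) / m : ℝ) : ℂ) * u z := by
  have h := integral_withDensity_eq_integral_smul (μ := (volume : Measure (Torus d)))
    (f := fun z => Real.toNNReal (f (q • z) / m)) (by fun_prop) u
  refine h.trans (integral_congr_ae (ae_of_all _ fun x => ?_))
  have : 0 ≤ f (q • x) / m := div_nonneg (hf0 _) hm0.le
  simp only [NNReal.smul_def, Real.coe_toNNReal _ this, Complex.real_smul]

lemma isProbabilityMeasure_sampleLaw (hf : Continuous f) (hf0 : ∀ x, 0 ≤ f x) (hq : q ≠ 0)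
    (hm : ∫ x, f x = m) (hm0 : 0 < m) : IsProbabilityMeasure (sampleLaw f q m) := by
  refine ⟨?_⟩
  rw [sampleLaw, withDensity_apply _ MeasurableSet.univ, Measure.restrict_univ]
  have h1 : ∫⁻ z : Torus d, ENNReal.ofReal (f (q • z) / m)
      = ∫⁻ x : Torus d, ENNReal.ofReal (f x / m) :=
    (measurePreserving_zsmul_torus hq).lintegral_comp
      (f := fun x => ENNReal.ofReal (f x / m)) (by fun_prop)
  have hi : Integrable f (volume : Measure (Torus d)) :=
    hf.integrable_of_hasCompactSupport (HasCompactSupport.of_compactSpace f)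
  rw [h1, ← ofReal_integral_eq_lintegral_ofReal (hi.div_const m)
    (ae_of_all _ fun x => div_nonneg (hf0 x) hm0.le), integral_div, hm, div_self hm0.ne',
    ENNReal.ofReal_one]

lemma ae_sampleLaw_ne_zero (hf : Continuous f) : ∀ᵐ z ∂(sampleLaw f q m), f (q • z) ≠ 0 := by
  rw [sampleLaw, ae_withDensity_iff (by fun_prop)]
  refine ae_of_all _ fun z hz h => hz ?_
  simp [h]

lemma integral_mFourier_sampleLaw (hf : Continuous f) (hf0 : ∀ x, 0 ≤ f x) (hq : q ≠ 0)
    (hm0 : 0 < m) (ξ : Fin d → ℤ) :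
    ∫ z, mFourier (-ξ) (q • z) ∂(sampleLaw f q m) = coeff (fun x => (f x : ℂ)) ξ / m := by
  rw [integral_sampleLaw hf hf0 hm0]
  have h := integral_comp_of_measurePreserving (measurePreserving_zsmul_torus (d := d) hq)
    (u := fun x => ((f x / m : ℝ) : ℂ) * mFourier (-ξ) x)
    (by exact Continuous.measurable (by fun_prop))
  refine h.trans ?_
  rw [coeff, ← integral_div]
  congr 1
  ext x
  push_cast
  ring

/-- The function `z ↦ e(q ξ · z)` averaged over the fibre `x - p z ∈ 𝒯` is a multiple of a single
exponential in `x`. -/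
lemma exists_integral_ind_mul_mFourier {p : ℤ} (hp : p ≠ 0) (q : ℤ) {𝒯 : Set (Torus d)}
    (h𝒯 : MeasurableSet 𝒯) (ξ : Fin d → ℤ) :
    ∃ (a : ℂ) (η : Fin d → ℤ), ‖a‖ ≤ volume.real 𝒯 ∧ ‖η‖ ≤ |(q : ℝ)| * ‖ξ‖ ∧
      ∀ x : Torus d, ∫ z, (ind 𝒯 (x - p • z) : ℂ) * mFourier ξ (q • z) = a * mFourier η x := by
  -- If `p η = q ξ`, then `e(q ξ · z)` is `e(η · x)` times a function of `x - p z`, whose law is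
  -- Lebesgue measure. Otherwise a translation by a `p`-torsion point shows that the average
  -- vanishes.
  by_cases h : ∃ η : Fin d → ℤ, p • η = q • ξ
  · obtain ⟨η, hη⟩ := h
    refine ⟨∫ u, (ind 𝒯 u : ℂ) * mFourier (-η) u, η, ?_, ?_, fun x => ?_⟩
    · refine (norm_integral_le_integral_norm _).trans (le_of_eq ?_)
      simp only [norm_mul, norm_mFourier_apply, mul_one, Complex.norm_real,
        Real.norm_of_nonneg (ind_nonneg _ _)]
      simp [ind, integral_indicator h𝒯]
    · have h1 : ‖p • η‖ = |(p : ℝ)| * ‖η‖ := by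
        rw [norm_smul, Int.norm_eq_abs]
      have h2 : ‖q • ξ‖ = |(q : ℝ)| * ‖ξ‖ := by
        rw [norm_smul, Int.norm_eq_abs]
      rw [← h2, ← hη, h1]
      refine le_mul_of_one_le_left (norm_nonneg _) ?_
      exact_mod_cast Int.one_le_abs hp
    · have h1 := integral_comp_of_measurePreserving (measurePreserving_sub_zsmul (d := d) hp x)
        (u := fun u => (ind 𝒯 u : ℂ) * mFourier (-η) u)
        ((Complex.measurable_ofReal.comp (measurable_ind h𝒯)).mul
          (mFourier (-η)).continuous.measurable)
      rw [← h1, ← integral_mul_const]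
      congr 1
      ext z
      have h3 : mFourier ξ (q • z) = mFourier (-η) (x - p • z) * mFourier η x := by
        rw [mFourier_apply_sub, mFourier_apply_zsmul, mFourier_apply_zsmul, neg_neg, hη,
          mul_right_comm, mFourier_neg_mul_self, one_mul]
      rw [h3, mul_assoc]
  · refine ⟨0, 0, by simp, by simp; positivity, fun x => ?_⟩
    rw [zero_mul]
    obtain ⟨i, hi⟩ : ∃ i, ¬ p ∣ q * ξ i := by
      by_contra! hc
      choose η hη using hc
      exact h ⟨η, by ext i; simp [hη i]⟩
    have hp' : ((p : ℤ) : ℝ) ≠ 0 := by exact_mod_cast hp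
    -- This point satisfies `p t = 0`, but `e(q ξ · t) ≠ 1` because `p` does not divide `q * ξ i`.
    set t : Torus d := Pi.single i (((1 / (p : ℝ) : ℝ)) : UnitAddCircle) with ht
    have hpt : p • t = 0 := by
      ext j
      by_cases hj : j = i
      · subst hj
        simp only [ht, Pi.smul_apply, Pi.single_eq_same, Pi.zero_apply]
        rw [← AddCircle.coe_zsmul, zsmul_eq_mul, mul_one_div_cancel hp']
        exact AddCircle.coe_period 1
      · simp [ht, Pi.single_eq_of_ne hj]
    have hne : mFourier ξ (q • t) ≠ 1 := by
      rw [mFourier_apply_zsmul]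
      have : mFourier (q • ξ) t = fourier (q * ξ i) (((1 / (p : ℝ) : ℝ)) : UnitAddCircle) := by
        simp only [mFourier, ContinuousMap.coe_mk]
        rw [Finset.prod_eq_single i]
        · simp [ht]
        · intro j _ hj
          simp [ht, Pi.single_eq_of_ne hj]
        · simp
      rw [this, fourier_coe_apply]
      intro h1
      rw [Complex.exp_eq_one_iff] at h1
      obtain ⟨n, hn⟩ := h1
      apply hi
      refine ⟨n, ?_⟩
      have h2 : (2 * (Real.pi : ℂ) * Complex.I) ≠ 0 := Complex.two_pi_I_ne_zero
      have hpc : ((p : ℤ) : ℂ) ≠ 0 := by exact_mod_cast hp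
      have h3 : (2 * (Real.pi : ℂ) * Complex.I) * ((q * ξ i : ℤ) : ℂ)
          = (2 * (Real.pi : ℂ) * Complex.I) * ((p : ℂ) * n) := by
        push_cast at hn ⊢
        field_simp at hn
        linear_combination (Complex.I * Real.pi * 2) * hn
      have h4 := mul_left_cancel₀ h2 h3
      exact_mod_cast h4
    have h1 := integral_add_right_eq_self (μ := (volume : Measure (Torus d)))
      (fun z => (ind 𝒯 (x - p • z) : ℂ) * mFourier ξ (q • z)) t
    simp only [smul_add, hpt, add_zero, mFourier_apply_add, ← mul_assoc] at h1
    rw [integral_mul_const] at h1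
    have h2 : (∫ z, (ind 𝒯 (x - p • z) : ℂ) * mFourier ξ (q • z)) * (mFourier ξ (q • t) - 1) = 0 := by
      rw [mul_sub, h1]; ring
    exact (mul_eq_zero.1 h2).resolve_right (sub_ne_zero.2 hne)

/-- Expanding `f (q z)` into characters, each one averages to a multiple of a single character by
`exists_integral_ind_mul_mFourier`. The norm gains the volume of `𝒯`, and the frequencies grow by at
most the factor `|q|`. -/
lemma absRep_hitProb (hf : Continuous f) (hf0 : ∀ x, 0 ≤ f x)
    (hm0 : 0 < m) {N : ℕ} {C τ : ℝ} (hC : AbsRep N (fun x => (f x : ℂ)) C) {p : ℤ} (hp : p ≠ 0)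
    {𝒯 : Set (Torus d)} (h𝒯 : MeasurableSet 𝒯) (hτ : volume.real 𝒯 ≤ τ) :
    AbsRep N (fun x => (hitProb (sampleLaw f q m) p 𝒯 x : ℂ))
      (τ / m * (1 + |(q : ℝ)|) ^ N * C) := by
  have hτ0 : 0 ≤ τ := measureReal_nonneg.trans hτ
  obtain ⟨ι, hι, c, ξ, hs, hC', hsum⟩ := hC
  choose a η ha hη hI using fun i => exists_integral_ind_mul_mFourier hp q h𝒯 (ξ i)
  have hle : ∀ i, ‖c i / m * a i‖ * (1 + ‖η i‖) ^ N
      ≤ (τ / m * (1 + |(q : ℝ)|) ^ N) * (‖c i‖ * (1 + ‖ξ i‖) ^ N) := by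
    intro i
    have h1 : 1 + ‖η i‖ ≤ (1 + |(q : ℝ)|) * (1 + ‖ξ i‖) := by
      nlinarith [hη i, norm_nonneg (ξ i), abs_nonneg (q : ℝ)]
    rw [norm_mul, norm_div, Complex.norm_real, Real.norm_of_nonneg hm0.le]
    calc ‖c i‖ / m * ‖a i‖ * (1 + ‖η i‖) ^ N
        ≤ ‖c i‖ / m * τ * ((1 + |(q : ℝ)|) * (1 + ‖ξ i‖)) ^ N := by
          gcongr
          exact (ha i).trans hτ
      _ = _ := by rw [mul_pow]; ring
  have hs' : Summable fun i => ‖c i / m * a i‖ * (1 + ‖η i‖) ^ N :=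
    Summable.of_nonneg_of_le (fun _ => by positivity) hle (hs.mul_left _)
  refine ⟨ι, hι, fun i => c i / m * a i, η, hs', ?_, fun x => ?_⟩
  · refine (hs'.tsum_le_tsum hle (hs.mul_left _)).trans ?_
    rw [tsum_mul_left]
    gcongr
  · have hmeas : Measurable fun z => (ind 𝒯 (x - p • z) : ℂ) :=
      Complex.measurable_ofReal.comp ((measurable_ind_sub p h𝒯).comp measurable_prodMk_left)
    have h_int : Integrable (fun z => (ind 𝒯 (x - p • z) : ℂ)) (volume : Measure (Torus d)) :=
      Integrable.of_bound (C := 1) hmeas.aestronglyMeasurable (ae_of_all _ fun z => by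
        rw [Complex.norm_real, Real.norm_of_nonneg (ind_nonneg _ _)]; exact ind_le_one _ _)
    have h1 := hasSum_integral_mul (c := c) (F := fun i z => mFourier (ξ i) (q • z))
      (f := fun z => (f (q • z) : ℂ)) (summable_norm_of_weighted hs)
      (fun i => Continuous.measurable (by fun_prop)) (fun i z => (norm_mFourier_apply _ _).le)
      (fun z => hsum _) volume h_int
    have h2 : (hitProb (sampleLaw f q m) p 𝒯 x : ℂ)
        = (∫ z, (f (q • z) : ℂ) * (ind 𝒯 (x - p • z) : ℂ)) / m := by
      rw [hitProb, ← integral_complex_ofReal, integral_sampleLaw hf hf0 hm0, ← integral_div]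
      congr 1
      ext z
      push_cast
      ring
    beta_reduce
    rw [h2]
    refine (h1.div_const (m : ℂ)).congr_fun fun i => ?_
    have h3 : ∫ z, mFourier (ξ i) (q • z) * (ind 𝒯 (x - p • z) : ℂ) = a i * mFourier (η i) x := by
      rw [← hI i x]
      congr 1
      ext z
      rw [mul_comm]
    rw [h3]
    ring

end Sample

/-! ### Simultaneous choice of the sample points -/

/-- With `v` the function for exponent `M`, the one for `M + 1` is `v + u - v u`; the bounds obey
the same recursion with a plus sign. For `C` of size `o(1 / M)` the result is small. -/
lemma AbsRep.one_sub_one_sub_pow {N : ℕ} {u : Torus d → ℂ} {C : ℝ} (h : AbsRep N u C) (M : ℕ) :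
    AbsRep N (fun x => 1 - (1 - u x) ^ M) ((1 + C) ^ M - 1) := by
  induction M with
  | zero =>
    refine ⟨Empty, inferInstance, fun _ => 0, fun _ => 0, ?_, ?_, fun x => ?_⟩
    · exact summable_empty
    · simp
    · simp
  | succ M ih =>
    have h1 := (ih.add h).add ((ih.mul h).const_mul (-1))
    convert h1 using 1
    · ext x; ring
    · simp; ring

lemma pathSum_const {Ω : Type*} (A B : ℂ) (u : Ω → ℂ) (l : List Ω) :
    pathSum (fun _ ω => A * (u ω - B)) l = A * ((l.map u).sum - l.length * B) := by
  induction l with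
  | nil => simp [pathSum]
  | cons ω l ih =>
    rw [pathSum, ih]
    simp only [List.map_cons, List.sum_cons, List.length_cons]
    push_cast
    ring

/-- Points sampled from `f` whose exponential sums, and whose effect on the Fourier coefficients of
`g` after removing the sets `p z + 𝒯`, are simultaneously of square-root size. -/
lemma exists_sample {f g : Torus d → ℝ} {N : ℕ} {Cf Cg m τ : ℝ}
    (hf0 : ∀ x, 0 ≤ f x) (hf : AbsRep N (fun x => (f x : ℂ)) Cf)
    (hg : AbsRep N (fun x => (g x : ℂ)) Cg) (hm : ∫ x, f x = m) (hm0 : 0 < m) {q p : ℤ}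
    (hq : q ≠ 0) (hp : p ≠ 0) {𝒯 : Set (Torus d)} (h𝒯 : MeasurableSet 𝒯)
    (hτ : volume.real 𝒯 ≤ τ) (hτ0 : 0 < τ) (Ξ : Finset (Fin d → ℤ)) {M : ℕ} (hM : 1 ≤ M) :
    ∃ l : List (Torus d), l.length = M ∧ (∀ z ∈ l, f (q • z) ≠ 0) ∧
      (∀ ξ ∈ Ξ, ‖(l.map fun z => mFourier (-ξ) (q • z)).sum
          - M * (coeff (fun x => (f x : ℂ)) ξ / m)‖
        ≤ 4 * √M * Real.log (8 * Real.exp 1 * Ξ.card)) ∧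
      (∀ ξ ∈ Ξ, ‖coeff (fun x => ((g x * keep p 𝒯 l x : ℝ) : ℂ)) ξ - coeff (fun x => (g x : ℂ)) ξ‖
        ≤ 4 * (Cg + 1) * τ * √M * Real.log (8 * Real.exp 1 * Ξ.card)
          + Cg * ((1 + τ / m * (1 + |(q : ℝ)|) ^ N * Cf) ^ M - 1) / (1 + ‖ξ‖) ^ N) := by
  have hfc : Continuous f := Complex.continuous_re.comp hf.continuous
  have hgc : Continuous g := Complex.continuous_re.comp hg.continuous
  set P := sampleLaw f q m with hP
  have hPp : IsProbabilityMeasure P := isProbabilityMeasure_sampleLaw hfc hf0 hq hm hm0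
  have hCg : 0 ≤ Cg := hg.nonneg
  -- Adding one keeps the normalizing constant `A` below well defined even if `Cg = 0`.
  set G := Cg + 1 with hGdef
  have hG0 : 0 < G := by positivity
  have hG : ∀ x, |g x| ≤ G := fun x => by
    have := hg.norm_apply_le x
    rw [Complex.norm_real, Real.norm_eq_abs] at this
    linarith
  set A : ℂ := ((1 / (2 * G * τ) : ℝ) : ℂ) with hA
  have hA0 : A ≠ 0 := by rw [hA]; exact_mod_cast (by positivity)
  have hAn : ‖A‖ = 1 / (2 * G * τ) := by
    rw [hA, Complex.norm_real, Real.norm_of_nonneg (by positivity)]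
  set Blin : (Fin d → ℤ) → ℂ := fun ξ => ∫ z, mFourier (-ξ) (q • z) ∂P with hBlin
  have hlinm : ∀ ξ : Fin d → ℤ, Measurable fun z : Torus d => mFourier (-ξ) (q • z) := fun ξ =>
    Continuous.measurable (by fun_prop)
  have hlini : ∀ ξ : Fin d → ℤ, Integrable (fun z : Torus d => mFourier (-ξ) (q • z)) P := fun ξ =>
    Integrable.of_bound (C := 1) (hlinm ξ).aestronglyMeasurable
      (ae_of_all _ fun z => (norm_mFourier_apply _ _).le)
  have hBn : ∀ ξ, ‖Blin ξ‖ ≤ 1 := fun ξ => by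
    refine (norm_integral_le_of_norm_le_const (C := 1)
      (ae_of_all _ fun x => (norm_mFourier_apply _ _).le)).trans ?_
    simp
  have hweight : ∀ ξ l x, ‖removalWeight P p 𝒯 g M ξ l x‖ ≤ G := fun ξ l x =>
    norm_mart_integrand_le P p ξ l h𝒯 hG _ x
  -- Two families of increments per frequency: `true` records the exponential sum, `false` the
  -- removal martingale. The factors `1 / 2` and `A` normalize them to size at most one.
  obtain ⟨l, hl, hlG, hle⟩ := exists_path P (K := Ξ × Bool)
    (fun k l z => if k.2 then (1 / 2 : ℂ) * (mFourier (-(k.1 : Fin d → ℤ)) (q • z) - Blin k.1)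
      else A * removalStep P p 𝒯 (removalWeight P p 𝒯 g M k.1 l) z)
    (by
      rintro ⟨ξ, _ | _⟩ l
      · simpa using (measurable_removalStep P p h𝒯
          (measurable_removalWeight P p M ξ l h𝒯 hgc.measurable)).const_mul A
      · simpa using ((hlinm ξ).sub_const _).const_mul (1 / 2 : ℂ))
    (by
      rintro ⟨ξ, _ | _⟩ l z
      · simp only [Bool.false_eq_true, if_false, norm_mul, hAn]
        have h1 := norm_removalStep_le P p h𝒯 (hweight ξ l) z
        rw [one_div, inv_mul_le_iff₀ (by positivity), mul_one]
        exact h1.trans (by gcongr)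
      · simp only [if_true, norm_mul]
        have h1 := norm_sub_le (mFourier (-(ξ : Fin d → ℤ)) (q • z)) (Blin ξ)
        rw [norm_mFourier_apply] at h1
        have h2 := hBn ξ
        have h3 : ‖(1 / 2 : ℂ)‖ = 1 / 2 := by simp
        rw [h3]
        linarith)
    (by
      rintro ⟨ξ, _ | _⟩ l
      · simp only [Bool.false_eq_true, if_false]
        rw [integral_const_mul, integral_removalStep P p h𝒯
          (measurable_removalWeight P p M ξ l h𝒯 hgc.measurable) (hweight ξ l), mul_zero]
      · simp only [if_true]
        rw [integral_const_mul, integral_sub (hlini ξ) (integrable_const _)]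
        simp [hBlin])
    (ae_sampleLaw_ne_zero hfc) M hM
  have hcard : 4 * Real.exp 1 * (Fintype.card (Ξ × Bool) : ℝ) = 8 * Real.exp 1 * Ξ.card := by
    simp; ring
  rw [hcard] at hle
  set Lg := Real.log (8 * Real.exp 1 * Ξ.card) with hLg
  refine ⟨l, hl, hlG, fun ξ hξ => ?_, fun ξ hξ => ?_⟩
  · have h1 := hle (⟨ξ, hξ⟩, true)
    simp only [if_true] at h1
    have hB : Blin ξ = coeff (fun x => (f x : ℂ)) ξ / m :=
      integral_mFourier_sampleLaw hfc hf0 hq hm0 ξ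
    rw [pathSum_const, hl, norm_mul, hB] at h1
    have h3 : ‖(1 / 2 : ℂ)‖ = 1 / 2 := by simp
    rw [h3] at h1
    linarith
  · have h1 := hle (⟨ξ, hξ⟩, false)
    simp only [Bool.false_eq_true, if_false] at h1
    rw [pathSum_removalStep P p M ξ l h𝒯 hgc.measurable hG A hl.le, norm_mul, hAn,
      one_div, inv_mul_le_iff₀ (by positivity)] at h1
    have e1 : removalMart P p 𝒯 g M ξ l = coeff (fun x => ((g x * keep p 𝒯 l x : ℝ) : ℂ)) ξ := by
      simp only [removalMart, coeff, hl, Nat.sub_self, pow_zero, mul_one]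
    have hpr := (absRep_hitProb (q := q) hfc hf0 hm0 hf hp h𝒯 hτ).one_sub_one_sub_pow M
    have hrep := hg.mul hpr
    -- Before any removal the martingale is the coefficient of `g (1 - hitProb) ^ M`, so this
    -- difference is the expected loss.
    have e2 : removalMart P p 𝒯 g M ξ [] - coeff (fun x => (g x : ℂ)) ξ
        = - coeff (fun x => (g x : ℂ) * (1 - (1 - (hitProb P p 𝒯 x : ℂ)) ^ M)) ξ := by
      have i1 : Integrable (fun x => (g x : ℂ) * mFourier (-ξ) x) :=
        Continuous.integrable_of_hasCompactSupport (by fun_prop) (HasCompactSupport.of_compactSpace _)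
      have i2 : Integrable (fun x => (g x : ℂ) * (1 - (1 - (hitProb P p 𝒯 x : ℂ)) ^ M)
          * mFourier (-ξ) x) :=
        Continuous.integrable_of_hasCompactSupport
          (hrep.continuous.mul (mFourier (-ξ)).continuous) (HasCompactSupport.of_compactSpace _)
      rw [sub_eq_iff_eq_add, neg_add_eq_sub, coeff, coeff, ← integral_sub i1 i2, removalMart]
      congr 1
      ext x
      simp only [keep, List.length_nil, Nat.sub_zero]
      push_cast
      ring
    have h2 := hrep.norm_coeff_le ξ
    have h3 : ‖removalMart P p 𝒯 g M ξ [] - coeff (fun x => (g x : ℂ)) ξ‖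
        ≤ Cg * ((1 + τ / m * (1 + |(q : ℝ)|) ^ N * Cf) ^ M - 1) / (1 + ‖ξ‖) ^ N := by
      rw [e2, norm_neg, le_div_iff₀ (by positivity)]
      exact h2
    rw [← e1]
    calc _ = ‖(removalMart P p 𝒯 g M ξ l - removalMart P p 𝒯 g M ξ [])
          + (removalMart P p 𝒯 g M ξ [] - coeff (fun x => (g x : ℂ)) ξ)‖ := by congr 1; ring
      _ ≤ _ := (norm_add_le _ _).trans (add_le_add (h1.trans (le_of_eq (by ring))) h3)

/-! ### Discretization at all small scales -/

/-- The frequencies of size at most `R`. -/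
def freqBox (d : ℕ) (R : ℝ) : Finset (Fin d → ℤ) :=
  Fintype.piFinset fun _ => Finset.Icc (-⌊R⌋) ⌊R⌋

lemma mem_freqBox {R : ℝ} {ξ : Fin d → ℤ} (h : ‖ξ‖ ≤ R) : ξ ∈ freqBox d R := by
  rw [freqBox, Fintype.mem_piFinset]
  intro i
  have h1 := (norm_int_cast_apply_le ξ i).trans h
  rw [Finset.mem_Icc, ← abs_le, Int.le_floor]
  exact_mod_cast h1

lemma one_le_card_freqBox {R : ℝ} (hR : 0 ≤ R) : 1 ≤ (freqBox d R).card :=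
  Finset.card_pos.2 ⟨0, mem_freqBox (by simpa using hR)⟩

lemma card_freqBox_le {R : ℝ} (hR : 1 ≤ R) : ((freqBox d R).card : ℝ) ≤ (3 * R) ^ d := by
  have h0 : 0 ≤ ⌊R⌋ := Int.floor_nonneg.2 (by linarith)
  rw [freqBox, Fintype.card_piFinset]
  simp only [Int.card_Icc, Finset.prod_const, Finset.card_univ, Fintype.card_fin]
  push_cast
  gcongr
  have h1 : (((⌊R⌋ + 1 - -⌊R⌋).toNat : ℤ) : ℝ) = 2 * ⌊R⌋ + 1 := by
    rw [Int.toNat_of_nonneg (by omega)]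
    push_cast
    ring
  have h2 := Int.floor_le R
  calc (((⌊R⌋ + 1 - -⌊R⌋).toNat : ℕ) : ℝ) = 2 * ⌊R⌋ + 1 := by exact_mod_cast h1
    _ ≤ 3 * R := by linarith

/-- Beyond `r ^ (-κ)` with `κ > 1`, the product `r ‖ξ‖` exceeds a negative power of `r`, so a
sufficiently high order of decay of the mollifier absorbs both the weight and a factor `r`. -/
lemma exists_tail_bumpCoeff (d : ℕ) {κ θ : ℝ} (hκ : 1 < κ) (hθ : 0 < θ) :
    ∃ A : ℝ, 0 ≤ A ∧ ∀ r : ℝ, 0 < r → r ≤ 1 → ∀ ξ : Fin d → ℤ, r ^ (-κ) < ‖ξ‖ →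
      (1 + ‖ξ‖) ^ d * ‖bumpCoeff (θ * r) ξ‖ ≤ A * r := by
  -- The decay order `K = K₀ + d` must satisfy `κ d + 1 ≤ (κ - 1) K`, which makes the exponent `K +
  -- 1 - κ K₀` of `r` in `e3` nonpositive.
  obtain ⟨K₀, hK₀⟩ := exists_nat_ge ((κ * d + 1) / (κ - 1))
  set K := K₀ + d with hK
  have hκ1 : 0 < κ - 1 := by linarith
  have hKκ : κ * d + 1 ≤ (κ - 1) * K := by
    rw [div_le_iff₀ hκ1] at hK₀
    have : (K : ℝ) = K₀ + d := by rw [hK]; push_cast; ring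
    rw [this]
    have : 0 ≤ (κ - 1) * d := by positivity
    nlinarith
  obtain ⟨C, hC0, hC⟩ := exists_norm_bumpCoeff_le d K
  refine ⟨C * 2 ^ d / θ ^ K, by positivity, fun r hr hr1 ξ hξ => ?_⟩
  set X := ‖ξ‖ with hX
  have hR1 : 1 ≤ r ^ (-κ) := Real.one_le_rpow_of_pos_of_le_one_of_nonpos hr hr1 (by linarith)
  have hX1 : 1 ≤ X := hR1.trans hξ.le
  have hX0 : 0 < X := by linarith
  have h1 : ‖bumpCoeff (θ * r) ξ‖ * (θ * r * X) ^ K ≤ C := by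
    refine le_trans ?_ (hC (θ * r) (by positivity) ξ)
    gcongr
    linarith
  have h2 : X ^ d ≤ (r * X) ^ K * r := by
    have e1 : (X ^ (K₀ : ℕ)) * X ^ d = X ^ K := by rw [hK, pow_add]
    have e2 : r ^ (-(κ * K₀)) ≤ X ^ K₀ := by
      have : r ^ (-(κ * K₀)) = (r ^ (-κ)) ^ K₀ := by
        rw [← Real.rpow_natCast, ← Real.rpow_mul hr.le]; ring_nf
      rw [this]
      gcongr
    have e3 : (1 : ℝ) ≤ r ^ (K : ℕ) * r * r ^ (-(κ * K₀)) := by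
      have : r ^ (K : ℕ) * r * r ^ (-(κ * K₀)) = r ^ ((K : ℝ) + 1 + -(κ * K₀)) := by
        rw [Real.rpow_add hr, Real.rpow_add hr, Real.rpow_one, Real.rpow_natCast]
      rw [this]
      refine Real.one_le_rpow_of_pos_of_le_one_of_nonpos hr hr1 ?_
      have : (K : ℝ) = K₀ + d := by rw [hK]; push_cast; ring
      rw [this] at hKκ ⊢
      nlinarith
    calc X ^ d = 1 * X ^ d := by ring
      _ ≤ (r ^ (K : ℕ) * r * r ^ (-(κ * K₀))) * X ^ d := by gcongr
      _ ≤ (r ^ (K : ℕ) * r * X ^ K₀) * X ^ d := by gcongr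
      _ = (r * X) ^ K * r := by rw [mul_pow, ← e1]; ring
  calc (1 + X) ^ d * ‖bumpCoeff (θ * r) ξ‖ ≤ (2 * X) ^ d * ‖bumpCoeff (θ * r) ξ‖ := by
        gcongr; linarith
    _ = 2 ^ d * X ^ d * ‖bumpCoeff (θ * r) ξ‖ := by rw [mul_pow]
    _ ≤ 2 ^ d * ((r * X) ^ K * r) * ‖bumpCoeff (θ * r) ξ‖ := by gcongr
    _ = (‖bumpCoeff (θ * r) ξ‖ * (θ * r * X) ^ K) * (2 ^ d / θ ^ K * r) := by
        rw [mul_assoc θ r X, mul_pow θ]; field_simp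
    _ ≤ C * (2 ^ d / θ ^ K * r) := by gcongr
    _ = _ := by ring

lemma tendsto_rpow_mul_log {a : ℝ} (ha : 0 < a) (b c : ℝ) :
    Tendsto (fun r : ℝ => r ^ a * (b + c * Real.log r⁻¹)) (𝓝[>] 0) (𝓝 0) := by
  have h1 := tendsto_log_mul_rpow_nhdsGT_zero ha
  have h2 : Tendsto (fun r : ℝ => r ^ a) (𝓝[>] 0) (𝓝 0) := by
    have := (Real.continuousAt_rpow_const 0 a (Or.inr ha.le)).tendsto
    rw [Real.zero_rpow ha.ne'] at this
    exact this.mono_left nhdsWithin_le_nhds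
  have h3 := (h2.mul_const b).sub (h1.const_mul c)
  simp only [zero_mul, mul_zero, sub_zero] at h3
  refine h3.congr fun r => ?_
  rw [Real.log_inv]
  ring

lemma tendsto_exp_rpow_sub_one {a : ℝ} (ha : 0 < a) (b : ℝ) :
    Tendsto (fun r : ℝ => Real.exp (b * r ^ a) - 1) (𝓝[>] 0) (𝓝 0) := by
  have h2 : Tendsto (fun r : ℝ => r ^ a) (𝓝[>] 0) (𝓝 0) := by
    have := (Real.continuousAt_rpow_const 0 a (Or.inr ha.le)).tendsto
    rw [Real.zero_rpow ha.ne'] at this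
    exact this.mono_left nhdsWithin_le_nhds
  have h3 := (Real.continuous_exp.tendsto _).comp (h2.const_mul b)
  simp only [mul_zero, Real.exp_zero] at h3
  simpa using h3.sub_const 1

lemma rpow_half_le_pow {s : ℝ} (hsd : s ≤ d) (ξ : Fin d → ℤ) :
    (1 + ‖ξ‖) ^ (s / 2) ≤ (1 + ‖ξ‖) ^ d := by
  rw [← Real.rpow_natCast]
  exact Real.rpow_le_rpow_of_exponent_le (by linarith [norm_nonneg ξ]) (by linarith)

/-- Low frequencies: the error made by mollification. -/
lemma weighted_norm_mollify_le {s ρ C : ℝ} (hsd : s ≤ d) (hρ : 0 < ρ) {a b : ℂ}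
    {ξ : Fin d → ℤ} (hb : ‖b‖ * (1 + ‖ξ‖) ^ (d + 1) ≤ C) :
    (1 + ‖ξ‖) ^ (s / 2) * ‖bumpCoeff ρ ξ * a - b‖
      ≤ (1 + ‖ξ‖) ^ (s / 2) * ‖a - b‖ + 2 * Real.pi * d * ρ * C := by
  have h1 : ‖bumpCoeff ρ ξ * a - b‖ ≤ ‖a - b‖ + ‖1 - bumpCoeff ρ ξ‖ * ‖b‖ := by
    have : bumpCoeff ρ ξ * a - b = bumpCoeff ρ ξ * (a - b) - (1 - bumpCoeff ρ ξ) * b := by ring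
    rw [this]
    refine (norm_sub_le _ _).trans ?_
    rw [norm_mul, norm_mul]
    gcongr
    exact mul_le_of_le_one_left (norm_nonneg _) (norm_bumpCoeff_le_one _ _)
  have h2 := norm_one_sub_bumpCoeff_le hρ ξ
  have h3 := rpow_half_le_pow hsd ξ
  have hpi := Real.pi_pos
  calc (1 + ‖ξ‖) ^ (s / 2) * ‖bumpCoeff ρ ξ * a - b‖
      ≤ (1 + ‖ξ‖) ^ (s / 2) * (‖a - b‖ + ‖1 - bumpCoeff ρ ξ‖ * ‖b‖) := by gcongr
    _ = (1 + ‖ξ‖) ^ (s / 2) * ‖a - b‖ + (1 + ‖ξ‖) ^ (s / 2) * (‖1 - bumpCoeff ρ ξ‖ * ‖b‖) := by ring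
    _ ≤ (1 + ‖ξ‖) ^ (s / 2) * ‖a - b‖
        + (1 + ‖ξ‖) ^ d * ((2 * Real.pi * d * ρ * (1 + ‖ξ‖)) * ‖b‖) := by
        gcongr
        refine h2.trans ?_
        gcongr
        linarith
    _ = (1 + ‖ξ‖) ^ (s / 2) * ‖a - b‖
        + 2 * Real.pi * d * ρ * (‖b‖ * (1 + ‖ξ‖) ^ (d + 1)) := by ring
    _ ≤ _ := by gcongr

/-- High frequencies: the tail estimate. -/
lemma weighted_norm_tail_le {s ρ C A B r : ℝ} (hsd : s ≤ d) {a b : ℂ}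
    {ξ : Fin d → ℤ} (hb : ‖b‖ * (1 + ‖ξ‖) ^ (d + 1) ≤ C) (ha : ‖a‖ ≤ B)
    (hA : (1 + ‖ξ‖) ^ d * ‖bumpCoeff ρ ξ‖ ≤ A * r) (hr : 0 < r) (hξ : r⁻¹ ≤ ‖ξ‖) :
    (1 + ‖ξ‖) ^ (s / 2) * ‖bumpCoeff ρ ξ * a - b‖ ≤ (A * B + C) * r := by
  have h3 := rpow_half_le_pow hsd ξ
  have hAr : 0 ≤ A * r := le_trans (by positivity) hA
  have h4 : (1 + ‖ξ‖) ^ d * ‖b‖ ≤ C * r := by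
    have h5 : 1 ≤ r * (1 + ‖ξ‖) := by
      have := mul_le_mul_of_nonneg_left hξ hr.le
      rw [mul_inv_cancel₀ hr.ne'] at this
      linarith
    calc (1 + ‖ξ‖) ^ d * ‖b‖ ≤ (1 + ‖ξ‖) ^ d * ‖b‖ * (r * (1 + ‖ξ‖)) :=
          le_mul_of_one_le_right (by positivity) h5
      _ = (‖b‖ * (1 + ‖ξ‖) ^ (d + 1)) * r := by ring
      _ ≤ C * r := by gcongr
  calc (1 + ‖ξ‖) ^ (s / 2) * ‖bumpCoeff ρ ξ * a - b‖
      ≤ (1 + ‖ξ‖) ^ d * (‖bumpCoeff ρ ξ‖ * ‖a‖ + ‖b‖) := by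
        rw [← norm_mul]
        gcongr
        exact norm_sub_le _ _
    _ = ((1 + ‖ξ‖) ^ d * ‖bumpCoeff ρ ξ‖) * ‖a‖ + (1 + ‖ξ‖) ^ d * ‖b‖ := by ring
    _ ≤ (A * r) * B + C * r := by gcongr
    _ = _ := by ring

lemma norm_coeff_le_of_abs_le {g : Torus d → ℝ} {C : ℝ} (hg : ∀ x, |g x| ≤ C) (ξ : Fin d → ℤ) :
    ‖coeff (fun x => (g x : ℂ)) ξ‖ ≤ C := by
  refine (norm_integral_le_of_norm_le_const (C := C) (ae_of_all _ fun x => ?_)).trans ?_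
  · rw [norm_mul, norm_mFourier_apply, mul_one, Complex.norm_real]
    exact hg x
  · simp

lemma norm_list_map_mFourier_sum_le (l : List (Torus d)) (ξ : Fin d → ℤ) (q : ℤ) :
    ‖(l.map fun z => mFourier ξ (q • z)).sum‖ ≤ l.length := by
  induction l with
  | nil => simp
  | cons z l ih =>
    simp only [List.map_cons, List.sum_cons, List.length_cons]
    refine (norm_add_le _ _).trans ?_
    rw [norm_mFourier_apply]
    push_cast
    linarith

set_option maxHeartbeats 1600000 in
/-- For all small scales `r`, a density `f` can be replaced by at most `r ^ (-lam)` points, and the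
sets `p z + 𝒯` removed from a density `g`, with a small change of the weighted Fourier
coefficients after mollification at scale `θ r`. -/
lemma eventually_exists_discretization {f g : Torus d → ℝ} {Cf Cg m : ℝ}
    (hf0 : ∀ x, 0 ≤ f x) (hf : AbsRep (d + 1) (fun x => (f x : ℂ)) Cf)
    (hg : AbsRep (d + 1) (fun x => (g x : ℂ)) Cg) (hm : ∫ x, f x = m) {q p : ℤ}
    (hq : q ≠ 0) (hp : p ≠ 0) {s lam η θ ε : ℝ} (hs : 0 < s) (hsd : s ≤ d) (hlam : s < lam)
    (hη : 0 < η) (hθ : 0 < θ) (hε : 0 < ε) :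
    ∀ᶠ r in 𝓝[>] (0 : ℝ), ∀ 𝒯 : Set (Torus d), MeasurableSet 𝒯 →
      volume.real 𝒯 ≤ r ^ (lam + η) → ∃ l : List (Torus d), (l.length : ℝ) ≤ r ^ (-lam) ∧
        (∀ z ∈ l, f (q • z) ≠ 0) ∧
        (∀ ξ, (1 + ‖ξ‖) ^ (s / 2) * ‖bumpCoeff (θ * r) ξ *
          (m / l.length * (l.map fun z => mFourier (-ξ) (q • z)).sum)
            - coeff (fun x => (f x : ℂ)) ξ‖ ≤ ε) ∧
        (∀ ξ, (1 + ‖ξ‖) ^ (s / 2) * ‖bumpCoeff (θ * r) ξ *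
          coeff (fun x => ((g x * keep p 𝒯 l x : ℝ) : ℂ)) ξ
            - coeff (fun x => (g x : ℂ)) ξ‖ ≤ ε) := by
  have hCf := hf.nonneg
  have hCg := hg.nonneg
  have hm0 : 0 ≤ m := hm ▸ integral_nonneg hf0
  -- The midpoint of `1` and `lam / s`: `κ > 1` makes the mollifier negligible beyond `r ^ (-κ)`,
  -- and `κ s < lam` lets square-root cancellation beat the weight below it.
  set κ := (1 + lam / s) / 2 with hκdef
  have hlam0 : 0 < lam := hs.trans hlam
  have hκ : 1 < κ := by
    have : 1 < lam / s := (one_lt_div hs).2 hlam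
    rw [hκdef]; linarith
  have hκs : κ * s = (s + lam) / 2 := by rw [hκdef]; field_simp
  set a := (lam - κ * s) / 2 with hadef
  have ha : 0 < a := by rw [hadef, hκs]; linarith
  obtain ⟨A, hA0, hA⟩ := exists_tail_bumpCoeff d hκ hθ
  set b := Real.log (8 * Real.exp 1 * 3 ^ d) with hbdef
  set c := (d : ℝ) * κ with hcdef
  set Cp := (1 / m) * (1 + |(q : ℝ)|) ^ (d + 1) * Cf with hCp
  have hCp0 : 0 ≤ Cp := by positivity
  have hpi := Real.pi_pos
  set c1 := 8 * 2 ^ d * (m + Cg + 1) with hc1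
  set c3 := 2 * Real.pi * d * θ * (Cf + Cg) + A * (m + Cg) + Cf + Cg with hc3
  have htend : Tendsto (fun r : ℝ => c1 * (r ^ a * (b + c * Real.log r⁻¹))
      + (Cg * (Real.exp (Cp * r ^ η) - 1) + c3 * r)) (𝓝[>] 0) (𝓝 0) := by
    have h3 : Tendsto (fun r : ℝ => r) (𝓝[>] 0) (𝓝 0) := nhdsWithin_le_nhds
    simpa using ((tendsto_rpow_mul_log ha b c).const_mul c1).add
      (((tendsto_exp_rpow_sub_one hη Cp).const_mul Cg).add (h3.const_mul c3))
  have hr1 : ∀ᶠ r in 𝓝[>] (0 : ℝ), r < 1 :=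
    nhdsWithin_le_nhds (Iio_mem_nhds one_pos)
  filter_upwards [htend.eventually_lt_const hε, hr1, self_mem_nhdsWithin] with r hrε hr1 hr0 𝒯 h𝒯 hvol
  have hr0 : 0 < r := hr0
  set R := r ^ (-κ) with hR
  have hrR : r⁻¹ ≤ R := by
    rw [hR, ← Real.rpow_neg_one]
    exact Real.rpow_le_rpow_of_exponent_ge hr0 hr1.le (by linarith)
  have hR1 : 1 ≤ R := Real.one_le_rpow_of_pos_of_le_one_of_nonpos hr0 hr1.le (by linarith)
  have hlow : ∀ ξ : Fin d → ℤ, ‖ξ‖ ≤ R → (1 + ‖ξ‖) ^ (s / 2) ≤ 2 ^ d * r ^ (-(κ * s / 2)) := by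
    intro ξ hξ
    calc (1 + ‖ξ‖) ^ (s / 2) ≤ (2 * R) ^ (s / 2) := by gcongr; linarith
      _ = 2 ^ (s / 2) * R ^ (s / 2) := Real.mul_rpow (by norm_num) (by linarith)
      _ ≤ 2 ^ d * r ^ (-(κ * s / 2)) := by
          rw [hR, ← Real.rpow_mul hr0.le, ← Real.rpow_natCast 2 d]
          have e : -κ * (s / 2) = -(κ * s / 2) := by ring
          rw [e]
          gcongr
          · norm_num
          · linarith
  have hlog : ∀ n : ℕ, 1 ≤ n → (n : ℝ) ≤ (3 * R) ^ d →
      Real.log (8 * Real.exp 1 * n) ≤ b + c * Real.log r⁻¹ := by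
    -- The number of controlled frequencies is polynomial in `1 / r`, so it costs only a logarithm.
    intro n hn1 hn
    have hn0 : (0 : ℝ) < n := by exact_mod_cast hn1
    calc Real.log (8 * Real.exp 1 * n) ≤ Real.log (8 * Real.exp 1 * (3 * R) ^ d) := by gcongr
      _ = b + c * Real.log r⁻¹ := by
          rw [mul_pow, ← mul_assoc, Real.log_mul (by positivity) (by positivity), Real.log_pow, hR,
            Real.log_rpow hr0, Real.log_inv]
          ring
  have hbc : 0 ≤ b + c * Real.log r⁻¹ := by
    refine le_trans (Real.log_nonneg ?_) (hlog _ (one_le_card_freqBox (d := d) (by linarith)) (card_freqBox_le hR1))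
    have h1 : (1 : ℝ) ≤ (freqBox d R).card := by
      exact_mod_cast one_le_card_freqBox (d := d) (R := R) (by linarith)
    nlinarith [Real.add_one_le_exp (1 : ℝ)]
  set E1 := r ^ a * (b + c * Real.log r⁻¹) with hE1
  have hE10 : 0 ≤ E1 := by positivity
  have hexp0 : 0 ≤ Real.exp (Cp * r ^ η) - 1 := by
    have := Real.add_one_le_exp (Cp * r ^ η)
    have : 0 ≤ Cp * r ^ η := by positivity
    linarith
  set E2 := Real.exp (Cp * r ^ η) - 1 with hE2
  -- The error budget: fluctuations (`c1 * E1`), expected loss by removal (`Cg * E2`), and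
  -- mollification or tail (`c3 * r`).
  have hsum : ∀ t1 t2 t3 : ℝ, t1 ≤ c1 * E1 → t2 ≤ Cg * E2 → t3 ≤ c3 * r → t1 + t2 + t3 ≤ ε := by
    intro t1 t2 t3 h1 h2 h3; linarith
  have hc10 : 0 ≤ c1 := by positivity
  have hc30 : 0 ≤ c3 := by positivity
  have hgk : ∀ (l : List (Torus d)) ξ, ‖coeff (fun x => ((g x * keep p 𝒯 l x : ℝ) : ℂ)) ξ‖ ≤ Cg := by
    intro l ξ
    refine norm_coeff_le_of_abs_le (g := fun x => g x * keep p 𝒯 l x) (fun x => ?_) ξ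
    rw [abs_mul, abs_of_nonneg (keep_nonneg _ _ _ _)]
    have := hg.norm_apply_le x
    rw [Complex.norm_real, Real.norm_eq_abs] at this
    exact (mul_le_of_le_one_right (abs_nonneg _) (keep_le_one _ _ _ _)).trans this
  have hfk : ∀ (l : List (Torus d)) ξ,
      ‖((m : ℂ) / l.length * (l.map fun z => mFourier (-ξ) (q • z)).sum)‖ ≤ m := by
    intro l ξ
    rw [norm_mul, norm_div, Complex.norm_real, Real.norm_of_nonneg hm0, Complex.norm_natCast]
    rcases Nat.eq_zero_or_pos l.length with h | h
    · simp [h, hm0]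
    · have h' : (0 : ℝ) < l.length := by exact_mod_cast h
      calc m / l.length * _ ≤ m / l.length * l.length := by
            gcongr; exact norm_list_map_mFourier_sum_le l _ q
        _ = m := by field_simp
  have hhighf : ∀ (l : List (Torus d)) ξ, R < ‖ξ‖ → (1 + ‖ξ‖) ^ (s / 2) * ‖bumpCoeff (θ * r) ξ *
          (m / l.length * (l.map fun z => mFourier (-ξ) (q • z)).sum)
            - coeff (fun x => (f x : ℂ)) ξ‖ ≤ ε := by
    intro l ξ hξ
    refine (weighted_norm_tail_le hsd (hf.norm_coeff_le ξ) (hfk l ξ)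
      (hA r hr0 hr1.le ξ hξ) hr0 (hrR.trans hξ.le)).trans ?_
    have := hsum 0 0 ((A * m + Cf) * r) (by positivity) (by positivity) (by
      gcongr; rw [hc3]
      have : 0 ≤ 2 * Real.pi * d * θ * (Cf + Cg) := by positivity
      nlinarith)
    linarith
  have hhighg : ∀ (l : List (Torus d)) ξ, R < ‖ξ‖ → (1 + ‖ξ‖) ^ (s / 2) * ‖bumpCoeff (θ * r) ξ *
          coeff (fun x => ((g x * keep p 𝒯 l x : ℝ) : ℂ)) ξ
            - coeff (fun x => (g x : ℂ)) ξ‖ ≤ ε := by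
    intro l ξ hξ
    refine (weighted_norm_tail_le hsd (hg.norm_coeff_le ξ) (hgk l ξ)
      (hA r hr0 hr1.le ξ hξ) hr0 (hrR.trans hξ.le)).trans ?_
    have := hsum 0 0 ((A * Cg + Cg) * r) (by positivity) (by positivity) (by
      gcongr; rw [hc3]
      have : 0 ≤ 2 * Real.pi * d * θ * (Cf + Cg) := by positivity
      nlinarith [mul_nonneg hA0 hm0])
    linarith
  have hmollf : 2 * Real.pi * d * (θ * r) * Cf ≤ c3 * r := by
    have : 2 * Real.pi * d * (θ * r) * Cf = (2 * Real.pi * d * θ * Cf) * r := by ring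
    rw [this]
    gcongr
    have : 0 ≤ 2 * Real.pi * d * θ * Cg := by positivity
    rw [hc3]
    nlinarith [mul_nonneg hA0 hm0, mul_nonneg hA0 hCg]
  have hmollg : 2 * Real.pi * d * (θ * r) * Cg ≤ c3 * r := by
    have : 2 * Real.pi * d * (θ * r) * Cg = (2 * Real.pi * d * θ * Cg) * r := by ring
    rw [this]
    gcongr
    have : 0 ≤ 2 * Real.pi * d * θ * Cf := by positivity
    rw [hc3]
    nlinarith [mul_nonneg hA0 hm0, mul_nonneg hA0 hCg]
  -- If `f` has no mass there is no sampling law; then `f = 0`, and the empty list works because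
  -- nothing is removed.
  rcases hm0.eq_or_lt with hm00 | hmpos
  · refine ⟨[], by simp; positivity, by simp, fun ξ => ?_, fun ξ => ?_⟩
    · have h1 : coeff (fun x => (f x : ℂ)) ξ = 0 := by
        have hfc : Continuous f := Complex.continuous_re.comp hf.continuous
        have hz : ∀ x, f x = 0 := by
          have h0 : f =ᵐ[volume] 0 := by
            rw [← integral_eq_zero_iff_of_nonneg hf0 (hfc.integrable_of_hasCompactSupport
              (HasCompactSupport.of_compactSpace f)), hm, ← hm00]
          intro x
          exact congr_fun ((hfc.ae_eq_iff_eq volume continuous_zero).1 h0) x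
        simp [coeff, hz]
      simp [h1, hε.le]
    · by_cases hξ : ‖ξ‖ ≤ R
      · refine (weighted_norm_mollify_le hsd (by positivity) (hg.norm_coeff_le ξ)).trans ?_
        have h1 : coeff (fun x => ((g x * keep p 𝒯 [] x : ℝ) : ℂ)) ξ = coeff (fun x => (g x : ℂ)) ξ := by
          simp [keep]
        rw [h1, sub_self, norm_zero, mul_zero]
        have := hsum 0 0 _ (by positivity) (by positivity) hmollg
        linarith
      · exact hhighg [] ξ (not_le.1 hξ)
  have hlam1 : 1 ≤ r ^ (-lam) :=
    Real.one_le_rpow_of_pos_of_le_one_of_nonpos hr0 hr1.le (by linarith)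
  set M := ⌊r ^ (-lam)⌋₊ with hMdef
  have hM1 : 1 ≤ M := Nat.floor_pos.2 hlam1
  have hMle : (M : ℝ) ≤ r ^ (-lam) := Nat.floor_le (by positivity)
  have hMge : r ^ (-lam) / 2 ≤ M := by
    have := Nat.lt_floor_add_one (r ^ (-lam))
    have h1 : (1 : ℝ) ≤ M := by exact_mod_cast hM1
    rw [← hMdef] at this
    linarith
  have hM0 : (0 : ℝ) < M := by exact_mod_cast hM1
  have hsqpos : 0 < √(M : ℝ) := Real.sqrt_pos.2 hM0
  have hsq : √(M : ℝ) ≤ r ^ (-(lam / 2)) := by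
    rw [Real.sqrt_le_left (by positivity), ← Real.rpow_natCast, ← Real.rpow_mul hr0.le]
    refine hMle.trans (le_of_eq ?_)
    congr 1; push_cast; ring
  have hsqi : 1 / √(M : ℝ) ≤ 2 * r ^ (lam / 2) := by
    rw [div_le_iff₀ hsqpos]
    have h1 : r ^ (-(lam / 2)) / 2 ≤ √(M : ℝ) := by
      refine Real.le_sqrt_of_sq_le ?_
      rw [div_pow, ← Real.rpow_natCast, ← Real.rpow_mul hr0.le]
      have e : -(lam / 2) * ((2 : ℕ) : ℝ) = -lam := by push_cast; ring
      rw [e]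
      have : 0 < r ^ (-lam) := by positivity
      linarith
    have h2 : r ^ (lam / 2) * r ^ (-(lam / 2)) = 1 := by
      rw [← Real.rpow_add hr0]; simp
    calc (1 : ℝ) = 2 * r ^ (lam / 2) * (r ^ (-(lam / 2)) / 2) := by linarith
      _ ≤ _ := by gcongr
  have hτ0 : 0 < r ^ (lam + η) := by positivity
  obtain ⟨l, hl, hlf, hlin, hrem⟩ := exists_sample hf0 hf hg hm hmpos hq hp h𝒯 hvol hτ0
    (freqBox d R) hM1
  have hLg := hlog _ (one_le_card_freqBox (d := d) (R := R) (by linarith)) (card_freqBox_le hR1)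
  set Lg := Real.log (8 * Real.exp 1 * (freqBox d R).card) with hLgdef
  have hra : r ^ (-(κ * s / 2)) * r ^ (lam / 2) = r ^ a := by
    rw [← Real.rpow_add hr0, hadef]; congr 1; ring
  refine ⟨l, hl ▸ hMle, hlf, fun ξ => ?_, fun ξ => ?_⟩
  · by_cases hξ : ‖ξ‖ ≤ R
    · refine (weighted_norm_mollify_le hsd (by positivity) (hf.norm_coeff_le ξ)).trans ?_
      have h1 := hlin ξ (mem_freqBox hξ)
      have hmc : (m : ℂ) ≠ 0 := by exact_mod_cast hmpos.ne'
      have hMc : (M : ℂ) ≠ 0 := by exact_mod_cast hM0.ne'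
      have h2 : ‖(m / l.length * (l.map fun z => mFourier (-ξ) (q • z)).sum)
            - coeff (fun x => (f x : ℂ)) ξ‖ ≤ 4 * m * (1 / √M) * (b + c * Real.log r⁻¹) := by
        have e1 : (m / l.length * (l.map fun z => mFourier (-ξ) (q • z)).sum)
            - coeff (fun x => (f x : ℂ)) ξ = (m / M) * ((l.map fun z => mFourier (-ξ) (q • z)).sum
          - M * (coeff (fun x => (f x : ℂ)) ξ / m)) := by
          rw [hl]; field_simp
        rw [e1, norm_mul, norm_div, Complex.norm_real, Real.norm_of_nonneg hm0, Complex.norm_natCast]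
        calc m / M * _ ≤ m / M * (4 * √M * (b + c * Real.log r⁻¹)) := by
              gcongr
              exact h1.trans (by gcongr)
          _ = _ := by
              have : m / M * √(M : ℝ) = m * (1 / √M) := by
                nth_rewrite 1 [← Real.mul_self_sqrt hM0.le]
                field_simp
              linear_combination (4 * (b + c * Real.log r⁻¹)) * this
      have h3 : (1 + ‖ξ‖) ^ (s / 2) * ‖(m / l.length * (l.map fun z => mFourier (-ξ) (q • z)).sum)
            - coeff (fun x => (f x : ℂ)) ξ‖ ≤ c1 * E1 := by
        calc _ ≤ (2 ^ d * r ^ (-(κ * s / 2))) * (4 * m * (2 * r ^ (lam / 2)) * (b + c * Real.log r⁻¹)) := by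
              gcongr
              · exact hlow ξ hξ
              · exact h2.trans (by gcongr)
          _ = 8 * 2 ^ d * m * E1 := by rw [hE1, ← hra]; ring
          _ ≤ c1 * E1 := by
              rw [hc1]; gcongr; linarith
      have := hsum _ 0 _ h3 (by positivity) hmollf
      linarith
    · exact hhighf l ξ (not_le.1 hξ)
  · by_cases hξ : ‖ξ‖ ≤ R
    · refine (weighted_norm_mollify_le hsd (by positivity) (hg.norm_coeff_le ξ)).trans ?_
      have h1 := hrem ξ (mem_freqBox hξ)
      set Q := r ^ (lam + η) / m * (1 + |(q : ℝ)|) ^ (d + 1) * Cf with hQ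
      have hQ0 : 0 ≤ Q := by positivity
      -- The number of removals times the volume of `𝒯` is at most `r ^ η`; this is where the spare
      -- exponent `η` is spent.
      have hQM : (1 + Q) ^ M - 1 ≤ E2 := by
        have e1 : (1 + Q) ^ M ≤ Real.exp (M * Q) := by
          rw [Real.exp_nat_mul]
          gcongr
          linarith [Real.add_one_le_exp Q]
        have e2 : (M : ℝ) * Q ≤ Cp * r ^ η := by
          calc (M : ℝ) * Q ≤ r ^ (-lam) * Q := by gcongr
            _ = Cp * r ^ η := by
              have : r ^ (-lam) * r ^ (lam + η) = r ^ η := by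
                rw [← Real.rpow_add hr0]; congr 1; ring
              rw [hQ, hCp, ← this]; ring
        have e3 := Real.exp_le_exp.2 e2
        rw [hE2]
        linarith
      have h2 : (1 + ‖ξ‖) ^ (s / 2) * (Cg * ((1 + Q) ^ M - 1) / (1 + ‖ξ‖) ^ (d + 1)) ≤ Cg * E2 := by
        have e1 : (1 + ‖ξ‖) ^ (s / 2) ≤ (1 + ‖ξ‖) ^ (d + 1) :=
          (rpow_half_le_pow hsd ξ).trans
            (pow_le_pow_right₀ (by linarith [norm_nonneg ξ]) (Nat.le_succ d))
        have hQ1 : 0 ≤ (1 + Q) ^ M - 1 := by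
          have := one_le_pow₀ (n := M) (by linarith : 1 ≤ 1 + Q)
          linarith
        rw [mul_div_assoc', div_le_iff₀ (by positivity), mul_comm]
        gcongr
      have h3 : (1 + ‖ξ‖) ^ (s / 2) * (4 * (Cg + 1) * r ^ (lam + η) * √M * Lg) ≤ c1 * E1 := by
        have e1 : r ^ (lam + η) * √M ≤ r ^ (lam / 2) := by
          calc r ^ (lam + η) * √M ≤ r ^ (lam + η) * r ^ (-(lam / 2)) := by gcongr
            _ = r ^ (lam / 2 + η) := by rw [← Real.rpow_add hr0]; congr 1; ring
            _ ≤ r ^ (lam / 2) :=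
              Real.rpow_le_rpow_of_exponent_ge hr0 hr1.le (by linarith)
        calc _ = (1 + ‖ξ‖) ^ (s / 2) * (4 * (Cg + 1) * (r ^ (lam + η) * √M) * Lg) := by ring
          _ ≤ (2 ^ d * r ^ (-(κ * s / 2))) * (4 * (Cg + 1) * r ^ (lam / 2) * (b + c * Real.log r⁻¹)) := by
              refine mul_le_mul (hlow ξ hξ) ?_ ?_ (by positivity)
              · refine mul_le_mul (by gcongr) hLg ?_ (by positivity)
                refine Real.log_nonneg ?_
                have h1 : (1 : ℝ) ≤ (freqBox d R).card := by
                  exact_mod_cast one_le_card_freqBox (d := d) (R := R) (by linarith)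
                nlinarith [Real.add_one_le_exp (1 : ℝ)]
              · refine mul_nonneg (by positivity) (Real.log_nonneg ?_)
                have h1 : (1 : ℝ) ≤ (freqBox d R).card := by
                  exact_mod_cast one_le_card_freqBox (d := d) (R := R) (by linarith)
                nlinarith [Real.add_one_le_exp (1 : ℝ)]
          _ = 4 * 2 ^ d * (Cg + 1) * E1 := by rw [hE1, ← hra]; ring
          _ ≤ c1 * E1 := by
              rw [hc1]
              gcongr
              · norm_num
              · linarith
      refine le_trans (add_le_add_left (mul_le_mul_of_nonneg_left h1 (by positivity)) _) ?_
      rw [mul_add]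
      exact hsum _ _ _ h3 h2 hmollg
    · exact hhighg l ξ (not_le.1 hξ)

/-! ### Weighted suprema and neighbourhoods in `𝒳_β` -/

lemma freqNorm_nonneg (ξ : Fin d → ℤ) : 0 ≤ freqNorm ξ := Real.sqrt_nonneg _

lemma norm_le_freqNorm (ξ : Fin d → ℤ) : ‖ξ‖ ≤ freqNorm ξ := by
  rw [pi_norm_le_iff_of_nonneg (freqNorm_nonneg ξ)]
  intro i
  rw [Int.norm_eq_abs, ← Real.sqrt_sq_eq_abs]
  exact Real.sqrt_le_sqrt (Finset.single_le_sum (f := fun i => ((ξ i : ℤ) : ℝ) ^ 2)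
    (fun _ _ => sq_nonneg _) (Finset.mem_univ i))

lemma freqNorm_le (ξ : Fin d → ℤ) : freqNorm ξ ≤ (d + 1) * (1 + ‖ξ‖) := by
  refine Real.sqrt_le_iff.2 ⟨by positivity, ?_⟩
  calc ∑ i, ((ξ i : ℤ) : ℝ) ^ 2 ≤ ∑ _i : Fin d, (1 + ‖ξ‖) ^ 2 := by
        refine Finset.sum_le_sum fun i _ => ?_
        rw [← sq_abs]
        have := norm_int_cast_apply_le ξ i
        gcongr
        linarith
    _ = d * (1 + ‖ξ‖) ^ 2 := by simp
    _ ≤ ((d + 1) * (1 + ‖ξ‖)) ^ 2 := by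
        rw [mul_pow]
        gcongr
        have : (0 : ℝ) ≤ d := by positivity
        nlinarith

lemma one_le_norm_of_ne_zero {ξ : Fin d → ℤ} (h : ξ ≠ 0) : 1 ≤ ‖ξ‖ := by
  obtain ⟨i, hi⟩ := Function.ne_iff.1 h
  refine le_trans ?_ (norm_int_cast_apply_le ξ i)
  exact_mod_cast Int.one_le_abs hi

lemma weightedSup_le {s ε : ℝ} (hs : 0 ≤ s) {c : (Fin d → ℤ) → ℂ}
    (h : ∀ ξ, (1 + ‖ξ‖) ^ (s / 2) * ‖c ξ‖ ≤ ε) :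
    weightedSup s c ≤ ENNReal.ofReal (((d : ℝ) + 1) ^ (s / 2) * ε) := by
  refine iSup_le fun ξ => ?_
  rw [← ofReal_norm, ← ENNReal.ofReal_mul (norm_nonneg _)]
  refine ENNReal.ofReal_le_ofReal ?_
  calc ‖c ξ‖ * freqNorm ξ ^ (s / 2) ≤ ‖c ξ‖ * ((d + 1) * (1 + ‖ξ‖)) ^ (s / 2) := by
        gcongr
        · exact Real.sqrt_nonneg _
        · exact freqNorm_le ξ
    _ = ((d : ℝ) + 1) ^ (s / 2) * ((1 + ‖ξ‖) ^ (s / 2) * ‖c ξ‖) := by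
        rw [Real.mul_rpow (by positivity) (by positivity)]; ring
    _ ≤ _ := by gcongr; exact h ξ

lemma exists_of_weightedSup_lt_top {s : ℝ} (hs : 0 ≤ s) {c : (Fin d → ℤ) → ℂ}
    (h : weightedSup s c < ∞) : ∃ C, 0 ≤ C ∧ ∀ ξ, (1 + ‖ξ‖) ^ (s / 2) * ‖c ξ‖ ≤ C := by
  refine ⟨max ‖c 0‖ (2 ^ (s / 2) * (weightedSup s c).toReal), by positivity, fun ξ => ?_⟩
  by_cases hξ : ξ = 0
  · simp [hξ]
  refine le_trans ?_ (le_max_right _ _)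
  have h1 : ENNReal.ofReal (‖c ξ‖ * freqNorm ξ ^ (s / 2)) ≤ weightedSup s c := by
    rw [ENNReal.ofReal_mul (norm_nonneg _), ofReal_norm]
    exact le_iSup (fun ξ => ‖c ξ‖ₑ * ENNReal.ofReal (freqNorm ξ ^ (s / 2))) ξ
  have h2 : ‖c ξ‖ * freqNorm ξ ^ (s / 2) ≤ (weightedSup s c).toReal := by
    rw [← ENNReal.ofReal_le_iff_le_toReal h.ne]; exact h1
  have h3 := one_le_norm_of_ne_zero hξ
  have h4 := norm_le_freqNorm ξ
  calc (1 + ‖ξ‖) ^ (s / 2) * ‖c ξ‖ ≤ (2 * freqNorm ξ) ^ (s / 2) * ‖c ξ‖ := by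
        gcongr; linarith
    _ = 2 ^ (s / 2) * (‖c ξ‖ * freqNorm ξ ^ (s / 2)) := by
        rw [Real.mul_rpow (by norm_num) (freqNorm_nonneg ξ)]; ring
    _ ≤ _ := by gcongr

lemma weightedSup_lt_top {s C : ℝ} (hs : 0 ≤ s) {c : (Fin d → ℤ) → ℂ}
    (h : ∀ ξ, (1 + ‖ξ‖) ^ (s / 2) * ‖c ξ‖ ≤ C) : weightedSup s c < ∞ :=
  (weightedSup_le hs h).trans_lt ENNReal.ofReal_lt_top

/-- Nonzero integer frequencies have length at least one. The zero frequency must be excluded since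
its weight is `0 ^ 0 = 1` for `s = 0` and `0` for `s > 0`; differences of probability measures
vanish there. -/
lemma weightedSup_mono {s t : ℝ} (hst : s ≤ t) {c : (Fin d → ℤ) → ℂ} (h0 : c 0 = 0) :
    weightedSup s c ≤ weightedSup t c := by
  refine iSup_mono fun ξ => ?_
  by_cases hξ : ξ = 0
  · simp [hξ, h0]
  gcongr
  exact (one_le_norm_of_ne_zero hξ).trans (norm_le_freqNorm ξ)

lemma fourierCoeffMeasure_eq_hat (μ : ProbabilityMeasure (Torus d)) :
    fourierCoeffMeasure μ = hat (μ : Measure (Torus d)) := rfl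

lemma fourierCoeffMeasure_zero (μ : ProbabilityMeasure (Torus d)) : fourierCoeffMeasure μ 0 = 1 := by
  rw [fourierCoeffMeasure_eq_hat, hat_zero_freq]; simp

/-- The neighbourhoods in `𝒳_β` are governed by the Hausdorff distance and a single seminorm. -/
lemma XSpace.exists_of_mem_nhds {β : ℝ} (hβ : 0 < β) {p : XSpace d β} {U : Set (XSpace d β)}
    (hU : U ∈ 𝓝 p) : ∃ s ε : ℝ, 0 < s ∧ s < β ∧ 0 < ε ∧ ∀ q : XSpace d β,
      edist q.set p.set < ENNReal.ofReal ε →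
      weightedSup s (fourierCoeffMeasure q.measure - fourierCoeffMeasure p.measure)
        < ENNReal.ofReal ε → q ∈ U := by
  have hmono : ∀ (s t : ℝ), s ≤ t → ∀ p q : XSpace d β,
      weightedSup s (fourierCoeffMeasure q.measure - fourierCoeffMeasure p.measure)
        ≤ weightedSup t (fourierCoeffMeasure q.measure - fourierCoeffMeasure p.measure) :=
    fun s t hst p q => weightedSup_mono hst (by simp [fourierCoeffMeasure_zero])
  have hnhds : 𝓝 p = comap XSpace.set (𝓝 p.set) ⊓ ⨅ s : Set.Ico (0 : ℝ) β,
      @nhds _ (XSpace.seminormDist d β s).toUniformSpace.toTopologicalSpace p := by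
    refine (nhds_inf (t₁ := TopologicalSpace.induced XSpace.set inferInstance)
      (t₂ := ⨅ s : Set.Ico (0 : ℝ) β,
        (XSpace.seminormDist d β s).toUniformSpace.toTopologicalSpace) (a := p)).trans ?_
    rw [nhds_induced, nhds_iInf]
  rw [hnhds, Filter.mem_inf_iff] at hU
  obtain ⟨U₁, hU₁, U₂, hU₂, rfl⟩ := hU
  have : Nonempty (Set.Ico (0 : ℝ) β) := ⟨⟨0, le_rfl, hβ⟩⟩
  have hball : ∀ s : Set.Ico (0 : ℝ) β, ∀ {V : Set (XSpace d β)},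
      V ∈ @nhds _ (XSpace.seminormDist d β s).toUniformSpace.toTopologicalSpace p ↔
      ∃ ε > 0, {q | weightedSup s (fourierCoeffMeasure q.measure - fourierCoeffMeasure p.measure)
        < ε} ⊆ V := by
    intro s V
    let _ := XSpace.seminormDist d β s
    exact EMetric.mem_nhds_iff
  rw [mem_iInf_of_directed] at hU₂
  · obtain ⟨s, hs⟩ := hU₂
    rw [hball] at hs
    obtain ⟨ε₂, hε₂, h₂⟩ := hs
    rw [mem_comap] at hU₁
    obtain ⟨W, hW, hWU⟩ := hU₁
    obtain ⟨ε₁, hε₁, h₁⟩ := EMetric.mem_nhds_iff.1 hW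
    obtain ⟨e, he0, he⟩ := ENNReal.lt_iff_exists_nnreal_btwn.1 (lt_min hε₁ hε₂)
    -- The exponent is moved up to the midpoint so that it is strictly positive even if `s = 0`.
    refine ⟨(s + β) / 2, e, by have := s.2.1; linarith, by have := s.2.2; linarith,
      by exact_mod_cast he0, fun q h3 h4 => ⟨?_, ?_⟩⟩
    · refine hWU (h₁ (h3.trans ?_))
      rw [ENNReal.ofReal_coe_nnreal]
      exact he.trans_le (min_le_left _ _)
    · refine h₂ (lt_of_le_of_lt (hmono _ _ (by have := s.2.2; linarith) p q) (h4.trans ?_))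
      rw [ENNReal.ofReal_coe_nnreal]
      exact he.trans_le (min_le_right _ _)
  · intro s t
    refine ⟨⟨max s t, le_max_of_le_left s.2.1, max_lt s.2.2 t.2.2⟩, ?_, ?_⟩
    · intro V hV
      rw [hball] at hV ⊢
      obtain ⟨ε, hε, h⟩ := hV
      exact ⟨ε, hε, fun q hq => h (lt_of_le_of_lt (hmono _ _ (le_max_left _ _) p q) hq)⟩
    · intro V hV
      rw [hball] at hV ⊢
      obtain ⟨ε, hε, h⟩ := hV
      exact ⟨ε, hε, fun q hq => h (lt_of_le_of_lt (hmono _ _ (le_max_right _ _) p q) hq)⟩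

lemma XSpace.continuous_set {β : ℝ} : Continuous (XSpace.set : XSpace d β → Compacts (Torus d)) :=
  continuous_iff_le_induced.2 inf_le_left

/-! ### From approximation of mollified measures to density -/

/-- Mollified measures can be approximated by measures whose support has the property `Q`. -/
def SmoothApprox (d : ℕ) (β : ℝ) (Q : Set (Torus d) → Prop) : Prop :=
  ∃ δ₀ > 0, ∀ δ, 0 < δ → δ < δ₀ → ∀ κ : Measure (Torus d), IsFiniteMeasure κ →
    ∀ s, 0 < s → s < β → ∀ ε > 0, ∃ ν : Measure (Torus d), IsFiniteMeasure ν ∧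
      (∃ C, ∀ ξ, (1 + ‖ξ‖) ^ d * ‖hat ν ξ‖ ≤ C) ∧
      ν.support ⊆ Metric.cthickening (2 * δ) κ.support ∧
      (∀ ξ, (1 + ‖ξ‖) ^ (s / 2) * ‖hat ν ξ - bumpCoeff δ ξ * hat κ ξ‖ ≤ ε) ∧ Q ν.support

/-- Mollification at a small scale is a small change in the weaker of two norms. -/
lemma exists_mollify_close {s t C ε : ℝ} (hst : s < t) (hC : 0 ≤ C) (hε : 0 < ε) :
    ∃ δ₁ > 0, ∀ δ, 0 < δ → δ < δ₁ → ∀ c : (Fin d → ℤ) → ℂ,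
      (∀ ξ, (1 + ‖ξ‖) ^ (t / 2) * ‖c ξ‖ ≤ C) →
      ∀ ξ, (1 + ‖ξ‖) ^ (s / 2) * ‖bumpCoeff δ ξ * c ξ - c ξ‖ ≤ ε := by
  set a := (t - s) / 2 with ha
  have ha0 : 0 < a := by rw [ha]; linarith
  have hlim : Tendsto (fun R : ℝ => 2 * C * R ^ (-a)) atTop (𝓝 0) := by
    simpa using (tendsto_rpow_neg_atTop ha0).const_mul (2 * C)
  -- Above `R` the gap between the two weights gives the smallness; below `R` the mollifier is close
  -- to one for small `δ`.
  obtain ⟨R, hRε, hR1⟩ := ((hlim.eventually_le_const hε).and (eventually_ge_atTop 1)).exists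
  have hpi := Real.pi_pos
  set B := 2 * Real.pi * d * R * C + 1 with hB
  have hB0 : 0 < B := by positivity
  refine ⟨ε / B, by positivity, fun δ hδ hδ1 c hc ξ => ?_⟩
  have e1 : ‖bumpCoeff δ ξ * c ξ - c ξ‖ = ‖1 - bumpCoeff δ ξ‖ * ‖c ξ‖ := by
    rw [← norm_mul, ← norm_neg]; congr 1; ring
  have hpos : (0 : ℝ) < 1 + ‖ξ‖ := by positivity
  have e2 : (1 + ‖ξ‖) ^ (s / 2) = (1 + ‖ξ‖) ^ (-a) * (1 + ‖ξ‖) ^ (t / 2) := by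
    rw [← Real.rpow_add hpos]; congr 1; rw [ha]; ring
  rw [e1, e2]
  have e3 : (1 + ‖ξ‖) ^ (-a) * (1 + ‖ξ‖) ^ (t / 2) * (‖1 - bumpCoeff δ ξ‖ * ‖c ξ‖)
      ≤ (1 + ‖ξ‖) ^ (-a) * ‖1 - bumpCoeff δ ξ‖ * C := by
    have : (1 + ‖ξ‖) ^ (-a) * (1 + ‖ξ‖) ^ (t / 2) * (‖1 - bumpCoeff δ ξ‖ * ‖c ξ‖)
      = (1 + ‖ξ‖) ^ (-a) * ‖1 - bumpCoeff δ ξ‖ * ((1 + ‖ξ‖) ^ (t / 2) * ‖c ξ‖) := by ring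
    rw [this]
    gcongr
    exact hc ξ
  refine e3.trans ?_
  rcases le_total ‖ξ‖ R with h | h
  · have h1 : (1 + ‖ξ‖) ^ (-a) ≤ 1 :=
      Real.rpow_le_one_of_one_le_of_nonpos (by linarith [norm_nonneg ξ]) (by linarith)
    calc _ ≤ 1 * (2 * Real.pi * d * δ * R) * C := by
          gcongr
          refine (norm_one_sub_bumpCoeff_le hδ ξ).trans ?_
          gcongr
      _ = (2 * Real.pi * d * R * C) * δ := by ring
      _ ≤ B * (ε / B) := by
          refine mul_le_mul (by rw [hB]; linarith) hδ1.le hδ.le hB0.le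
      _ = ε := by field_simp
  · have h1 : (1 + ‖ξ‖) ^ (-a) ≤ R ^ (-a) :=
      Real.rpow_le_rpow_of_nonpos (by linarith) (by linarith) (by linarith)
    have h2 : ‖1 - bumpCoeff δ ξ‖ ≤ 2 := by
      refine (norm_sub_le _ _).trans ?_
      have := norm_bumpCoeff_le_one δ ξ
      rw [norm_one]; linarith
    calc _ ≤ R ^ (-a) * 2 * C := by gcongr
      _ ≤ ε := by linarith

lemma torusBump_zero_pos {δ : ℝ} (hδ : 0 < δ) : 0 < torusBump δ (0 : Torus d) := by
  obtain ⟨c, hc, h⟩ := exists_le_torusBump d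
  exact lt_of_lt_of_le (by positivity) (h δ hδ 0 (by simp; positivity))

/-- If the Fourier coefficients of `ν` are close to those of a mollified measure with an atom at
`y`, then the support of `ν` comes close to `y`. -/
lemma exists_support_near {δ : ℝ} (hδ : 0 < δ) (κ : Measure (Torus d)) [IsFiniteMeasure κ]
    {y : Torus d} (hy : κ {y} ≠ 0) :
    ∃ e > 0, ∀ ν : Measure (Torus d), IsFiniteMeasure ν →
      (∀ ξ, ‖hat ν ξ - bumpCoeff δ ξ * hat κ ξ‖ ≤ e) → ∃ x ∈ ν.support, dist y x ≤ δ := by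
  set f := smooth δ κ with hf
  have hfc : Continuous f := continuous_smooth hδ κ
  have hf0 : ∀ x, 0 ≤ f x := smooth_nonneg hδ κ
  have hbc := continuous_torusBump (d := d) hδ
  have hfy : 0 < f y := by
    have h1 : ∫ x, torusBump δ (y - x) ∂(κ.restrict {y}) ≤ f y := by
      refine setIntegral_le_integral ?_ (ae_of_all _ fun x => torusBump_nonneg hδ _)
      exact Continuous.integrable_of_hasCompactSupport (by fun_prop)
        (HasCompactSupport.of_compactSpace _)
    refine lt_of_lt_of_le ?_ h1
    rw [integral_singleton, sub_self, smul_eq_mul]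
    refine mul_pos ?_ (torusBump_zero_pos hδ)
    exact ENNReal.toReal_pos hy (measure_ne_top _ _)
  set F : Measure (Torus d) := volume.withDensity fun x => ENNReal.ofReal (f x) with hF
  have hFfin : IsFiniteMeasure F :=
    isFiniteMeasure_withDensity_ofReal (hfc.integrable_of_hasCompactSupport
      (HasCompactSupport.of_compactSpace f)).2
  -- The mollified measure, tested once more against the bump at `y`, gives a positive number
  -- because of the atom. Coefficients within `e` change this number by at most `S * e`, so `ν` also
  -- gives a nonzero value there.
  have hJ : 0 < smooth δ F y := by
    have h1 : smooth δ F y = ∫ x, f x * torusBump δ (y - x) := by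
      have := integral_withDensity_eq_integral_smul (μ := (volume : Measure (Torus d)))
        (f := fun x => Real.toNNReal (f x)) (by fun_prop) (fun x => torusBump δ (y - x))
      refine this.trans (integral_congr_ae (ae_of_all _ fun x => ?_))
      simp only [NNReal.smul_def, Real.coe_toNNReal _ (hf0 x), smul_eq_mul]
    rw [h1]
    refine Continuous.integral_pos_of_hasCompactSupport_nonneg_nonzero (x := y) (by fun_prop)
      (HasCompactSupport.of_compactSpace _)
      (fun x => mul_nonneg (hf0 x) (torusBump_nonneg hδ _)) ?_
    rw [sub_self]
    exact (mul_pos hfy (torusBump_zero_pos hδ)).ne'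
  have hFhat : ∀ ξ, hat F ξ = bumpCoeff δ ξ * hat κ ξ := fun ξ => by
    rw [hF, hat_withDensity hfc.measurable hf0, hf, coeff_smooth hδ]
  have hS := summable_norm_bumpCoeff (d := d) hδ
  set S := ∑' ξ : Fin d → ℤ, ‖bumpCoeff δ ξ‖ with hSdef
  have hS0 : 0 ≤ S := tsum_nonneg fun _ => norm_nonneg _
  refine ⟨smooth δ F y / (2 * (S + 1)), by positivity, fun ν hν hclose => ?_⟩
  have h1 : ‖(smooth δ ν y : ℂ) - smooth δ F y‖ ≤ S * (smooth δ F y / (2 * (S + 1))) := by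
    have h2 := (hasSum_smooth hδ ν y).sub (hasSum_smooth hδ F y)
    rw [← h2.tsum_eq, hSdef, ← tsum_mul_right]
    refine tsum_of_norm_bounded (hS.mul_right _).hasSum fun ξ => ?_
    rw [← sub_mul, ← mul_sub, norm_mul, norm_mul, norm_mFourier_apply, mul_one, hFhat]
    gcongr
    exact hclose ξ
  have h3 : smooth δ ν y ≠ 0 := by
    intro h0
    rw [h0, Complex.ofReal_zero, zero_sub, norm_neg, Complex.norm_real,
      Real.norm_of_nonneg hJ.le, mul_div_assoc', le_div_iff₀ (by positivity)] at h1
    nlinarith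
  exact exists_dist_le_of_smooth_ne_zero hδ ν Measure.measure_compl_support h3

lemma exists_pow_mul_norm_bumpCoeff_le {δ : ℝ} (hδ : 0 < δ) :
    ∃ C, 0 < C ∧ ∀ ξ : Fin d → ℤ, (1 + ‖ξ‖) ^ d * ‖bumpCoeff δ ξ‖ ≤ C := by
  obtain ⟨C, hC, h⟩ := exists_norm_bumpCoeff_le d d
  set m := min δ 1 with hm
  have hm0 : 0 < m := lt_min hδ one_pos
  refine ⟨C / m ^ d, by positivity, fun ξ => ?_⟩
  rw [le_div_iff₀ (by positivity)]
  refine le_trans ?_ (h δ hδ ξ)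
  calc (1 + ‖ξ‖) ^ d * ‖bumpCoeff δ ξ‖ * m ^ d = ‖bumpCoeff δ ξ‖ * (m * (1 + ‖ξ‖)) ^ d := by
        rw [mul_pow]; ring
    _ ≤ _ := by
        gcongr
        rw [mul_add, mul_one]
        have : m * ‖ξ‖ ≤ δ * ‖ξ‖ := by gcongr; exact min_le_left _ _
        linarith [min_le_right δ 1]

/-- A property of the supports that can be realized by approximations of mollified measures holds
on a dense subset of `𝒳_β`. -/
lemma dense_of_smoothApprox {β : ℝ} (hβ : 0 < β) (hβd : β ≤ d) {Q : Set (Torus d) → Prop}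
    (hQ : SmoothApprox d β Q) : Dense {p : XSpace d β | Q p.set} := by
  intro p
  rw [mem_closure_iff_nhds]
  intro U hU
  obtain ⟨s, ε, hs, hsβ, hε, hsub⟩ := XSpace.exists_of_mem_nhds hβ hU
  set μ : Measure (Torus d) := (p.measure : Measure (Torus d)) with hμ
  have hμE : μ (p.set : Set (Torus d))ᶜ = 0 :=
    measure_mono_null (Set.compl_subset_compl.2 p.support_subset) Measure.measure_compl_support
  have hE : (p.set : Set (Torus d)).Nonempty := by
    obtain ⟨x, hx⟩ := Measure.nonempty_support (IsProbabilityMeasure.ne_zero μ)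
    exact ⟨x, p.support_subset hx⟩
  -- Four errors of size `ε₁` arise below: normalization, approximation, mixing with point masses,
  -- and mollification.
  set ε₁ := ε / (8 * ((d : ℝ) + 1) ^ (s / 2)) with hε₁
  have hε₁0 : 0 < ε₁ := by positivity
  obtain ⟨C, hC0, hC⟩ := exists_of_weightedSup_lt_top (s := (s + β) / 2) (by linarith)
    (p.decay _ (by linarith) (by linarith))
  obtain ⟨δ₁, hδ₁, hmol⟩ := exists_mollify_close (d := d) (s := s) (t := (s + β) / 2)
    (by linarith) hC0 hε₁0
  obtain ⟨δ₀, hδ₀, happ⟩ := hQ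
  obtain ⟨δ, hδ0, hδ⟩ := exists_between (lt_min (lt_min hδ₀ hδ₁) (half_pos hε))
  obtain ⟨hδ', hδε⟩ := lt_min_iff.1 hδ
  obtain ⟨hδδ₀, hδδ₁⟩ := lt_min_iff.1 hδ'
  obtain ⟨K, hK0, hK⟩ := exists_pow_mul_norm_bumpCoeff_le (d := d) hδ0
  have hw : ∀ ξ : Fin d → ℤ, (1 + ‖ξ‖) ^ (s / 2) * ‖bumpCoeff δ ξ‖ ≤ K := fun ξ => by
    refine le_trans ?_ (hK ξ)
    gcongr
    exact rpow_half_le_pow (by linarith) ξ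
  obtain ⟨t, htE, htf, htc⟩ := p.set.isCompact.finite_cover_balls hδ0
  have htn : t.Nonempty := by
    obtain ⟨x, hx⟩ := hE
    obtain ⟨y, hy, -⟩ := Set.mem_iUnion₂.1 (htc hx)
    exact ⟨y, hy⟩
  -- The mixing error has size `2 * τ` before mollification, and the mollifier times the weight is
  -- at most `K`.
  set τ := min (1 / 2) (ε₁ / (2 * K)) with hτ
  have hτ0 : 0 < τ := lt_min (by norm_num) (by positivity)
  have hτ1 : τ ≤ 1 / 2 := min_le_left _ _
  set ρ : Measure (Torus d) := ProbabilityTheory.uniformOn t with hρ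
  have hρp : IsProbabilityMeasure ρ := ProbabilityTheory.isProbabilityMeasure_uniformOn htf htn
  -- The support of `μ` may be much smaller than the compact set. The atoms on a finite `δ`-net
  -- force the new support to come close to the whole set, as the Hausdorff distance requires.
  set κ : Measure (Torus d) := ENNReal.ofReal (1 - τ) • μ + ENNReal.ofReal τ • ρ with hκ
  have hf1 : IsFiniteMeasure (ENNReal.ofReal (1 - τ) • μ) := Measure.smul_finite _ ENNReal.ofReal_ne_top
  have hf2 : IsFiniteMeasure (ENNReal.ofReal τ • ρ) := Measure.smul_finite _ ENNReal.ofReal_ne_top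
  have hκhat : ∀ ξ, hat κ ξ = (1 - τ : ℝ) * hat μ ξ + (τ : ℝ) * hat ρ ξ := fun ξ => by
    rw [hκ, hat_add, hat_smul, hat_smul, ENNReal.toReal_ofReal (by linarith),
      ENNReal.toReal_ofReal hτ0.le]
  have hκ0 : hat κ 0 = 1 := by
    rw [hκhat, hat_zero_freq, hat_zero_freq]; simp
  have hκE : κ.support ⊆ p.set := by
    refine Measure.support_subset_of_isClosed p.set.isCompact.isClosed ?_
    rw [mem_ae_iff, hκ]
    have : ρ (p.set : Set (Torus d))ᶜ = 0 := by
      rw [hρ, ProbabilityTheory.uniformOn_eq_zero_iff htf]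
      exact Set.disjoint_iff_inter_eq_empty.1 (Set.disjoint_compl_right_iff_subset.2 htE)
    simp [hμE, this]
  have hκt : ∀ y ∈ t, κ {y} ≠ 0 := fun y hy => by
    have : ρ {y} ≠ 0 := by
      rw [hρ, Ne, ProbabilityTheory.uniformOn_eq_zero_iff htf, ← Ne, ← Set.nonempty_iff_ne_empty]
      exact ⟨y, hy, rfl⟩
    simp [hκ, this, hτ0]
  have hnear : ∀ᶠ e in 𝓝[>] (0 : ℝ), ∀ y ∈ t, ∀ ν : Measure (Torus d), IsFiniteMeasure ν →
      (∀ ξ, ‖hat ν ξ - bumpCoeff δ ξ * hat κ ξ‖ ≤ e) → ∃ x ∈ ν.support, dist y x ≤ δ := by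
    rw [Filter.eventually_all_finite htf]
    intro y hy
    obtain ⟨e, he, h⟩ := exists_support_near hδ0 κ (hκt y hy)
    filter_upwards [Ioc_mem_nhdsGT he] with e' he' ν hν hc
    exact h ν hν fun ξ => (hc ξ).trans he'.2
  obtain ⟨e, hnear, he⟩ := (hnear.and (Ioc_mem_nhdsGT (show 0 < min (min (1 / 2) ε₁)
    (ε₁ / (2 * (1 + K))) by positivity))).exists
  obtain ⟨he0, he⟩ := he
  obtain ⟨he', heK⟩ := le_min_iff.1 he
  obtain ⟨he2, heε⟩ := le_min_iff.1 he'
  obtain ⟨ν, hν, ⟨D, hD⟩, hνs, hνc, hνQ⟩ := happ δ hδ0 hδδ₀ κ inferInstance s hs hsβ e he0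
  have hone : ∀ ξ : Fin d → ℤ, (1 : ℝ) ≤ (1 + ‖ξ‖) ^ (s / 2) := fun ξ =>
    Real.one_le_rpow (by linarith [norm_nonneg ξ]) (by linarith)
  have hνc' : ∀ ξ, ‖hat ν ξ - bumpCoeff δ ξ * hat κ ξ‖ ≤ e := fun ξ =>
    (le_mul_of_one_le_left (norm_nonneg _) (hone ξ)).trans (hνc ξ)
  set m := ν.real Set.univ with hm
  have hm1 : |m - 1| ≤ e := by
    have := hνc' 0
    rw [hκ0, bumpCoeff_zero, hat_zero_freq, mul_one] at this
    rwa [← Complex.ofReal_one, ← Complex.ofReal_sub, Complex.norm_real] at this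
  have hmh : 1 / 2 ≤ m := by have := (abs_le.1 hm1).1; linarith
  have hν0 : ν Set.univ ≠ 0 := fun h => by
    have : m = 0 := by rw [hm, Measure.real, h]; rfl
    linarith
  -- The total mass is the coefficient at zero, hence within `e` of one, so normalizing is a small
  -- change.
  set ν' : Measure (Torus d) := (ν Set.univ)⁻¹ • ν with hν'
  have hν'p : IsProbabilityMeasure ν' := ⟨by
    rw [hν', Measure.smul_apply, smul_eq_mul,
      ENNReal.inv_mul_cancel hν0 (measure_ne_top _ _)]⟩
  have hν'hat : ∀ ξ, hat ν' ξ = (m⁻¹ : ℝ) * hat ν ξ := fun ξ => by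
    rw [hν', hat_smul, ENNReal.toReal_inv]; rfl
  have hm2 : m⁻¹ ≤ 2 := by
    rw [inv_le_comm₀ (by linarith) (by norm_num)]; linarith
  let q : XSpace d β :=
    { set := ⟨ν.support, Measure.isClosed_support.isCompact⟩
      measure := ⟨ν', hν'p⟩
      support_subset := Measure.AbsolutelyContinuous.support_mono
        Measure.smul_absolutelyContinuous
      decay := fun u hu hu' => by
        refine weightedSup_lt_top (C := 2 * D) hu fun ξ => ?_
        change (1 + ‖ξ‖) ^ (u / 2) * ‖hat ν' ξ‖ ≤ 2 * D
        rw [hν'hat, norm_mul, Complex.norm_real, Real.norm_of_nonneg (by positivity)]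
        calc (1 + ‖ξ‖) ^ (u / 2) * (m⁻¹ * ‖hat ν ξ‖) = m⁻¹ * ((1 + ‖ξ‖) ^ (u / 2) * ‖hat ν ξ‖) := by
              ring
          _ ≤ 2 * ((1 + ‖ξ‖) ^ d * ‖hat ν ξ‖) := by
              gcongr
              exact rpow_half_le_pow (by linarith) ξ
          _ ≤ 2 * D := by gcongr; exact hD ξ }
  refine ⟨q, hsub q ?_ ?_, hνQ⟩
  · rw [Compacts.edist_eq]
    refine lt_of_le_of_lt (Metric.hausdorffEDist_le_of_infEDist (r := ENNReal.ofReal (2 * δ))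
      ?_ ?_) ((ENNReal.ofReal_lt_ofReal_iff hε).2 (by linarith))
    · intro x hx
      have h1 := Metric.cthickening_subset_of_subset (2 * δ) hκE (hνs hx)
      exact Metric.mem_cthickening_iff.1 h1
    · intro x hx
      obtain ⟨y, hy, hxy⟩ := Set.mem_iUnion₂.1 (htc hx)
      obtain ⟨z, hz, hyz⟩ := hnear y hy ν hν hνc'
      refine (Metric.infEDist_le_edist_of_mem hz).trans ?_
      rw [edist_dist]
      refine ENNReal.ofReal_le_ofReal ?_
      have := dist_triangle x y z
      have := Metric.mem_ball.1 hxy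
      linarith
  · refine lt_of_le_of_lt (weightedSup_le (ε := 4 * ε₁) hs.le fun ξ => ?_)
      ((ENNReal.ofReal_lt_ofReal_iff hε).2 ?_)
    · change (1 + ‖ξ‖) ^ (s / 2) * ‖hat ν' ξ - hat μ ξ‖ ≤ 4 * ε₁
      set w := (1 + ‖ξ‖) ^ (s / 2) with hwdef
      have hw0 : 0 < w := by positivity
      have h1 : w * ‖hat ν' ξ - hat ν ξ‖ ≤ ε₁ := by
        have e1 : hat ν' ξ - hat ν ξ = ((m⁻¹ * (1 - m) : ℝ) : ℂ) * hat ν ξ := by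
          rw [hν'hat, mul_sub, mul_one, inv_mul_cancel₀ (by linarith)]
          push_cast; ring
        have e2 : w * ‖hat ν ξ‖ ≤ 1 + K := by
          have : ‖hat ν ξ‖ ≤ ‖hat ν ξ - bumpCoeff δ ξ * hat κ ξ‖ + ‖bumpCoeff δ ξ‖ := by
            have h2 : ‖hat κ ξ‖ ≤ 1 := by
              refine (norm_hat_le κ ξ).trans (le_of_eq ?_)
              have := hat_zero_freq κ
              rw [hκ0] at this
              exact_mod_cast this.symm
            have h3 : ‖bumpCoeff δ ξ * hat κ ξ‖ ≤ ‖bumpCoeff δ ξ‖ := by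
              rw [norm_mul]; exact mul_le_of_le_one_right (norm_nonneg _) h2
            have := norm_add_le (hat ν ξ - bumpCoeff δ ξ * hat κ ξ) (bumpCoeff δ ξ * hat κ ξ)
            rw [sub_add_cancel] at this
            linarith
          calc w * ‖hat ν ξ‖ ≤ w * (‖hat ν ξ - bumpCoeff δ ξ * hat κ ξ‖ + ‖bumpCoeff δ ξ‖) := by
                gcongr
            _ ≤ e + K := by rw [mul_add]; exact add_le_add (hνc ξ) (hw ξ)
            _ ≤ 1 + K := by linarith
        rw [e1, norm_mul, Complex.norm_real, norm_mul, Real.norm_of_nonneg (by positivity),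
          Real.norm_eq_abs, abs_sub_comm]
        calc w * (m⁻¹ * |m - 1| * ‖hat ν ξ‖) = m⁻¹ * |m - 1| * (w * ‖hat ν ξ‖) := by ring
          _ ≤ 2 * (ε₁ / (2 * (1 + K))) * (1 + K) := by
              gcongr
              exact hm1.trans heK
          _ = ε₁ := by field_simp
      have h2 : w * ‖hat ν ξ - bumpCoeff δ ξ * hat κ ξ‖ ≤ ε₁ := (hνc ξ).trans heε
      have h3 : w * ‖bumpCoeff δ ξ * (hat κ ξ - hat μ ξ)‖ ≤ ε₁ := by
        have e1 : ‖hat κ ξ - hat μ ξ‖ ≤ 2 * τ := by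
          have : hat κ ξ - hat μ ξ = (τ : ℝ) * (hat ρ ξ - hat μ ξ) := by
            rw [hκhat]; push_cast; ring
          rw [this, norm_mul, Complex.norm_real, Real.norm_of_nonneg hτ0.le]
          have h4 := norm_hat_le ρ ξ
          have h5 := norm_hat_le μ ξ
          rw [probReal_univ] at h4 h5
          have := norm_sub_le (hat ρ ξ) (hat μ ξ)
          nlinarith
        rw [norm_mul, ← mul_assoc]
        calc _ ≤ K * (2 * (ε₁ / (2 * K))) := by
              gcongr
              · exact hw ξ
              · refine e1.trans ?_
                gcongr
                exact min_le_right _ _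
          _ = ε₁ := by field_simp
      have h4 : w * ‖bumpCoeff δ ξ * hat μ ξ - hat μ ξ‖ ≤ ε₁ := hmol δ hδ0 hδδ₁ _ hC ξ
      have h5 : ‖hat ν' ξ - hat μ ξ‖ ≤ ‖hat ν' ξ - hat ν ξ‖
          + ‖hat ν ξ - bumpCoeff δ ξ * hat κ ξ‖ + ‖bumpCoeff δ ξ * (hat κ ξ - hat μ ξ)‖
          + ‖bumpCoeff δ ξ * hat μ ξ - hat μ ξ‖ := by
        refine le_trans (le_of_eq ?_) norm_add₄_le
        congr 1; ring
      have := mul_le_mul_of_nonneg_left h5 hw0.le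
      linarith
    · rw [hε₁]
      have : ((d : ℝ) + 1) ^ (s / 2) * (4 * (ε / (8 * ((d : ℝ) + 1) ^ (s / 2)))) = ε / 2 := by
        field_simp; norm_num
      rw [this]; linarith

/-! ### Completeness of `𝒳_β` -/

lemma weightedSup_le_add_sub (s : ℝ) (c c' : (Fin d → ℤ) → ℂ) :
    weightedSup s c ≤ weightedSup s c' + weightedSup s (c' - c) := by
  refine iSup_le fun ξ => ?_
  refine le_trans ?_ (add_le_add
    (le_iSup (fun ξ => ‖c' ξ‖ₑ * ENNReal.ofReal (freqNorm ξ ^ (s / 2))) ξ)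
    (le_iSup (fun ξ => ‖(c' - c) ξ‖ₑ * ENNReal.ofReal (freqNorm ξ ^ (s / 2))) ξ))
  rw [← add_mul]
  gcongr
  have : c ξ = c' ξ - (c' - c) ξ := by simp
  rw [this]
  exact enorm_sub_le

lemma tendsto_fourierCoeffMeasure {ι : Type*} {L : Filter ι} {μ : ProbabilityMeasure (Torus d)}
    {u : ι → ProbabilityMeasure (Torus d)} (h : Tendsto u L (𝓝 μ)) (ξ : Fin d → ℤ) :
    Tendsto (fun i => fourierCoeffMeasure (u i) ξ) L (𝓝 (fourierCoeffMeasure μ ξ)) :=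
  (ProbabilityMeasure.tendsto_iff_forall_integral_rclike_tendsto ℂ).1 h
    (BoundedContinuousFunction.mkOfCompact (mFourier (-ξ)))

/-- A weak limit of measures supported in sets converging to `E` is supported in `E`. -/
lemma support_subset_of_tendsto {L : Filter ℕ} [L.NeBot] {μ : ProbabilityMeasure (Torus d)}
    {u : ℕ → ProbabilityMeasure (Torus d)} (h : Tendsto u L (𝓝 μ))
    {F : ℕ → Compacts (Torus d)} {E : Compacts (Torus d)} (hF : Tendsto F L (𝓝 E))
    (hu : ∀ i, (u i : Measure (Torus d)).support ⊆ F i) :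
    (μ : Measure (Torus d)).support ⊆ E := by
  refine Measure.support_subset_of_isClosed E.isCompact.isClosed ?_
  rw [mem_ae_iff]
  have hU : (E : Set (Torus d))ᶜ
      ⊆ ⋃ k : ℕ, {x | ENNReal.ofReal (1 / ((k : ℝ) + 1)) < Metric.infEDist x E} := by
    intro x hx
    have h0 : 0 < Metric.infEDist x E :=
      (Metric.infEDist_pos_iff_notMem_closure).2 (by rwa [E.isCompact.isClosed.closure_eq])
    have hlim : Tendsto (fun k : ℕ => ENNReal.ofReal (1 / ((k : ℝ) + 1))) atTop (𝓝 0) := by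
      have := (ENNReal.continuous_ofReal.tendsto 0).comp
        (tendsto_one_div_add_atTop_nhds_zero_nat (𝕜 := ℝ))
      rwa [ENNReal.ofReal_zero] at this
    obtain ⟨k, hk⟩ := (hlim.eventually_lt_const h0).exists
    exact Set.mem_iUnion.2 ⟨k, hk⟩
  refine measure_mono_null hU (measure_iUnion_null fun k => ?_)
  set O := {x | ENNReal.ofReal (1 / ((k : ℝ) + 1)) < Metric.infEDist x (E : Set (Torus d))} with hO
  have hOo : IsOpen O := isOpen_lt continuous_const Metric.continuous_infEDist
  refine le_antisymm ((ProbabilityMeasure.le_liminf_measure_open_of_tendsto h hOo).trans ?_) bot_le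
  refine liminf_le_of_frequently_le' (Eventually.frequently ?_)
  have he : ∀ᶠ i in L, edist (F i) E < ENNReal.ofReal (1 / ((k : ℝ) + 1)) :=
    hF.eventually (Metric.eball_mem_nhds E (by positivity))
  filter_upwards [he] with i hi
  refine le_of_eq (measure_mono_null ?_ (Measure.measure_compl_support (μ := (u i : Measure (Torus d)))))
  intro x hx hxs
  refine lt_irrefl _ ((lt_of_lt_of_le hx ?_).trans hi)
  rw [Compacts.edist_eq]
  exact Metric.infEDist_le_hausdorffEDist_of_mem (hu i hxs)

/-- Weak compactness of the probability measures provides a limit along an ultrafilter. Its Fourier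
coefficients are pointwise limits, and the Cauchy bounds, being closed conditions at each frequency,
pass to it along the full sequence. -/
lemma XSpace.exists_limit {β : ℝ} {u : ℕ → XSpace d β} {E : Compacts (Torus d)}
    (hE : Tendsto (fun i => (u i).set) atTop (𝓝 E)) {s : ℕ → ℝ} (hs : ∀ t < β, ∃ k, t ≤ s k)
    (hC : ∀ k, ∀ ε : ℝ≥0∞, 0 < ε → ∃ N, ∀ i ≥ N, ∀ j ≥ N, weightedSup (s k)
      (fourierCoeffMeasure (u i).measure - fourierCoeffMeasure (u j).measure) ≤ ε) :
    ∃ p : XSpace d β, p.set = E ∧ ∀ k, ∀ ε : ℝ≥0∞, 0 < ε → ∃ N, ∀ i ≥ N, weightedSup (s k)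
      (fourierCoeffMeasure (u i).measure - fourierCoeffMeasure p.measure) ≤ ε := by
  obtain ⟨μ, -, hμ⟩ := (isCompact_univ (X := ProbabilityMeasure (Torus d))).ultrafilter_le_nhds
    ((Ultrafilter.map (fun i => (u i).measure) (hyperfilter ℕ))) (by simp)
  set L : Filter ℕ := (hyperfilter ℕ : Filter ℕ) with hL
  have hLn : L ≤ atTop := Nat.hyperfilter_le_atTop
  have hμ' : Tendsto (fun i => (u i).measure) L (𝓝 μ) := hμ
  have hconv : ∀ k, ∀ ε : ℝ≥0∞, 0 < ε → ∃ N, ∀ i ≥ N, weightedSup (s k)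
      (fourierCoeffMeasure (u i).measure - fourierCoeffMeasure μ) ≤ ε := by
    intro k ε hε
    obtain ⟨N, hN⟩ := hC k ε hε
    refine ⟨N, fun i hi => iSup_le fun ξ => ?_⟩
    have h1 : Tendsto (fun j => ‖fourierCoeffMeasure (u i).measure ξ
        - fourierCoeffMeasure (u j).measure ξ‖ₑ * ENNReal.ofReal (freqNorm ξ ^ (s k / 2))) L
        (𝓝 (‖fourierCoeffMeasure (u i).measure ξ - fourierCoeffMeasure μ ξ‖ₑ
          * ENNReal.ofReal (freqNorm ξ ^ (s k / 2)))) :=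
      ENNReal.Tendsto.mul_const
        ((tendsto_const_nhds.sub (tendsto_fourierCoeffMeasure hμ' ξ)).enorm)
        (Or.inr ENNReal.ofReal_ne_top)
    refine le_of_tendsto h1 (((eventually_ge_atTop N).filter_mono hLn).mono fun j hj => ?_)
    refine le_trans ?_ (hN i hi j hj)
    exact le_iSup (fun ξ => ‖(fourierCoeffMeasure (u i).measure
      - fourierCoeffMeasure (u j).measure) ξ‖ₑ * ENNReal.ofReal (freqNorm ξ ^ (s k / 2))) ξ
  refine ⟨⟨E, μ, support_subset_of_tendsto hμ' (hE.mono_left hLn) fun i => (u i).support_subset,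
    fun t ht htβ => ?_⟩, rfl, hconv⟩
  obtain ⟨k, hk⟩ := hs t htβ
  obtain ⟨N, hN⟩ := hconv k 1 one_pos
  refine (weightedSup_le_add_sub t _ (fourierCoeffMeasure (u N).measure)).trans_lt
    (ENNReal.add_lt_top.2 ⟨(u N).decay t ht htβ, ?_⟩)
  refine ((weightedSup_mono hk (by simp [fourierCoeffMeasure_zero])).trans (hN N le_rfl)).trans_lt
    ENNReal.one_lt_top

/-- The space `𝒳_β` is completely metrizable, hence a Baire space. -/
lemma XSpace.baireSpace {β : ℝ} (hβ : 0 < β) : BaireSpace (XSpace d β) := by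
  -- A sequence of exponents increasing to `β`; by monotonicity of the seminorms it generates the
  -- same topology, now from countably many seminorms.
  set s : ℕ → ℝ := fun k => β * (1 - 1 / ((k : ℝ) + 1)) with hsdef
  have hpos : ∀ k : ℕ, (0 : ℝ) < 1 / ((k : ℝ) + 1) := fun k => by positivity
  have hs0 : ∀ k, 0 ≤ s k := fun k => by
    have : 1 / ((k : ℝ) + 1) ≤ 1 := by
      rw [div_le_one (by positivity)]; linarith [Nat.cast_nonneg (α := ℝ) k]
    exact mul_nonneg hβ.le (by linarith)
  have hsβ : ∀ k, s k < β := fun k => by have := mul_pos hβ (hpos k); simp only [hsdef]; linarith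
  have hs : ∀ t < β, ∃ k, t ≤ s k := fun t ht => by
    have hlim : Tendsto s atTop (𝓝 β) := by
      have := ((tendsto_one_div_add_atTop_nhds_zero_nat (𝕜 := ℝ)).const_sub 1).const_mul β
      rwa [sub_zero, mul_one] at this
    obtain ⟨k, hk⟩ := (hlim.eventually_const_lt ht).exists
    exact ⟨k, hk.le⟩
  let 𝒰 : UniformSpace (XSpace d β) :=
    UniformSpace.comap XSpace.set inferInstance ⊓ ⨅ k, (XSpace.seminormDist d β (s k)).toUniformSpace
  have hunif : @uniformity _ 𝒰 = comap (fun p => (p.1.set, p.2.set)) (uniformity (Compacts (Torus d)))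
      ⊓ ⨅ k, @uniformity _ (XSpace.seminormDist d β (s k)).toUniformSpace := by
    refine (inf_uniformity (u := UniformSpace.comap XSpace.set inferInstance)
      (v := ⨅ k, (XSpace.seminormDist d β (s k)).toUniformSpace)).trans ?_
    rw [iInf_uniformity, uniformity_comap]
    rfl
  have hnhds : ∀ p, @nhds _ 𝒰.toTopologicalSpace p = comap XSpace.set (𝓝 p.set)
      ⊓ ⨅ k, @nhds _ (XSpace.seminormDist d β (s k)).toUniformSpace.toTopologicalSpace p := by
    intro p
    have h1 : 𝒰.toTopologicalSpace = TopologicalSpace.induced XSpace.set inferInstance ⊓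
        ⨅ k, (XSpace.seminormDist d β (s k)).toUniformSpace.toTopologicalSpace := by
      refine (UniformSpace.toTopologicalSpace_inf (u := UniformSpace.comap XSpace.set inferInstance)
        (v := ⨅ k, (XSpace.seminormDist d β (s k)).toUniformSpace)).trans ?_
      rw [UniformSpace.toTopologicalSpace_iInf]
      rfl
    refine (congrArg (fun t => @nhds _ t p) h1).trans ?_
    refine (nhds_inf (t₁ := TopologicalSpace.induced XSpace.set inferInstance)
      (t₂ := ⨅ k, (XSpace.seminormDist d β (s k)).toUniformSpace.toTopologicalSpace)
      (a := p)).trans ?_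
    rw [nhds_induced, nhds_iInf]
  have htop : 𝒰.toTopologicalSpace = XSpace.instTopologicalSpace d β := by
    refine le_antisymm (le_of_nhds_le_nhds fun p => ?_) ?_
    · intro U hU
      obtain ⟨t, ε, ht, htβ, hε, h⟩ := XSpace.exists_of_mem_nhds hβ hU
      obtain ⟨k, hk⟩ := hs t htβ
      rw [hnhds]
      have h1 : {q : XSpace d β | edist q.set p.set < ENNReal.ofReal ε}
          ∈ comap XSpace.set (𝓝 p.set) :=
        preimage_mem_comap (Metric.eball_mem_nhds _ (by positivity))
      have h2 : {q : XSpace d β | weightedSup (s k)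
          (fourierCoeffMeasure q.measure - fourierCoeffMeasure p.measure) < ENNReal.ofReal ε} ∈
          ⨅ k, @nhds _ (XSpace.seminormDist d β (s k)).toUniformSpace.toTopologicalSpace p := by
        refine (iInf_le (fun k => @nhds _
          (XSpace.seminormDist d β (s k)).toUniformSpace.toTopologicalSpace p) k) ?_
        let _ := XSpace.seminormDist d β (s k)
        exact Metric.eball_mem_nhds _ (by positivity)
      filter_upwards [mem_inf_of_left h1, mem_inf_of_right h2] with q hq1 hq2
      exact h q hq1 ((weightedSup_mono hk (by simp [fourierCoeffMeasure_zero])).trans_lt hq2)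
    · refine le_of_nhds_le_nhds fun p => ?_
      rw [hnhds]
      refine le_inf ?_ (le_iInf fun k => ?_)
      · exact XSpace.continuous_set.continuousAt.le_comap
      · refine nhds_mono (inf_le_right.trans ?_)
        exact iInf_le (fun t : Set.Ico (0 : ℝ) β =>
          (XSpace.seminormDist d β t).toUniformSpace.toTopologicalSpace) ⟨s k, hs0 k, hsβ k⟩
  have hcount : IsCountablyGenerated (@uniformity _ 𝒰) := by
    rw [hunif]
    have : ∀ k, IsCountablyGenerated
        (@uniformity _ (XSpace.seminormDist d β (s k)).toUniformSpace) := fun k =>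
      @EMetric.instIsCountablyGeneratedUniformity _ (XSpace.seminormDist d β (s k))
    infer_instance
  have hcomplete : @CompleteSpace _ 𝒰 := by
    refine @UniformSpace.complete_of_cauchySeq_tendsto _ 𝒰 hcount fun u hu => ?_
    have hu2 := hu.2
    rw [hunif] at hu2
    have hset : CauchySeq fun i => (u i).set := by
      refine ⟨inferInstance, ?_⟩
      have := hu2.trans inf_le_left
      rw [← map_le_iff_le_comap] at this
      refine le_trans (le_of_eq ?_) this
      rw [prod_map_map_eq, prod_map_map_eq, map_map]
      rfl
    obtain ⟨E, hE⟩ := cauchySeq_tendsto_of_complete hset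
    have hC : ∀ k, ∀ ε : ℝ≥0∞, 0 < ε → ∃ N, ∀ i ≥ N, ∀ j ≥ N, weightedSup (s k)
        (fourierCoeffMeasure (u i).measure - fourierCoeffMeasure (u j).measure) ≤ ε := by
      intro k ε hε
      have h1 : @CauchySeq _ _ (XSpace.seminormDist d β (s k)).toUniformSpace _ u := ⟨inferInstance, hu2.trans (inf_le_right.trans (iInf_le
        (fun k => @uniformity _ (XSpace.seminormDist d β (s k)).toUniformSpace) k))⟩
      obtain ⟨N, hN⟩ := (@EMetric.cauchySeq_iff _ _ (XSpace.seminormDist d β (s k)) _ _ _).1 h1 ε hε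
      exact ⟨N, fun i hi j hj => (hN i hi j hj).le⟩
    obtain ⟨p, hpE, hp⟩ := XSpace.exists_limit hE hs hC
    refine ⟨p, ?_⟩
    rw [hnhds, tendsto_inf, tendsto_iInf]
    refine ⟨tendsto_comap_iff.2 (hpE ▸ hE), fun k => ?_⟩
    let _ := XSpace.seminormDist d β (s k)
    refine EMetric.tendsto_atTop.2 fun ε hε => ?_
    obtain ⟨e, he0, he⟩ := exists_between hε
    obtain ⟨N, hN⟩ := hp k e he0
    exact ⟨N, fun i hi => (hN i hi).trans_lt he⟩
  have : @BaireSpace _ 𝒰.toTopologicalSpace := by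
    let _ := @UniformSpace.pseudoMetricSpace _ 𝒰 hcount
    exact inferInstance
  rwa [htop] at this

/-! ### Fourier decay bounds the Hausdorff dimension from below -/

lemma summable_one_add_norm_rpow {r : ℝ} (hr : r < -d) :
    Summable fun ξ : Fin d → ℤ => (1 + ‖ξ‖) ^ r := by
  have hr0 : r < 0 := hr.trans_le (by simp)
  have h0 : Summable fun ξ : Fin d → ℤ => if ξ = 0 then (1 : ℝ) else 0 :=
    summable_of_ne_finset_zero (s := {0}) (by simp +contextual)
  refine Summable.of_nonneg_of_le (fun _ => by positivity) (fun ξ => ?_)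
    ((summable_norm_rpow_int d hr).add h0)
  by_cases hξ : ξ = 0
  · simp [hξ, Real.zero_rpow hr0.ne]
  · simp only [hξ, if_false, add_zero]
    exact Real.rpow_le_rpow_of_nonpos (by have := one_le_norm_of_ne_zero hξ; linarith)
      (by linarith) hr0.le

/-- The energy of a measure at scale `ρ` is controlled by its Fourier decay. -/
lemma exists_integral_smooth_le {s t C : ℝ} (ht : t < s) (hsd : s ≤ d) (ht0 : 0 ≤ t)
    (μ : Measure (Torus d)) [IsProbabilityMeasure μ]
    (hμ : ∀ ξ, (1 + ‖ξ‖) ^ (s / 2) * ‖hat μ ξ‖ ≤ C) :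
    ∃ B, 0 ≤ B ∧ ∀ ρ, 0 < ρ → ρ ≤ 1 → ∫ x, smooth ρ μ x ∂μ ≤ B * ρ ^ (-(d - t)) := by
  obtain ⟨A, hA, hbump⟩ := exists_norm_bumpCoeff_le d d
  -- Two factors of decay `s / 2` from `μ` and `d - t` from the mollifier sum to more than `d`
  -- exactly because `t < s`.
  have hsum := summable_one_add_norm_rpow (d := d) (r := -(d - t) - s) (by linarith)
  have hC : 0 ≤ C := le_trans (by positivity) (hμ 0)
  have hμ' : ∀ ξ : Fin d → ℤ, ‖hat μ ξ‖ ≤ C * (1 + ‖ξ‖) ^ (-(s / 2)) := fun ξ => by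
    rw [Real.rpow_neg (by positivity), ← div_eq_mul_inv, le_div_iff₀ (by positivity), mul_comm]
    exact hμ ξ
  refine ⟨A * C ^ 2 * ∑' ξ : Fin d → ℤ, (1 + ‖ξ‖) ^ (-(d - t) - s),
    mul_nonneg (by positivity) (tsum_nonneg fun _ => by positivity), fun ρ hρ hρ1 => ?_⟩
  have hb : ∀ ξ : Fin d → ℤ, ‖bumpCoeff ρ ξ‖ ≤ A * (ρ ^ (-(d - t)) * (1 + ‖ξ‖) ^ (-(d - t))) := by
    intro ξ
    have h1 := hbump ρ hρ ξ
    have h2 : ρ * (1 + ‖ξ‖) ≤ 1 + ρ * ‖ξ‖ := by rw [mul_add, mul_one]; linarith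
    have h3 : (ρ * (1 + ‖ξ‖)) ^ (d - t) ≤ (1 + ρ * ‖ξ‖) ^ d := by
      calc (ρ * (1 + ‖ξ‖)) ^ (d - t) ≤ (1 + ρ * ‖ξ‖) ^ (d - t) :=
            Real.rpow_le_rpow (by positivity) h2 (by linarith)
        _ ≤ (1 + ρ * ‖ξ‖) ^ (d : ℝ) :=
            Real.rpow_le_rpow_of_exponent_le (by linarith [mul_nonneg hρ.le (norm_nonneg ξ)])
              (by linarith)
        _ = _ := Real.rpow_natCast _ _
    rw [← Real.mul_rpow hρ.le (by positivity), Real.rpow_neg (by positivity), ← div_eq_mul_inv,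
      le_div_iff₀ (by positivity)]
    refine le_trans ?_ h1
    gcongr
  have hsm := hasSum_integral_mul (c := fun ξ : Fin d → ℤ => bumpCoeff ρ ξ * hat μ ξ)
    (F := fun ξ x => mFourier ξ x) (f := fun x => (smooth ρ μ x : ℂ)) ?_
    (fun ξ => (mFourier ξ).continuous.measurable) (fun ξ x => (norm_mFourier_apply ξ x).le)
    (hasSum_smooth hρ μ) μ (u := fun _ => 1) (integrable_const _)
  · simp only [mul_one] at hsm
    rw [integral_complex_ofReal] at hsm
    have h1 : ‖((∫ x, smooth ρ μ x ∂μ : ℝ) : ℂ)‖ ≤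
        ∑' ξ : Fin d → ℤ, (A * C ^ 2 * ρ ^ (-(d - t))) * (1 + ‖ξ‖) ^ (-(d - t) - s) := by
      rw [← hsm.tsum_eq]
      refine tsum_of_norm_bounded (hsum.mul_left _).hasSum fun ξ => ?_
      have h2 : ‖∫ x, mFourier ξ x ∂μ‖ ≤ C * (1 + ‖ξ‖) ^ (-(s / 2)) := by
        have := hμ' (-ξ)
        rwa [hat, neg_neg, norm_neg] at this
      have h3 : (1 + ‖ξ‖) ^ (-(d - t) - s) = (1 + ‖ξ‖) ^ (-(d - t)) * (1 + ‖ξ‖) ^ (-(s / 2))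
          * (1 + ‖ξ‖) ^ (-(s / 2)) := by
        rw [← Real.rpow_add (by positivity), ← Real.rpow_add (by positivity)]
        congr 1; ring
      rw [norm_mul, norm_mul, h3]
      calc _ ≤ A * (ρ ^ (-(d - t)) * (1 + ‖ξ‖) ^ (-(d - t))) * (C * (1 + ‖ξ‖) ^ (-(s / 2)))
            * (C * (1 + ‖ξ‖) ^ (-(s / 2))) := by
            gcongr
            · exact hb ξ
            · exact hμ' ξ
        _ = _ := by ring
    rw [Complex.norm_real, tsum_mul_left] at h1
    refine (le_abs_self _).trans (h1.trans (le_of_eq ?_))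
    ring
  · refine Summable.of_nonneg_of_le (fun _ => norm_nonneg _) (fun ξ => ?_)
      (summable_norm_bumpCoeff (d := d) hρ)
    rw [norm_mul]
    refine mul_le_of_le_one_right (norm_nonneg _) ((norm_hat_le μ ξ).trans ?_)
    rw [probReal_univ]

/-- A lower bound of the mollification by the measure of a ball. -/
lemma exists_measure_closedBall_le_smooth (d : ℕ) : ∃ c > 0, ∀ ρ > 0,
    ∀ (μ : Measure (Torus d)) [IsFiniteMeasure μ] (x : Torus d),
      c / ρ ^ d * μ.real (Metric.closedBall x (ρ / 2)) ≤ smooth ρ μ x := by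
  obtain ⟨c, hc, h⟩ := exists_le_torusBump d
  refine ⟨c, hc, fun ρ hρ μ _ x => ?_⟩
  have hbc := continuous_torusBump (d := d) hρ
  have h_int : Integrable (fun y => torusBump ρ (x - y)) μ :=
    Continuous.integrable_of_hasCompactSupport (by fun_prop) (HasCompactSupport.of_compactSpace _)
  calc c / ρ ^ d * μ.real (Metric.closedBall x (ρ / 2))
      = ∫ _y in Metric.closedBall x (ρ / 2), c / ρ ^ d ∂μ := by
        rw [setIntegral_const, smul_eq_mul, mul_comm]
    _ ≤ ∫ y in Metric.closedBall x (ρ / 2), torusBump ρ (x - y) ∂μ := by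
        refine setIntegral_mono_on (integrableOn_const (measure_ne_top _ _)) h_int.integrableOn
          Metric.isClosed_closedBall.measurableSet fun y hy => ?_
        refine h ρ hρ _ ?_
        rw [← dist_eq_norm, dist_comm]
        exact hy
    _ ≤ ∫ y, torusBump ρ (x - y) ∂μ :=
        setIntegral_le_integral h_int (ae_of_all _ fun y => torusBump_nonneg hρ _)

/-- Fourier decay of a measure forces the balls around most points to have small measure. -/
lemma exists_measure_closedBall_le {s t C : ℝ} (ht0 : 0 ≤ t) (ht : t < s) (hsd : s ≤ d)
    (μ : Measure (Torus d)) [IsProbabilityMeasure μ]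
    (hμ : ∀ ξ, (1 + ‖ξ‖) ^ (s / 2) * ‖hat μ ξ‖ ≤ C) :
    ∃ A : Set (Torus d), MeasurableSet A ∧ μ A ≠ 0 ∧ ∃ N : ℝ, 0 < N ∧ ∀ x ∈ A, ∀ j : ℕ,
      μ.real (Metric.closedBall x ((1 / 2) ^ j / 2)) ≤ N * ((1 / 2 : ℝ) ^ j) ^ t := by
  -- The energy bound at the midpoint of `s` and `t` leaves a geometric factor per dyadic scale, so
  -- the scales can be summed and one bound holds for all of them on a set of positive measure.
  obtain ⟨B, hB0, hB⟩ := exists_integral_smooth_le (t := (s + t) / 2) (by linarith) hsd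
    (by linarith) μ hμ
  obtain ⟨c, hc, hball⟩ := exists_measure_closedBall_le_smooth d
  set ρ : ℕ → ℝ := fun j => (1 / 2) ^ j with hρdef
  have hρ : ∀ j, 0 < ρ j := fun j => by positivity
  have hρ1 : ∀ j, ρ j ≤ 1 := fun j => pow_le_one₀ (by norm_num) (by norm_num)
  set G : ℕ → Torus d → ℝ≥0∞ := fun j x => ENNReal.ofReal (ρ j ^ (d - t) * smooth (ρ j) μ x) with hG
  have hGm : ∀ j, Measurable (G j) := fun j =>
    (((continuous_smooth (hρ j) μ).measurable).const_mul _).ennreal_ofReal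
  have hGint : ∀ j, ∫⁻ x, G j x ∂μ ≤ ENNReal.ofReal (B * ((1 / 2 : ℝ) ^ ((s - t) / 2)) ^ j) := by
    intro j
    rw [hG]
    rw [← ofReal_integral_eq_lintegral_ofReal]
    · refine ENNReal.ofReal_le_ofReal ?_
      rw [integral_const_mul]
      calc ρ j ^ (d - t) * ∫ x, smooth (ρ j) μ x ∂μ
          ≤ ρ j ^ (d - t) * (B * ρ j ^ (-(d - (s + t) / 2))) := by
            gcongr
            exact hB _ (hρ j) (hρ1 j)
        _ = B * (ρ j ^ (d - t) * ρ j ^ (-(d - (s + t) / 2))) := by ring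
        _ = B * ((1 / 2 : ℝ) ^ ((s - t) / 2)) ^ j := by
            rw [← Real.rpow_add (hρ j)]
            change B * ((1 / 2 : ℝ) ^ j) ^ _ = _
            rw [← Real.rpow_natCast, ← Real.rpow_natCast,
              ← Real.rpow_mul (by norm_num), ← Real.rpow_mul (by norm_num)]
            congr 2; ring
    · exact ((continuous_smooth (hρ j) μ).integrable_of_hasCompactSupport
        (HasCompactSupport.of_compactSpace _)).const_mul _
    · exact ae_of_all _ fun x => mul_nonneg (by positivity) (smooth_nonneg (hρ j) μ x)
  have hfin : ∫⁻ x, ∑' j, G j x ∂μ ≠ ∞ := by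
    rw [lintegral_tsum fun j => (hGm j).aemeasurable]
    refine ne_top_of_le_ne_top ?_ (ENNReal.tsum_le_tsum hGint)
    rw [← ENNReal.ofReal_tsum_of_nonneg (fun j => by positivity)]
    · exact ENNReal.ofReal_ne_top
    · refine (summable_geometric_of_lt_one (by positivity) ?_).mul_left _
      exact Real.rpow_lt_one (by norm_num) (by norm_num) (by linarith)
  have hGm' : Measurable fun x => ∑' j, G j x := Measurable.tsum hGm
  have hae := ae_lt_top hGm' hfin
  obtain ⟨k, hk⟩ : ∃ k : ℕ, μ {x | ∑' j, G j x ≤ k} ≠ 0 := by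
    by_contra! hcon
    have h0 : μ (⋃ k : ℕ, {x | ∑' j, G j x ≤ k}) = 0 := measure_iUnion_null hcon
    have h1 : ∀ᵐ x ∂μ, False := by
      filter_upwards [hae, measure_eq_zero_iff_ae_notMem.1 h0] with x hx hx'
      obtain ⟨k, hk⟩ := ENNReal.exists_nat_gt hx.ne
      exact hx' (Set.mem_iUnion.2 ⟨k, hk.le⟩)
    exact h1.exists.elim fun _ h => h
  refine ⟨_, measurableSet_le hGm' measurable_const, hk, (k + 1) / c, by positivity,
    fun x hx j => ?_⟩
  have h1 : ENNReal.ofReal (ρ j ^ (d - t) * smooth (ρ j) μ x) ≤ ENNReal.ofReal (k + 1) := by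
    refine ((ENNReal.le_tsum (f := fun j => G j x) j).trans hx).trans ?_
    rw [← ENNReal.ofReal_natCast]
    exact ENNReal.ofReal_le_ofReal (by linarith)
  rw [ENNReal.ofReal_le_ofReal_iff (by positivity)] at h1
  have h2 := hball (ρ j) (hρ j) μ x
  have h3 : ρ j ^ (d - t) * (c / ρ j ^ d * μ.real (Metric.closedBall x (ρ j / 2))) ≤ k + 1 :=
    (mul_le_mul_of_nonneg_left h2 (by positivity)).trans h1
  have h4 : ρ j ^ ((d : ℝ) - t) = ρ j ^ d / ρ j ^ t := by
    rw [Real.rpow_sub (hρ j), Real.rpow_natCast]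
  have h5 : 0 < ρ j ^ d := pow_pos (hρ j) d
  have h6 : 0 < ρ j ^ t := Real.rpow_pos_of_pos (hρ j) t
  rw [h4] at h3
  have h7 : ρ j ^ d / ρ j ^ t * (c / ρ j ^ d * μ.real (Metric.closedBall x (ρ j / 2)))
      = c * μ.real (Metric.closedBall x (ρ j / 2)) / ρ j ^ t := by
    field_simp
  rw [h7, div_le_iff₀ h6] at h3
  change μ.real (Metric.closedBall x (ρ j / 2)) ≤ (k + 1) / c * ρ j ^ t
  rw [div_mul_eq_mul_div, le_div_iff₀ hc]
  linarith

/-- The mass distribution principle for measures with Fourier decay. -/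
lemma le_dimH_of_decay {s : ℝ} (hs0 : 0 ≤ s) (hsd : s ≤ d) {E : Set (Torus d)}
    {μ : ProbabilityMeasure (Torus d)} (hE : (μ : Measure (Torus d)).support ⊆ E)
    (hμ : weightedSup s (fourierCoeffMeasure μ) < ∞) : ENNReal.ofReal s ≤ dimH E := by
  obtain ⟨C, hC0, hC⟩ := exists_of_weightedSup_lt_top hs0 hμ
  refine le_of_forall_lt fun t' ht' => ?_
  obtain ⟨t, ht1, ht2⟩ := ENNReal.lt_iff_exists_nnreal_btwn.1 ht'
  refine ht1.trans_le (le_dimH_of_hausdorffMeasure_ne_zero ?_)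
  have hts : (t : ℝ) < s := by
    rw [← ENNReal.ofReal_coe_nnreal] at ht2
    exact (ENNReal.ofReal_lt_ofReal_iff_of_nonneg t.2).1 ht2
  obtain ⟨A, hAm, hA0, N, hN, hA⟩ := exists_measure_closedBall_le (C := C) t.2 hts hsd
    (μ : Measure (Torus d)) hC
  set m : Measure (Torus d) := (μ : Measure (Torus d)) with hm
  -- A radius `r` is enclosed in the dyadic radius `(1 / 2) ^ j / 2`, where `(1 / 2) ^ j` is at most
  -- `4 * r`.
  set K : ℝ := N * 4 ^ (t : ℝ) with hK
  have hK0 : 0 < K := by positivity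
  have key : ∀ S : Set (Torus d), Metric.ediam S ≤ ENNReal.ofReal (1 / 2) →
      (m.restrict A) S ≤ ENNReal.ofReal K * Metric.ediam S ^ (t : ℝ) := by
    intro S hS
    rcases (S ∩ A).eq_empty_or_nonempty with hSA | ⟨x, hxS, hxA⟩
    · rw [Measure.restrict_apply' hAm, hSA, measure_empty]
      exact bot_le
    set D := (Metric.ediam S).toReal with hD
    have hStop : Metric.ediam S ≠ ∞ := ne_top_of_le_ne_top ENNReal.ofReal_ne_top hS
    have hDS : ENNReal.ofReal D = Metric.ediam S := ENNReal.ofReal_toReal hStop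
    have hD0 : 0 ≤ D := ENNReal.toReal_nonneg
    have hD1 : D ≤ 1 / 2 := ENNReal.toReal_le_of_le_ofReal (by norm_num) hS
    have hball : ∀ r, 0 < r → r ≤ 1 / 2 → m.real (Metric.closedBall x r) ≤ K * r ^ (t : ℝ) := by
      intro r hr hr1
      obtain ⟨j, hj1, hj2⟩ := exists_nat_pow_near_of_lt_one (x := 2 * r) (y := (1 / 2 : ℝ))
        (by linarith) (by linarith) (by norm_num) (by norm_num)
      calc m.real (Metric.closedBall x r) ≤ m.real (Metric.closedBall x ((1 / 2) ^ j / 2)) :=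
            measureReal_mono (Metric.closedBall_subset_closedBall (by linarith))
        _ ≤ N * ((1 / 2 : ℝ) ^ j) ^ (t : ℝ) := hA x hxA j
        _ ≤ N * (4 * r) ^ (t : ℝ) := by
            gcongr
            rw [pow_succ] at hj1
            linarith
        _ = K * r ^ (t : ℝ) := by rw [hK, Real.mul_rpow (by norm_num) hr.le]; ring
    have hsub : S ⊆ Metric.closedBall x D := fun y hy => by
      rw [Metric.mem_closedBall, dist_edist]
      exact ENNReal.toReal_mono hStop (Metric.edist_le_ediam_of_mem hy hxS)
    have hbound : m.real (Metric.closedBall x D) ≤ K * D ^ (t : ℝ) := by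
      -- Sets of diameter zero lie in balls of every positive radius, so their bound follows by
      -- letting the radius tend to zero.
      rcases hD0.eq_or_lt with h0 | h0
      · rw [← h0]
        have hlim : Tendsto (fun r : ℝ => K * r ^ (t : ℝ)) (𝓝[>] 0) (𝓝 (K * 0 ^ (t : ℝ))) :=
          ((Real.continuousAt_rpow_const 0 t (Or.inr t.2)).const_mul K).tendsto.mono_left
            nhdsWithin_le_nhds
        refine ge_of_tendsto hlim ?_
        filter_upwards [Ioc_mem_nhdsGT (show (0 : ℝ) < 1 / 2 by norm_num)] with r hr
        exact (measureReal_mono (Metric.closedBall_subset_closedBall hr.1.le)).trans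
          (hball r hr.1 hr.2)
      · exact hball D h0 hD1
    calc (m.restrict A) S ≤ m (Metric.closedBall x D) :=
          (Measure.restrict_apply_le A S).trans (measure_mono hsub)
      _ = ENNReal.ofReal (m.real (Metric.closedBall x D)) :=
          (ofReal_measureReal (measure_ne_top _ _)).symm
      _ ≤ ENNReal.ofReal (K * D ^ (t : ℝ)) := ENNReal.ofReal_le_ofReal hbound
      _ = ENNReal.ofReal K * Metric.ediam S ^ (t : ℝ) := by
          rw [ENNReal.ofReal_mul hK0.le, ← hDS, ENNReal.ofReal_rpow_of_nonneg hD0 t.coe_nonneg]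
  have hle : (ENNReal.ofReal K)⁻¹ • m.restrict A ≤ μH[t] := by
    refine Measure.le_hausdorffMeasure _ _ (ENNReal.ofReal (1 / 2)) (by simp) fun S hS => ?_
    rw [Measure.smul_apply, smul_eq_mul, mul_comm, ← div_eq_mul_inv]
    refine ENNReal.div_le_of_le_mul ?_
    rw [mul_comm]
    exact key S hS
  have h1 := hle E
  rw [Measure.smul_apply, smul_eq_mul] at h1
  have h2 : m.restrict A E ≠ 0 := by
    intro h
    rw [Measure.restrict_apply' hAm] at h
    refine hA0 (le_antisymm ?_ bot_le)
    calc m A ≤ m (E ∩ A ∪ m.supportᶜ) := measure_mono fun x hx => by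
          by_cases hxs : x ∈ m.support
          · exact Or.inl ⟨hE hxs, hx⟩
          · exact Or.inr hxs
      _ ≤ m (E ∩ A) + m m.supportᶜ := measure_union_le _ _
      _ = 0 := by rw [h, Measure.measure_compl_support, add_zero]
  intro h3
  rw [h3, nonpos_iff_eq_zero, mul_eq_zero] at h1
  rcases h1 with h1 | h1
  · exact ENNReal.inv_ne_zero.2 ENNReal.ofReal_ne_top h1
  · exact h2 h1

lemma fourierDim_le_dimH (E : Set (Torus d)) : fourierDim E ≤ dimH E :=
  iSup₂_le fun _ hμE => iSup₂_le fun _ hs => le_dimH_of_decay hs.1 hs.2.1 hμE hs.2.2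

/-! ### Mollified discrete measures -/

/-- The mollification of a measure at scale `ρ`, as a measure. -/
def mollify (ρ : ℝ) (κ : Measure (Torus d)) : Measure (Torus d) :=
  volume.withDensity fun x => ENNReal.ofReal (smooth ρ κ x)

lemma hat_mollify {ρ : ℝ} (hρ : 0 < ρ) (κ : Measure (Torus d)) [IsFiniteMeasure κ]
    (ξ : Fin d → ℤ) : hat (mollify ρ κ) ξ = bumpCoeff ρ ξ * hat κ ξ := by
  rw [mollify, hat_withDensity (continuous_smooth hρ κ).measurable (smooth_nonneg hρ κ),
    coeff_smooth hρ]

lemma isFiniteMeasure_mollify {ρ : ℝ} (hρ : 0 < ρ) (κ : Measure (Torus d)) [IsFiniteMeasure κ] :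
    IsFiniteMeasure (mollify ρ κ) :=
  isFiniteMeasure_withDensity_ofReal ((continuous_smooth hρ κ).integrable_of_hasCompactSupport
    (HasCompactSupport.of_compactSpace _)).2

lemma exists_pow_mul_norm_hat_mollify_le {ρ : ℝ} (hρ : 0 < ρ) (κ : Measure (Torus d))
    [IsFiniteMeasure κ] : ∃ C, ∀ ξ, (1 + ‖ξ‖) ^ d * ‖hat (mollify ρ κ) ξ‖ ≤ C := by
  obtain ⟨K, -, hK⟩ := exists_pow_mul_norm_bumpCoeff_le (d := d) hρ
  refine ⟨K * κ.real Set.univ, fun ξ => ?_⟩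
  rw [hat_mollify hρ, norm_mul, ← mul_assoc]
  exact mul_le_mul (hK ξ) (norm_hat_le κ ξ) (norm_nonneg _) (le_trans (by positivity) (hK ξ))

lemma support_mollify_subset {ρ : ℝ} (hρ : 0 < ρ) (κ : Measure (Torus d)) [IsFiniteMeasure κ]
    {K : Set (Torus d)} (hK : κ Kᶜ = 0) : (mollify ρ κ).support ⊆ Metric.cthickening ρ K := by
  refine Measure.support_subset_of_isClosed Metric.isClosed_cthickening ?_
  rw [mem_ae_iff, mollify, withDensity_apply _ Metric.isClosed_cthickening.measurableSet.compl]
  refine (setLIntegral_congr_fun Metric.isClosed_cthickening.measurableSet.compl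
    fun x hx => ?_).trans lintegral_zero
  by_contra h
  obtain ⟨y, hy, hxy⟩ := exists_dist_le_of_smooth_ne_zero hρ κ hK (x := x)
    fun h0 => h (by simp [h0])
  exact hx (Metric.mem_cthickening_of_dist_le x y ρ K hy hxy)

/-- The sum of the point masses `w` at the points of a list. -/
def pointMass (w : ℝ) (l : List (Torus d)) : Measure (Torus d) :=
  ENNReal.ofReal w • (l.map Measure.dirac).sum

instance isFiniteMeasure_pointMass (w : ℝ) (l : List (Torus d)) :
    IsFiniteMeasure (pointMass w l) := by
  have : IsFiniteMeasure (l.map (Measure.dirac (α := Torus d))).sum := by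
    induction l with
    | nil => simp only [List.map_nil, List.sum_nil]; infer_instance
    | cons a l ih => simp only [List.map_cons, List.sum_cons]; infer_instance
  exact Measure.smul_finite _ ENNReal.ofReal_ne_top

lemma hat_pointMass {w : ℝ} (hw : 0 ≤ w) (l : List (Torus d)) (ξ : Fin d → ℤ) :
    hat (pointMass w l) ξ = w * (l.map fun z => mFourier (-ξ) z).sum := by
  rw [pointMass, hat_smul, ENNReal.toReal_ofReal hw]
  congr 1
  suffices IsFiniteMeasure (l.map (Measure.dirac (α := Torus d))).sum ∧
      hat (l.map Measure.dirac).sum ξ = (l.map fun z => mFourier (-ξ) z).sum from this.2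
  induction l with
  | nil =>
    simp only [List.map_nil, List.sum_nil]
    exact ⟨inferInstance, hat_zero_measure ξ⟩
  | cons a l ih =>
    have := ih.1
    simp only [List.map_cons, List.sum_cons]
    exact ⟨inferInstance, by rw [hat_add, hat_dirac, ih.2]⟩

lemma pointMass_compl_eq_zero (w : ℝ) (l : List (Torus d)) {K : Set (Torus d)}
    (hK : ∀ z ∈ l, z ∈ K) (hKm : MeasurableSet K) : pointMass w l Kᶜ = 0 := by
  suffices (l.map Measure.dirac).sum Kᶜ = 0 by simp [pointMass, this]
  induction l with
  | nil => simp
  | cons a l ih =>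
    simp only [List.map_cons, List.sum_cons, Measure.add_apply]
    rw [ih fun z hz => hK z (List.mem_cons_of_mem _ hz), add_zero,
      Measure.dirac_apply' _ hKm.compl]
    simp [hK a List.mem_cons_self]

lemma integral_smooth {ρ : ℝ} (hρ : 0 < ρ) (κ : Measure (Torus d)) [IsFiniteMeasure κ] :
    ∫ x, smooth ρ κ x = κ.real Set.univ := by
  have h := coeff_smooth hρ κ 0
  rw [bumpCoeff_zero, hat_zero_freq, one_mul, coeff] at h
  simp only [neg_zero, mFourier_zero, ContinuousMap.one_apply, mul_one] at h
  rw [integral_complex_ofReal] at h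
  exact_mod_cast h

/-! ### Generic sets are Salem -/

/-- `E` is covered by fewer than `r ^ (-lam)` balls of some radius `r < e`. -/
def FewBalls (lam e : ℝ) (E : Set (Torus d)) : Prop :=
  ∃ (F : Finset (Torus d)) (r : ℝ), 0 < r ∧ r < e ∧ (F.card : ℝ) * r ^ lam < 1 ∧
    E ⊆ ⋃ x ∈ F, Metric.ball x r

/-- About `r ^ (-β)` sampled points mollified at scale `r / 2` have support in that many balls of
radius `r`, which is fewer than `r ^ (-lam)`. Nothing is removed here. -/
lemma smoothApprox_fewBalls {β lam e : ℝ} (hβd : β ≤ d) (hlam : β < lam) (he : 0 < e) :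
    SmoothApprox d β (FewBalls lam e) := by
  refine ⟨1, one_pos, fun δ hδ _ κ hκ s hs hsβ ε hε => ?_⟩
  obtain ⟨Cf, hCf⟩ := absRep_smooth hδ κ (d + 1)
  have hmain := eventually_exists_discretization (smooth_nonneg hδ κ) hCf hCf (integral_smooth hδ κ)
    (q := 1) (p := 1) one_ne_zero one_ne_zero hs (hsβ.le.trans hβd) hsβ (η := 1) one_pos
    (θ := 1 / 2) (by norm_num) hε
  obtain ⟨r, hr, hr0, hr1⟩ := (hmain.and (Ioo_mem_nhdsGT (lt_min one_pos (lt_min he hδ)))).exists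
  obtain ⟨hr1, hr2⟩ := lt_min_iff.1 hr1
  obtain ⟨hre, hrδ⟩ := lt_min_iff.1 hr2
  obtain ⟨l, hlen, hlf, hl, -⟩ := hr ∅ MeasurableSet.empty (by simp; positivity)
  simp only [one_smul] at hlf hl
  have hρ : 0 < 1 / 2 * r := by positivity
  set w := κ.real Set.univ / l.length with hw
  set ν := mollify (1 / 2 * r) (pointMass w l) with hν
  have hsupp : ν.support ⊆ Metric.cthickening (1 / 2 * r) {z | z ∈ l} :=
    support_mollify_subset hρ _ (pointMass_compl_eq_zero w l (fun z hz => hz)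
      (List.finite_toSet l).measurableSet)
  have hsupp' : ∀ x ∈ ν.support, ∃ z ∈ l, dist x z ≤ 1 / 2 * r := fun x hx => by
    have := hsupp hx
    rw [(List.finite_toSet l).isCompact.cthickening_eq_biUnion_closedBall hρ.le] at this
    obtain ⟨z, hz, hxz⟩ := Set.mem_iUnion₂.1 this
    exact ⟨z, hz, hxz⟩
  refine ⟨ν, isFiniteMeasure_mollify hρ _, exists_pow_mul_norm_hat_mollify_le hρ _, ?_, ?_, ?_⟩
  · intro x hx
    obtain ⟨z, hz, hxz⟩ := hsupp' x hx
    obtain ⟨y, hy, hzy⟩ := exists_dist_le_of_smooth_ne_zero hδ κ Measure.measure_compl_support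
      (hlf z hz)
    exact Metric.mem_cthickening_of_dist_le x y _ _ hy (by linarith [dist_triangle x z y])
  · intro ξ
    rw [hν, hat_mollify hρ, hat_pointMass (by positivity), ← coeff_smooth hδ]
    have := hl ξ
    rw [hw]
    push_cast
    exact this
  · classical
    refine ⟨l.toFinset, r, hr0, hre, ?_, fun x hx => ?_⟩
    · calc (l.toFinset.card : ℝ) * r ^ lam ≤ r ^ (-β) * r ^ lam := by
            gcongr
            exact le_trans (by exact_mod_cast l.toFinset_card_le) hlen
        _ = r ^ (lam - β) := by rw [← Real.rpow_add hr0]; congr 1; ring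
        _ < 1 := Real.rpow_lt_one hr0.le hr1 (by linarith)
    · obtain ⟨z, hz, hxz⟩ := hsupp' x hx
      exact Set.mem_iUnion₂.2 ⟨z, by simpa using hz, Metric.mem_ball.2 (by linarith)⟩

lemma isOpen_setOf_fewBalls {β lam e : ℝ} :
    IsOpen {p : XSpace d β | FewBalls lam e (p.set : Set (Torus d))} := by
  have : {p : XSpace d β | FewBalls lam e (p.set : Set (Torus d))}
      = ⋃ (F : Finset (Torus d)) (r : ℝ) (_ : 0 < r ∧ r < e ∧ (F.card : ℝ) * r ^ lam < 1),
        XSpace.set ⁻¹' {K | (K : Set (Torus d)) ⊆ ⋃ x ∈ F, Metric.ball x r} := by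
    ext p
    simp only [FewBalls, Set.mem_ofPred_eq, Set.mem_iUnion, Set.mem_preimage, exists_prop, and_assoc]
  rw [this]
  refine isOpen_iUnion fun F => isOpen_iUnion fun r => isOpen_iUnion fun _ => ?_
  refine IsOpen.preimage XSpace.continuous_set ?_
  exact Compacts.isOpen_subsets_of_isOpen (isOpen_biUnion fun x _ => Metric.isOpen_ball)

lemma ediam_ball_le_ofReal (x : Torus d) (r : ℝ) :
    Metric.ediam (Metric.ball x r) ≤ ENNReal.ofReal (2 * r) := by
  rw [← Metric.eball_ofReal, ENNReal.ofReal_mul (by norm_num), ENNReal.ofReal_ofNat]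
  exact Metric.ediam_eball_le

/-- The covers at scales tending to zero bound the Hausdorff measure of order `lam` by `2 ^ lam`,
hence by a finite number. -/
lemma dimH_le_of_fewBalls {lam : ℝ≥0} {E : Set (Torus d)}
    (h : ∀ k : ℕ, FewBalls lam (1 / ((k : ℝ) + 1)) E) : dimH E ≤ lam := by
  choose F r hr0 hr hcard hsub using h
  refine dimH_le_of_hausdorffMeasure_ne_top (ne_top_of_le_ne_top ?_
    (Measure.hausdorffMeasure_le_liminf_sum (ι := fun k => F k) (l := atTop) lam E
      (fun k : ℕ => ENNReal.ofReal (2 * (1 / ((k : ℝ) + 1)))) ?_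
      (fun k x => Metric.ball (x : Torus d) (r k)) ?_ ?_))
  · refine ne_top_of_le_ne_top (b := ENNReal.ofReal (2 ^ (lam : ℝ))) ENNReal.ofReal_ne_top ?_
    refine liminf_le_of_frequently_le' (Eventually.frequently (Eventually.of_forall fun k => ?_))
    calc ∑ x : F k, Metric.ediam (Metric.ball (x : Torus d) (r k)) ^ (lam : ℝ)
        ≤ ∑ _x : F k, ENNReal.ofReal ((2 * r k) ^ (lam : ℝ)) := by
          refine Finset.sum_le_sum fun x _ => ?_
          rw [← ENNReal.ofReal_rpow_of_nonneg (by linarith [hr0 k]) lam.coe_nonneg]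
          exact ENNReal.rpow_le_rpow (ediam_ball_le_ofReal _ _) lam.coe_nonneg
      _ = ENNReal.ofReal (2 ^ (lam : ℝ) * ((F k).card * r k ^ (lam : ℝ))) := by
          rw [Finset.sum_const, Finset.card_univ, Fintype.card_coe, nsmul_eq_mul,
            ← ENNReal.ofReal_natCast, ← ENNReal.ofReal_mul (by positivity),
            Real.mul_rpow (by norm_num) (hr0 k).le]
          congr 1; ring
      _ ≤ ENNReal.ofReal (2 ^ (lam : ℝ)) := by
          refine ENNReal.ofReal_le_ofReal (mul_le_of_le_one_right (by positivity) (hcard k).le)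
  · have := (ENNReal.continuous_ofReal.tendsto 0).comp
      (by simpa using (tendsto_one_div_add_atTop_nhds_zero_nat (𝕜 := ℝ)).const_mul 2 :
        Tendsto (fun k : ℕ => 2 * (1 / ((k : ℝ) + 1))) atTop (𝓝 0))
    rwa [ENNReal.ofReal_zero] at this
  · refine Eventually.of_forall fun k x => ?_
    refine (ediam_ball_le_ofReal _ _).trans (ENNReal.ofReal_le_ofReal ?_)
    linarith [hr k]
  · refine Eventually.of_forall fun k => (hsub k).trans ?_
    intro x hx
    obtain ⟨z, hz, hxz⟩ := Set.mem_iUnion₂.1 hx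
    exact Set.mem_iUnion.2 ⟨⟨z, hz⟩, hxz⟩

lemma eventually_residual_dimH_le {β : ℝ} (hβ : 0 < β) (hβd : β ≤ d) :
    ∀ᶠ p in residual (XSpace d β), dimH (p.set : Set (Torus d)) ≤ ENNReal.ofReal β := by
  have h1 : ∀ᶠ p in residual (XSpace d β), ∀ j k : ℕ,
      FewBalls (β + 1 / ((j : ℝ) + 1)) (1 / ((k : ℝ) + 1)) (p.set : Set (Torus d)) := by
    rw [eventually_countable_forall]
    intro j
    rw [eventually_countable_forall]
    intro k
    exact residual_of_dense_open isOpen_setOf_fewBalls (dense_of_smoothApprox hβ hβd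
      (smoothApprox_fewBalls hβd (by linarith [show (0 : ℝ) < 1 / ((j : ℝ) + 1) by positivity])
        (by positivity)))
  filter_upwards [h1] with p hp
  have hlim : Tendsto (fun j : ℕ => ENNReal.ofReal (β + 1 / ((j : ℝ) + 1))) atTop
      (𝓝 (ENNReal.ofReal β)) := by
    have := (ENNReal.continuous_ofReal.tendsto (β + 0)).comp
      ((tendsto_one_div_add_atTop_nhds_zero_nat (𝕜 := ℝ)).const_add β)
    rwa [add_zero] at this
  refine ge_of_tendsto' hlim fun j => ?_
  have h2 : (0 : ℝ) ≤ β + 1 / ((j : ℝ) + 1) := by positivity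
  exact dimH_le_of_fewBalls (lam := (β + 1 / ((j : ℝ) + 1)).toNNReal) fun k => by
    rw [Real.coe_toNNReal _ h2]; exact hp j k

lemma XSpace.le_fourierDim {β : ℝ} (hβd : β ≤ d) (p : XSpace d β) :
    ENNReal.ofReal β ≤ fourierDim (p.set : Set (Torus d)) := by
  refine le_trans ?_ (le_iSup₂ (f := fun (μ : ProbabilityMeasure (Torus d))
    (_ : (μ : Measure (Torus d)).support ⊆ p.set) => fourierDimMeasure μ)
    p.measure p.support_subset)
  refine le_of_forall_lt fun t ht => ?_
  obtain ⟨u, hu1, hu2⟩ := ENNReal.lt_iff_exists_nnreal_btwn.1 ht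
  have huβ : (u : ℝ) < β := by
    rw [← ENNReal.ofReal_coe_nnreal] at hu2
    exact (ENNReal.ofReal_lt_ofReal_iff_of_nonneg u.2).1 hu2
  refine hu1.trans_le ?_
  rw [← ENNReal.ofReal_coe_nnreal]
  exact le_iSup₂ (f := fun (s : ℝ) (_ : 0 ≤ s ∧ s ≤ d ∧
    weightedSup s (fourierCoeffMeasure p.measure) < ∞) => ENNReal.ofReal s) (u : ℝ)
    ⟨u.2, huβ.le.trans hβd, p.decay u u.2 huβ⟩

/-- Generic sets in `𝒳_β` are Salem sets of dimension `β`. -/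
lemma eventually_residual_isSalem {β : ℝ} (hβ : 0 < β) (hβd : β ≤ d) :
    ∀ᶠ p in residual (XSpace d β), IsSalem (p.set : Set (Torus d)) ∧
      fourierDim (p.set : Set (Torus d)) = ENNReal.ofReal β := by
  filter_upwards [eventually_residual_dimH_le hβ hβd] with p hp
  have h1 := p.le_fourierDim hβd
  have h2 := fourierDim_le_dimH (p.set : Set (Torus d))
  exact ⟨le_antisymm h2 (hp.trans h1), le_antisymm (h2.trans hp) h1⟩

/-! ### Division on the torus and uniform Lipschitz bounds -/

lemma exists_coe_eq_abs_eq_norm (x : UnitAddCircle) : ∃ t : ℝ, (t : UnitAddCircle) = x ∧ |t| = ‖x‖ := by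
  obtain ⟨t, rfl⟩ := QuotientAddGroup.mk_surjective x
  refine ⟨t - round t, ?_, (UnitAddCircle.norm_eq (x := t)).symm⟩
  rw [AddCircle.coe_sub, sub_eq_self, AddCircle.coe_eq_zero_iff]
  exact ⟨round t, by simp⟩

lemma norm_coe_le_abs (t : ℝ) : ‖(t : UnitAddCircle)‖ ≤ |t| := by
  rw [UnitAddCircle.norm_eq]
  simpa using round_le t 0

/-- Multiplication by a nonzero integer has small right inverses. -/
lemma exists_zsmul_eq_norm_le {q : ℤ} (hq : q ≠ 0) (e : Torus d) :
    ∃ e' : Torus d, q • e' = e ∧ ‖e'‖ ≤ ‖e‖ := by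
  choose t ht htn using fun i => exists_coe_eq_abs_eq_norm (e i)
  have hq' : (q : ℝ) ≠ 0 := by exact_mod_cast hq
  refine ⟨fun i => ((t i / q : ℝ) : UnitAddCircle), ?_, ?_⟩
  · funext i
    rw [Pi.smul_apply, ← ht i, ← AddCircle.coe_zsmul, zsmul_eq_mul, mul_div_cancel₀ _ hq']
  · rw [pi_norm_le_iff_of_nonneg (norm_nonneg _)]
    intro i
    refine (norm_coe_le_abs _).trans (le_trans ?_ (norm_le_pi_norm e i))
    rw [← htn i, abs_div]
    refine div_le_self (abs_nonneg _) ?_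
    exact_mod_cast Int.one_le_abs hq

lemma finite_zsmul_torsion {q : ℤ} (hq : q ≠ 0) : {τ : Torus d | q • τ = 0}.Finite := by
  have h : {u : UnitAddCircle | q • u = 0}.Finite := by
    refine (AddCircle.finite_torsion (1 : ℝ) (Int.natAbs_pos.2 hq)).subset fun u hu => ?_
    exact natAbs_nsmul_eq_zero.2 hu
  refine (Set.Finite.pi fun _ : Fin d => h).subset fun τ hτ i _ => ?_
  exact congrFun hτ i

/-- Dividing a representative by the denominator removes rational multiples: every value of `a x` is
`p z` for some `z` with `q z = x`. -/
lemma exists_of_mem_ratMul {a : ℚ} {x y : Torus d} (h : y ∈ ratMul a x) :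
    ∃ z : Torus d, (a.den : ℤ) • z = x ∧ a.num • z = y := by
  obtain ⟨t, ht, hy⟩ := h
  have hq : (a.den : ℝ) ≠ 0 := by exact_mod_cast a.den_nz
  refine ⟨fun i => ((t i / a.den : ℝ) : UnitAddCircle), ?_, ?_⟩
  · funext i
    rw [Pi.smul_apply, ← ht i, ← AddCircle.coe_zsmul, zsmul_eq_mul, Int.cast_natCast,
      mul_div_cancel₀ _ hq]
  · funext i
    rw [Pi.smul_apply, hy i, ← AddCircle.coe_zsmul, zsmul_eq_mul, Rat.cast_def]
    congr 1
    ring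

lemma euclDist_le (x y : Torus d) : euclDist x y ≤ (d + 1) * dist x y := by
  refine Real.sqrt_le_iff.2 ⟨by positivity, ?_⟩
  calc ∑ i, ‖x i - y i‖ ^ 2 ≤ ∑ _i : Fin d, dist x y ^ 2 := by
        refine Finset.sum_le_sum fun i _ => ?_
        gcongr
        rw [← dist_eq_norm]
        exact dist_le_pi_dist x y i
    _ = d * dist x y ^ 2 := by simp
    _ ≤ ((d + 1) * dist x y) ^ 2 := by
        rw [mul_pow]
        gcongr
        have : (0 : ℝ) ≤ d := by positivity
        nlinarith

lemma isOpen_thickening (r : ℝ) (E : Set (Torus d)) : IsOpen (thickening r E) := by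
  have : thickening r E = ⋃ x ∈ E, {y | euclDist x y < r} := by
    ext y; simp [thickening]
  rw [this]
  refine isOpen_biUnion fun x _ => isOpen_lt ?_ continuous_const
  unfold euclDist
  fun_prop

/-- A locally Lipschitz map is uniformly Lipschitz at small distances from a compact set. -/
lemma exists_uniform_lipschitz {X Y : Type*} [PseudoMetricSpace X] [PseudoEMetricSpace Y]
    {T : X → Y} {V W : Set X} (hV : IsOpen V) (hT : LocallyLipschitzOn V T) (hW : IsCompact W)
    (hWV : W ⊆ V) : ∃ (L : ℝ≥0) (c : ℝ), 0 < c ∧ ∀ x ∈ W, ∀ y, dist x y < c →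
      edist (T x) (T y) ≤ L * edist x y := by
  refine hW.induction_on (p := fun W => ∃ (L : ℝ≥0) (c : ℝ), 0 < c ∧ ∀ x ∈ W, ∀ y, dist x y < c →
      edist (T x) (T y) ≤ L * edist x y) ⟨0, 1, one_pos, by simp⟩ ?_ ?_ ?_
  · rintro s t hst ⟨L, c, hc, h⟩
    exact ⟨L, c, hc, fun x hx => h x (hst hx)⟩
  · rintro s t ⟨L, c, hc, h⟩ ⟨L', c', hc', h'⟩
    refine ⟨max L L', min c c', lt_min hc hc', fun x hx y hxy => ?_⟩
    rcases hx with hx | hx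
    · refine (h x hx y (hxy.trans_le (min_le_left _ _))).trans ?_
      gcongr
      exact le_max_left _ _
    · refine (h' x hx y (hxy.trans_le (min_le_right _ _))).trans ?_
      gcongr
      exact le_max_right _ _
  · intro x hx
    obtain ⟨K, t, ht, hK⟩ := hT (hWV hx)
    rw [hV.nhdsWithin_eq (hWV hx)] at ht
    obtain ⟨c, hc, hct⟩ := Metric.mem_nhds_iff.1 ht
    refine ⟨Metric.ball x (c / 2), mem_nhdsWithin_of_mem_nhds (Metric.ball_mem_nhds x (by positivity)),
      K, c / 2, by positivity, fun y hy z hyz => ?_⟩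
    refine hK (hct (Metric.ball_subset_ball (by linarith) hy)) (hct ?_)
    rw [Metric.mem_ball] at hy ⊢
    rw [dist_comm] at hyz
    linarith [dist_triangle z y x]

lemma continuous_infEDist_compacts :
    Continuous fun p : Torus d × Compacts (Torus d) => Metric.infEDist p.1 (p.2 : Set (Torus d)) := by
  refine continuous_of_le_add_edist 2 (by simp) ?_
  rintro ⟨x, s⟩ ⟨y, t⟩
  calc
    Metric.infEDist x s ≤ Metric.infEDist x t + Metric.hausdorffEDist (t : Set (Torus d)) s :=
      Metric.infEDist_le_infEDist_add_hausdorffEDist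
    _ ≤ Metric.infEDist y t + edist x y + Metric.hausdorffEDist (t : Set (Torus d)) s := by
      gcongr; apply Metric.infEDist_le_infEDist_add_edist
    _ = Metric.infEDist y t + (edist x y + edist s t) := by
      rw [add_assoc, Metric.hausdorffEDist_comm, Compacts.edist_eq]
    _ ≤ Metric.infEDist y t + (edist (x, s) (y, t) + edist (x, s) (y, t)) := by
      gcongr <;> apply_rules [le_max_left, le_max_right]
    _ = Metric.infEDist y t + 2 * edist (x, s) (y, t) := by rw [← mul_two, mul_comm]

/-! ### Local avoidance as an open condition -/

/-- `E` avoids the pattern for the tuples in `W` whose first points stay away from `b`, `b'`, and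
whose last two points are close to `b` and `b'`. -/
def LocalAvoid {N : ℕ} (q p : ℤ) (T : (Fin N → Torus d) → Compacts (Torus d))
    (W : Set (Fin N → Torus d)) (b b' : Torus d) (ε : ℝ) (E : Set (Torus d)) : Prop :=
  ∀ X ∈ W, (∀ i, X i ∈ E) → (∀ i, ε ≤ dist (X i) b ∧ ε ≤ dist (X i) b') →
    ∀ z v, q • z ∈ E → dist (q • z) b ≤ ε / 4 → v ∈ E → dist v b' ≤ ε / 4 → v - p • z ∉ T X

-- The violating configurations form a compact set because all constraints are closed and `T` is
-- continuous on `W`. Avoidance says that the product of copies of `E` misses its image under `z ↦ q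
-- z`, and this persists for sets in a small neighbourhood of `E`.
set_option maxHeartbeats 2000000 in
lemma isOpen_setOf_localAvoid {N : ℕ} (q p : ℤ) {T : (Fin N → Torus d) → Compacts (Torus d)}
    {W : Set (Fin N → Torus d)} (hW : IsClosed W) (hT : ContinuousOn T W) (b b' : Torus d) (ε : ℝ)
    {β : ℝ} : IsOpen {P : XSpace d β | LocalAvoid q p T W b b' ε (P.set : Set (Torus d))} := by
  set D : Set ((Fin N → Torus d) × Torus d × Torus d) := {σ | σ.1 ∈ W ∧
    (∀ i, ε ≤ dist (σ.1 i) b ∧ ε ≤ dist (σ.1 i) b') ∧ dist (q • σ.2.1) b ≤ ε / 4 ∧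
      dist σ.2.2 b' ≤ ε / 4} with hD
  have hDc : IsClosed D := by
    have h1 : ∀ (i : Fin N) (c : Torus d), IsClosed
        {σ : (Fin N → Torus d) × Torus d × Torus d | ε ≤ dist (σ.1 i) c} := fun i c =>
      isClosed_le continuous_const (by fun_prop)
    have h2 : IsClosed {σ : (Fin N → Torus d) × Torus d × Torus d | dist (q • σ.2.1) b ≤ ε / 4} :=
      isClosed_le (by fun_prop) continuous_const
    have h3 : IsClosed {σ : (Fin N → Torus d) × Torus d × Torus d | dist σ.2.2 b' ≤ ε / 4} :=
      isClosed_le (by fun_prop) continuous_const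
    have h4 : IsClosed {σ : (Fin N → Torus d) × Torus d × Torus d |
        ∀ i, ε ≤ dist (σ.1 i) b ∧ ε ≤ dist (σ.1 i) b'} := by
      simp only [Set.ofPred_forall]
      exact isClosed_iInter fun i => (h1 i b).inter (h1 i b')
    exact (hW.preimage continuous_fst).inter (h4.inter (h2.inter h3))
  set S := D ∩ (fun σ => Metric.infEDist (σ.2.2 - p • σ.2.1) (T σ.1 : Set (Torus d))) ⁻¹' {0} with hS
  have hSc : IsClosed S := by
    refine ContinuousOn.preimage_isClosed_of_isClosed ?_ hDc isClosed_singleton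
    have h1 : ContinuousOn (fun σ : (Fin N → Torus d) × Torus d × Torus d =>
        (σ.2.2 - p • σ.2.1, T σ.1)) D :=
      ContinuousOn.prodMk (by fun_prop) (hT.comp continuousOn_fst fun σ hσ => hσ.1)
    exact continuous_infEDist_compacts.comp_continuousOn h1
  have hmem : ∀ σ : (Fin N → Torus d) × Torus d × Torus d, σ ∈ S ↔
      σ ∈ D ∧ σ.2.2 - p • σ.2.1 ∈ T σ.1 := fun σ => by
    rw [hS, Set.mem_inter_iff, Set.mem_preimage, Set.mem_singleton_iff,
      ← Metric.mem_iff_infEDist_zero_of_closed (T σ.1).isCompact.isClosed, SetLike.mem_coe]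
  set φ : (Fin N → Torus d) × Torus d × Torus d → (Fin N → Torus d) × Torus d × Torus d :=
    fun σ => (σ.1, q • σ.2.1, σ.2.2) with hφ
  have hφS : IsClosed (φ '' S) := (hSc.isCompact.image (by fun_prop)).isClosed
  have hiff : ∀ E : Set (Torus d), LocalAvoid q p T W b b' ε E ↔
      (Set.univ.pi fun _ => E) ×ˢ E ×ˢ E ⊆ (φ '' S)ᶜ := by
    intro E
    constructor
    · rintro h - hσE ⟨σ, hσ, rfl⟩
      obtain ⟨⟨h1, h2, h3, h4⟩, h5⟩ := (hmem σ).1 hσ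
      exact h σ.1 h1 (fun i => hσE.1 i trivial) h2 σ.2.1 σ.2.2 hσE.2.1 h3 hσE.2.2 h4 h5
    · intro h X hX hXE hd z v hz hzb hv hvb hmemT
      refine h (a := (X, q • z, v)) ⟨fun i _ => hXE i, hz, hv⟩ ⟨(X, z, v), ?_, rfl⟩
      exact (hmem _).2 ⟨⟨hX, hd, hzb, hvb⟩, hmemT⟩
  rw [isOpen_iff_mem_nhds]
  intro P hP
  have hK : IsCompact ((Set.univ.pi fun _ : Fin N => (P.set : Set (Torus d))) ×ˢ
      (P.set : Set (Torus d)) ×ˢ (P.set : Set (Torus d))) :=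
    (isCompact_univ_pi fun _ => P.set.isCompact).prod (P.set.isCompact.prod P.set.isCompact)
  obtain ⟨c, hc, hsub⟩ := hK.exists_thickening_subset_open hφS.isOpen_compl ((hiff _).1 hP)
  have hopen : IsOpen (XSpace.set (d := d) (β := β) ⁻¹'
      {K | (K : Set (Torus d)) ⊆ Metric.thickening c (P.set : Set (Torus d))}) :=
    (Compacts.isOpen_subsets_of_isOpen Metric.isOpen_thickening).preimage XSpace.continuous_set
  filter_upwards [hopen.mem_nhds (Metric.self_subset_thickening hc _)] with P' hP'
  refine (hiff _).2 (subset_trans ?_ hsub)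
  rintro ⟨X, u, v⟩ ⟨hX, hu, hv⟩
  choose Y hY hXY using fun i => Metric.mem_thickening_iff.1 (hP' (hX i trivial))
  obtain ⟨u', hu', huu⟩ := Metric.mem_thickening_iff.1 (hP' hu)
  obtain ⟨v', hv', hvv⟩ := Metric.mem_thickening_iff.1 (hP' hv)
  refine Metric.mem_thickening_iff.2 ⟨(Y, u', v'), ⟨fun i _ => hY i, hu', hv'⟩, ?_⟩
  rw [Prod.dist_eq, Prod.dist_eq]
  exact max_lt ((dist_pi_lt_iff hc).2 hXY) (max_lt huu hvv)

/-! ### The forbidden set and the density of local avoidance -/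

/-- The translates, by the multiples `p τ` of the points with `q τ = 0`, of the neighbourhoods of
the sets `T(X)`, where `X` runs over the tuples in `W` with entries in the list `l`. -/
def badSet {N : ℕ} (q p : ℤ) (T : (Fin N → Torus d) → Compacts (Torus d))
    (W : Set (Fin N → Torus d)) (r : ℝ) (l : List (Torus d)) : Set (Torus d) :=
  ⋃ (σ : Fin N → Fin l.length) (τ : Torus d) (_ : q • τ = 0 ∧ (fun i => l.get (σ i)) ∈ W),
    (fun w => w - p • τ) ⁻¹' thickening r (T fun i => l.get (σ i) : Set (Torus d))

lemma measurableSet_badSet {N : ℕ} (q p : ℤ) (T : (Fin N → Torus d) → Compacts (Torus d))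
    (W : Set (Fin N → Torus d)) (r : ℝ) (l : List (Torus d)) :
    MeasurableSet (badSet q p T W r l) := by
  refine (isOpen_iUnion fun σ => isOpen_iUnion fun τ => isOpen_iUnion fun _ => ?_).measurableSet
  exact (isOpen_thickening _ _).preimage (by fun_prop)

/-- Union bound over the tuples from the list and the finitely many `q`-torsion points; translation
preserves volume. -/
lemma volume_badSet_le {N : ℕ} {q : ℤ} (hq : q ≠ 0) (p : ℤ)
    {T : (Fin N → Torus d) → Compacts (Torus d)} {W : Set (Fin N → Torus d)} {r B : ℝ} (hB : 0 ≤ B)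
    (h : ∀ X ∈ W, volume (thickening r (T X : Set (Torus d))) ≤ ENNReal.ofReal B)
    (l : List (Torus d)) :
    volume.real (badSet q p T W r l)
      ≤ (finite_zsmul_torsion (d := d) hq).toFinset.card * ((l.length : ℝ) ^ N * B) := by
  classical
  set F := (finite_zsmul_torsion (d := d) hq).toFinset with hF
  set S : (Fin N → Fin l.length) → Torus d → Set (Torus d) := fun σ τ =>
    if (fun i => l.get (σ i)) ∈ W then
      (fun w => w - p • τ) ⁻¹' thickening r (T fun i => l.get (σ i) : Set (Torus d)) else ∅ with hS
  have hsub : badSet q p T W r l ⊆ ⋃ στ ∈ (Finset.univ : Finset (Fin N → Fin l.length)) ×ˢ F,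
      S στ.1 στ.2 := by
    intro w hw
    simp only [badSet, Set.mem_iUnion] at hw
    obtain ⟨σ, τ, ⟨hτ, hσ⟩, hw⟩ := hw
    refine Set.mem_iUnion₂.2 ⟨(σ, τ), by simpa [hF] using hτ, ?_⟩
    simp only [hS, if_pos hσ]
    exact hw
  have hle : volume (badSet q p T W r l) ≤ ENNReal.ofReal (F.card * ((l.length : ℝ) ^ N * B)) := by
    refine (measure_mono hsub).trans ((measure_biUnion_finset_le _ _).trans ?_)
    calc ∑ στ ∈ (Finset.univ : Finset (Fin N → Fin l.length)) ×ˢ F, volume (S στ.1 στ.2)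
        ≤ ∑ _στ ∈ (Finset.univ : Finset (Fin N → Fin l.length)) ×ˢ F, ENNReal.ofReal B := by
          refine Finset.sum_le_sum fun στ _ => ?_
          by_cases hσ : (fun i => l.get (στ.1 i)) ∈ W
          · simp only [hS, if_pos hσ]
            rw [(measurePreserving_sub_right volume (p • στ.2)).measure_preimage
              (isOpen_thickening _ _).measurableSet.nullMeasurableSet]
            exact h _ hσ
          · simp only [hS, if_neg hσ, measure_empty]
            exact bot_le
      _ = ENNReal.ofReal (F.card * ((l.length : ℝ) ^ N * B)) := by
          rw [Finset.sum_const, Finset.card_product, nsmul_eq_mul, ← ENNReal.ofReal_natCast,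
            ← ENNReal.ofReal_mul (by positivity)]
          congr 1
          simp only [Finset.card_univ, Fintype.card_fun, Fintype.card_fin]
          push_cast
          ring
  exact ENNReal.toReal_le_of_le_ofReal (by positivity) hle

lemma exists_mem_of_smooth_restrict_ne_zero {δ : ℝ} (hδ : 0 < δ) (κ : Measure (Torus d))
    [IsFiniteMeasure κ] {S : Set (Torus d)} (hS : MeasurableSet S) {x : Torus d}
    (h : smooth δ (κ.restrict S) x ≠ 0) : ∃ y ∈ S, y ∈ κ.support ∧ dist x y ≤ δ := by
  have h0 : κ.restrict S (S ∩ κ.support)ᶜ = 0 := by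
    rw [Measure.restrict_apply' hS]
    refine measure_mono_null (fun y hy hy' => hy.1 ⟨hy.2, hy'⟩)
      (Measure.measure_compl_support (μ := κ))
  obtain ⟨y, hy, hxy⟩ := exists_dist_le_of_smooth_ne_zero hδ _ h0 h
  exact ⟨y, hy.1, hy.2, hxy⟩

/-- The algebraic core: if the configuration `(X, q z, v)` is close to `(Y, q z', y)` and violates
the avoidance condition, then `y - p z'` lies in the set of forbidden points. -/
lemma sub_zsmul_mem_badSet {N : ℕ} {q : ℤ} (hq : q ≠ 0) (p : ℤ)
    {T : (Fin N → Torus d) → Compacts (Torus d)} {W : Set (Fin N → Torus d)} {r ρ : ℝ} {L : ℝ≥0}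
    (hρ : 0 < ρ) (hr : (d + 1) * (ρ * (L + 2 + |p|)) ≤ r) {l : List (Torus d)}
    {X Y : Fin N → Torus d} (hYl : ∀ i, Y i ∈ l) (hYW : Y ∈ W) (hXY : dist X Y < ρ)
    (hT : edist (T X) (T Y) ≤ L * edist X Y) {z z' v y : Torus d}
    (hz : dist (q • z) (q • z') < ρ) (hv : dist v y < ρ) (hmem : v - p • z ∈ T X) :
    y - p • z' ∈ badSet q p T W r l := by
  choose σ hσ using fun i => List.mem_iff_get.1 (hYl i)
  have hY : (fun i => l.get (σ i)) = Y := funext hσ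
  obtain ⟨e, he, hen⟩ := exists_zsmul_eq_norm_le hq (q • z - q • z')
  rw [← dist_eq_norm] at hen
  -- Using `L + 1` in place of `L` keeps the inequality strict even when `L = 0`.
  have h1 : Metric.infEDist (v - p • z) (T Y : Set (Torus d)) < ENNReal.ofReal (ρ * (L + 1)) := by
    refine (Metric.infEDist_le_hausdorffEDist_of_mem hmem).trans_lt ?_
    rw [← Compacts.edist_eq]
    refine hT.trans_lt ?_
    rw [edist_dist, ← ENNReal.ofReal_coe_nnreal, ← ENNReal.ofReal_mul L.coe_nonneg]
    refine (ENNReal.ofReal_lt_ofReal_iff (by positivity)).2 ?_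
    have := mul_le_mul_of_nonneg_left hXY.le L.coe_nonneg
    nlinarith
  obtain ⟨w, hw, hvw⟩ := Metric.infEDist_lt_iff.1 h1
  rw [edist_dist, ENNReal.ofReal_lt_ofReal_iff (by positivity)] at hvw
  simp only [badSet, Set.mem_iUnion]
  -- Closeness of `q z` and `q z'` determines `z - z'` only up to `q`-torsion. Subtracting a small
  -- preimage `e` of `q z - q z'` leaves an exact torsion point, which is why `badSet` includes
  -- torsion translates.
  refine ⟨σ, z - z' - e, ⟨?_, hY ▸ hYW⟩, ?_⟩
  · rw [smul_sub, smul_sub, he, sub_self]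
  · rw [hY]
    refine ⟨w, hw, (euclDist_le _ _).trans_lt (lt_of_lt_of_le ?_ hr)⟩
    refine mul_lt_mul_of_pos_left ?_ (by positivity)
    have h2 : dist (v - p • z) (y - p • z' - p • (z - z' - e)) ≤ ρ + |p| * ρ := by
      have : v - p • z - (y - p • z' - p • (z - z' - e)) = (v - y) - p • e := by
        rw [smul_sub, smul_sub]; abel
      rw [dist_eq_norm, this]
      refine (norm_sub_le _ _).trans (add_le_add ?_ ?_)
      · rw [← dist_eq_norm]; exact hv.le
      · refine (norm_zsmul_le _ _).trans ?_
        rw [Int.norm_eq_abs]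
        push_cast
        gcongr
        linarith
    change dist w (y - p • z' - p • (z - z' - e)) < _
    have := dist_triangle w (v - p • z) (y - p • z' - p • (z - z' - e))
    rw [dist_comm w (v - p • z)] at this
    push_cast at *
    linarith

/-- A mollified sum of two discrete measures and a density, with the distance of its support to
the three parts. -/
lemma support_mollify_add_add {ρ : ℝ} (hρ : 0 < ρ) (w w' : ℝ) (l l' : List (Torus d))
    {g : Torus d → ℝ} (hg : Measurable g) {x : Torus d}
    (hf : IsFiniteMeasure ((volume : Measure (Torus d)).withDensity fun x => ENNReal.ofReal (g x)))
    (hx : x ∈ (mollify ρ (pointMass w l + pointMass w' l'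
      + volume.withDensity fun x => ENNReal.ofReal (g x))).support) :
    (∃ y ∈ l, dist x y < 2 * ρ) ∨ (∃ y ∈ l', dist x y < 2 * ρ) ∨ ∃ y, g y ≠ 0 ∧ dist x y < 2 * ρ := by
  set K : Set (Torus d) := {y | y ∈ l} ∪ {y | y ∈ l'} ∪ {y | g y ≠ 0} with hK
  have hgm : MeasurableSet {y | g y ≠ 0} := (hg (measurableSet_singleton 0)).compl
  have hsupp := support_mollify_subset hρ (pointMass w l + pointMass w' l'
      + volume.withDensity fun x => ENNReal.ofReal (g x)) (K := K) ?_ hx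
  · have h1 := Metric.cthickening_subset_thickening' (δ₁ := ρ) (δ₂ := 2 * ρ) (by linarith)
      (by linarith) K hsupp
    obtain ⟨y, hy, hxy⟩ := Metric.mem_thickening_iff.1 h1
    rcases hy with (hy | hy) | hy
    · exact Or.inl ⟨y, hy, hxy⟩
    · exact Or.inr (Or.inl ⟨y, hy, hxy⟩)
    · exact Or.inr (Or.inr ⟨y, hy, hxy⟩)
  · rw [Measure.add_apply, Measure.add_apply]
    have h1 : pointMass w l Kᶜ = 0 := measure_mono_null
      (Set.compl_subset_compl.2 (Set.subset_union_left.trans Set.subset_union_left))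
      (pointMass_compl_eq_zero w l (K := {y | y ∈ l}) (fun z hz => hz)
        (List.finite_toSet l).measurableSet)
    have h2 : pointMass w' l' Kᶜ = 0 := measure_mono_null
      (Set.compl_subset_compl.2 (Set.subset_union_right.trans Set.subset_union_left))
      (pointMass_compl_eq_zero w' l' (K := {y | y ∈ l'}) (fun z hz => hz)
        (List.finite_toSet l').measurableSet)
    have h3 : (volume : Measure (Torus d)).withDensity (fun x => ENNReal.ofReal (g x)) Kᶜ = 0 := by
      refine measure_mono_null (Set.compl_subset_compl.2 Set.subset_union_right) ?_
      rw [withDensity_apply _ hgm.compl]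
      refine (setLIntegral_congr_fun hgm.compl fun y hy => ?_).trans lintegral_zero
      have : g y = 0 := not_not.1 hy
      simp [this]
    rw [h1, h2, h3, add_zero, add_zero]

lemma hat_eq_hat_restrict_add (κ : Measure (Torus d)) [IsFiniteMeasure κ] {B C : Set (Torus d)}
    (hB : MeasurableSet B) (hC : MeasurableSet C) (hBC : Disjoint B C) (ξ : Fin d → ℤ) :
    hat κ ξ = hat (κ.restrict (B ∪ C)ᶜ) ξ + hat (κ.restrict B) ξ + hat (κ.restrict C) ξ := by
  conv_lhs => rw [← Measure.restrict_add_restrict_compl (μ := κ) (hB.union hC),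
    Measure.restrict_union hBC hC]
  rw [hat_add, hat_add]
  ring

-- The measure is cut into `κB` near `b`, `κC` near `b'` and the rest `κA`. Points replace `κA` and
-- `κB`, and `κC` loses the points that would complete a forbidden configuration. The condition
-- `hdim` below the exponent `β * (N + 1)` makes the total removed volume small.
set_option maxHeartbeats 1000000 in
lemma smoothApprox_localAvoid {N : ℕ} {q p : ℤ} (hq : q ≠ 0) (hp : p ≠ 0)
    {T : (Fin N → Torus d) → Compacts (Torus d)} {V W : Set (Fin N → Torus d)} (hV : IsOpen V)
    (hT : LocallyLipschitzOn V T) (hW : IsClosed W) (hWV : W ⊆ V) {b b' : Torus d} {ε β : ℝ}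
    (hε : 0 < ε) (hbb : ε ≤ dist b b') (hβd : β ≤ d)
    (hdim : ∀ t, t < β * (N + 1) → ∀ W : Set (Fin N → Torus d), IsClosed W → W ⊆ V →
      ∃ r : ℕ → ℝ, (∀ i, 0 < r i) ∧ Tendsto r atTop (𝓝 0) ∧ ∀ x ∈ W, ∀ i,
        volume (thickening (r i) (T x : Set (Torus d))) ≤ ENNReal.ofReal (r i ^ t)) :
    SmoothApprox d β (LocalAvoid q p T W b b' ε) := by
  obtain ⟨c, hc, hcV⟩ := hW.isCompact.exists_cthickening_subset_open hV hWV
  obtain ⟨L, c', hc', hL⟩ := exists_uniform_lipschitz hV hT hW.isCompact hWV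
  -- Support points move by less than `2 * δ < ε / 8`, so the three regions remain distinguishable.
  refine ⟨ε / 16, by positivity, fun δ hδ hδε κ hκ s hs hsβ ε' hε' => ?_⟩
  set B := Metric.ball b (ε / 2) with hB
  set C := Metric.ball b' (ε / 2) with hC
  have hBm : MeasurableSet B := Metric.isOpen_ball.measurableSet
  have hCm : MeasurableSet C := Metric.isOpen_ball.measurableSet
  have hBC : Disjoint B C := Metric.ball_disjoint_ball (by linarith)
  set κA := κ.restrict (B ∪ C)ᶜ with hκA
  set κB := κ.restrict B with hκB
  set κC := κ.restrict C with hκC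
  obtain ⟨CA, hCA⟩ := absRep_smooth hδ κA (d + 1)
  obtain ⟨CB, hCB⟩ := absRep_smooth hδ κB (d + 1)
  obtain ⟨CC, hCC⟩ := absRep_smooth hδ κC (d + 1)
  set lam := (s + β) / 2 with hlam
  -- Since `β - lam = (β - s) / 2`, the loss `2 * η` still leaves `t < β * (N + 1)`. One `η` absorbs
  -- the number of torsion points, the other gives the volume bound `r ^ (lam + η)`.
  set η := (β - s) / 8 with hη
  have hη0 : 0 < η := by rw [hη]; linarith
  have hslam : s < lam := by rw [hlam]; linarith
  -- Chosen so that the displacement bound of `sub_zsmul_mem_badSet`, applied with `2 * ρ`, equals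
  -- `r`; the factor `d + 1` passes from the sup metric to the Euclidean one.
  set θ : ℝ := 1 / (2 * (d + 1) * (L + 2 + |p|)) with hθ
  have hθ0 : 0 < θ := by positivity
  have hsd : s ≤ d := hsβ.le.trans hβd
  have hε3 : 0 < ε' / 3 := by positivity
  have hmainA := eventually_exists_discretization (smooth_nonneg hδ κA) hCA hCA
    (integral_smooth hδ κA) (q := 1) (p := 1) one_ne_zero one_ne_zero hs hsd hslam hη0 hθ0 hε3
  have hmainB := eventually_exists_discretization (smooth_nonneg hδ κB) hCB hCC
    (integral_smooth hδ κB) hq hp hs hsd hslam hη0 hθ0 hε3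
  set t := lam * (N + 1) + 2 * η with ht
  have htβ : t < β * (N + 1) := by
    have h1 : (β - s) / 2 ≤ (β - s) / 2 * (N + 1) :=
      le_mul_of_one_le_right (by linarith) (by linarith [Nat.cast_nonneg (α := ℝ) N])
    have h2 : β * (N + 1) - lam * (N + 1) = (β - s) / 2 * (N + 1) := by rw [hlam]; ring
    rw [ht, hη]
    linarith
  -- The approximating tuple from the list may leave `W`, so the volume bound is taken on a closed
  -- neighbourhood still inside `V`.
  set W' := Metric.cthickening c W with hW'
  obtain ⟨R, hR0, hRlim, hRvol⟩ := hdim t htβ W' Metric.isClosed_cthickening hcV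
  set Q : ℝ := ((finite_zsmul_torsion (d := d) hq).toFinset.card : ℝ) with hQ
  have hsmall : ∀ᶠ r : ℝ in 𝓝[>] 0, Q * r ^ η ≤ 1 := by
    have h1 : Tendsto (fun r : ℝ => Q * r ^ η) (𝓝[>] 0) (𝓝 (Q * 0 ^ η)) :=
      ((Real.continuousAt_rpow_const 0 η (Or.inr hη0.le)).const_mul Q).tendsto.mono_left
        nhdsWithin_le_nhds
    rw [Real.zero_rpow hη0.ne', mul_zero] at h1
    exact h1.eventually_le_const one_pos
  have hpos : 0 < min (min c c') δ / (2 * θ) := by positivity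
  have hRlim' : Tendsto R atTop (𝓝[>] 0) :=
    tendsto_nhdsWithin_iff.2 ⟨hRlim, Eventually.of_forall hR0⟩
  -- The discretizations hold at all small scales, so one of the admissible scales of the dimension
  -- hypothesis can be used.
  obtain ⟨i, ⟨⟨hrA, hrB⟩, hrQ⟩, -, hrs⟩ := (hRlim'.eventually (((hmainA.and hmainB).and hsmall).and
    (Ioo_mem_nhdsGT hpos))).exists
  set r := R i with hr
  have hr0 : 0 < r := hR0 i
  set ρ := θ * r with hρ
  have hρ0 : 0 < ρ := by positivity
  rw [lt_div_iff₀ (by positivity)] at hrs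
  have hρs : 2 * ρ < min (min c c') δ := by rw [hρ]; linarith
  obtain ⟨hρcc, hρδ⟩ := lt_min_iff.1 hρs
  obtain ⟨hρc, hρc'⟩ := lt_min_iff.1 hρcc
  obtain ⟨lA, hlenA, hlA, hwA, -⟩ := hrA ∅ MeasurableSet.empty (by simp; positivity)
  simp only [one_smul] at hlA hwA
  set 𝒯 := badSet q p T W' r lA with h𝒯
  have h𝒯m : MeasurableSet 𝒯 := measurableSet_badSet q p T W' r lA
  have hvol : volume.real 𝒯 ≤ r ^ (lam + η) := by
    refine (volume_badSet_le hq p (by positivity) (fun X hX => hRvol X hX i) lA).trans ?_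
    have h1 : (lA.length : ℝ) ^ N ≤ r ^ (-(lam * N)) := by
      calc (lA.length : ℝ) ^ N ≤ (r ^ (-lam)) ^ N := by gcongr
        _ = r ^ (-(lam * N)) := by
            rw [← Real.rpow_natCast, ← Real.rpow_mul hr0.le]; congr 1; ring
    calc Q * ((lA.length : ℝ) ^ N * r ^ t) ≤ Q * (r ^ (-(lam * N)) * r ^ t) := by gcongr
      _ = (Q * r ^ η) * r ^ (lam + η) := by
          rw [← Real.rpow_add hr0, mul_assoc, ← Real.rpow_add hr0]
          congr 2; rw [ht]; ring
      _ ≤ r ^ (lam + η) := mul_le_of_le_one_left (by positivity) hrQ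
  obtain ⟨lB, -, hlB, hwB, hwC⟩ := hrB 𝒯 h𝒯m hvol
  set g : Torus d → ℝ := fun x => smooth δ κC x * keep p 𝒯 lB x with hg
  have hfCc := continuous_smooth hδ κC
  have hgm : Measurable g := hfCc.measurable.mul (measurable_keep p h𝒯m lB)
  have hg0 : ∀ x, 0 ≤ g x := fun x => mul_nonneg (smooth_nonneg hδ κC x) (keep_nonneg _ _ _ _)
  have hgle : ∀ x, g x ≤ smooth δ κC x := fun x =>
    mul_le_of_le_one_right (smooth_nonneg hδ κC x) (keep_le_one _ _ _ _)
  have hgint : Integrable g := by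
    refine (hfCc.integrable_of_hasCompactSupport (HasCompactSupport.of_compactSpace _)).mono'
      hgm.aestronglyMeasurable (ae_of_all _ fun x => ?_)
    rw [Real.norm_of_nonneg (hg0 x)]
    exact hgle x
  have hgfin := isFiniteMeasure_withDensity_ofReal hgint.2
  set wA := κA.real Set.univ / lA.length with hwAdef
  set wB := κB.real Set.univ / lB.length with hwBdef
  set κ' : Measure (Torus d) := pointMass wA lA + pointMass wB (lB.map fun z => q • z)
    + volume.withDensity fun x => ENNReal.ofReal (g x) with hκ'
  have hsupp : ∀ x ∈ (mollify ρ κ').support, (∃ y ∈ lA, dist x y < 2 * ρ) ∨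
      (∃ z ∈ lB, dist x (q • z) < 2 * ρ) ∨ ∃ y, g y ≠ 0 ∧ dist x y < 2 * ρ := by
    intro x hx
    have := support_mollify_add_add hρ0 wA wB lA (lB.map fun z => q • z) hgm hgfin hx
    simpa only [List.mem_map, exists_exists_and_eq_and] using this
  have hgC : ∀ y, g y ≠ 0 → ∃ y' ∈ C, y' ∈ κ.support ∧ dist y y' ≤ δ := fun y hy =>
    exists_mem_of_smooth_restrict_ne_zero hδ κ hCm (left_ne_zero_of_mul hy)
  have hlA' : ∀ y ∈ lA, ∃ y' ∈ (B ∪ C)ᶜ, y' ∈ κ.support ∧ dist y y' ≤ δ := fun y hy =>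
    exists_mem_of_smooth_restrict_ne_zero hδ κ (hBm.union hCm).compl (hlA y hy)
  have hlB' : ∀ z ∈ lB, ∃ y' ∈ B, y' ∈ κ.support ∧ dist (q • z) y' ≤ δ := fun z hz =>
    exists_mem_of_smooth_restrict_ne_zero hδ κ hBm (hlB z hz)
  refine ⟨mollify ρ κ', isFiniteMeasure_mollify hρ0 κ', exists_pow_mul_norm_hat_mollify_le hρ0 κ',
    ?_, ?_, ?_⟩
  · intro x hx
    suffices ∃ y y', dist x y < 2 * ρ ∧ y' ∈ κ.support ∧ dist y y' ≤ δ by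
      obtain ⟨y, y', h1, h2, h3⟩ := this
      exact Metric.mem_cthickening_of_dist_le x y' _ _ h2 (by linarith [dist_triangle x y y'])
    rcases hsupp x hx with ⟨y, hy, hxy⟩ | ⟨z, hz, hxy⟩ | ⟨y, hy, hxy⟩
    · obtain ⟨y', -, h⟩ := hlA' y hy
      exact ⟨y, y', hxy, h⟩
    · obtain ⟨y', -, h⟩ := hlB' z hz
      exact ⟨_, y', hxy, h⟩
    · obtain ⟨y', -, h⟩ := hgC y hy
      exact ⟨y, y', hxy, h⟩
  · intro ξ
    rw [hat_mollify hρ0, hκ', hat_add, hat_add, hat_pointMass (by positivity),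
      hat_pointMass (by positivity), hat_withDensity hgm hg0,
      hat_eq_hat_restrict_add κ hBm hCm hBC ξ, List.map_map]
    have hA := hwA ξ
    have hB' := hwB ξ
    have hC' := hwC ξ
    rw [coeff_smooth hδ] at hA hB' hC'
    set ω := (1 + ‖ξ‖) ^ (s / 2) with hω
    have hω0 : 0 < ω := by positivity
    have key : bumpCoeff ρ ξ * (wA * (lA.map fun z => mFourier (-ξ) z).sum
        + wB * (lB.map ((fun z => mFourier (-ξ) z) ∘ fun z => q • z)).sum
        + coeff (fun x => (g x : ℂ)) ξ)
        - bumpCoeff δ ξ * (hat κA ξ + hat κB ξ + hat κC ξ)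
        = (bumpCoeff ρ ξ * (κA.real Set.univ / lA.length * (lA.map fun z => mFourier (-ξ) z).sum)
          - bumpCoeff δ ξ * hat κA ξ)
        + (bumpCoeff ρ ξ * (κB.real Set.univ / lB.length
            * (lB.map fun z => mFourier (-ξ) (q • z)).sum) - bumpCoeff δ ξ * hat κB ξ)
        + (bumpCoeff ρ ξ * coeff (fun x => ((smooth δ κC x * keep p 𝒯 lB x : ℝ) : ℂ)) ξ
          - bumpCoeff δ ξ * hat κC ξ) := by
      rw [hwAdef, hwBdef]
      push_cast
      simp only [Function.comp_def, hg]
      push_cast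
      ring
    rw [key]
    calc _ ≤ ω * (_ + _ + _) := mul_le_mul_of_nonneg_left norm_add₃_le hω0.le
      _ ≤ ε' / 3 + ε' / 3 + ε' / 3 := by
          rw [mul_add, mul_add]
          exact add_le_add (add_le_add hA hB') hC'
      _ = ε' := by ring
  · have hnear : ∀ x y y' : Torus d, dist x y < 2 * ρ → dist y y' ≤ δ → dist x y' < ε / 8 :=
      fun x y y' h1 h2 => by linarith [dist_triangle x y y']
    have hregB : ∀ x, ∀ y' ∈ B, dist x y' < ε / 8 → dist x b < 5 / 8 * ε ∧ 3 / 8 * ε < dist x b' := by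
      intro x y' hy' hxy
      rw [hB, Metric.mem_ball] at hy'
      have h1 := dist_triangle x y' b
      have h2 := dist_triangle b x b'
      rw [dist_comm b x] at h2
      constructor <;> linarith
    have hregC : ∀ x, ∀ y' ∈ C, dist x y' < ε / 8 → dist x b' < 5 / 8 * ε ∧ 3 / 8 * ε < dist x b := by
      intro x y' hy' hxy
      rw [hC, Metric.mem_ball] at hy'
      have h1 := dist_triangle x y' b'
      have h2 := dist_triangle b x b'
      rw [dist_comm b x] at h2
      constructor <;> linarith
    have hregA : ∀ x, ∀ y' ∈ (B ∪ C)ᶜ, dist x y' < ε / 8 →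
        3 / 8 * ε ≤ dist x b ∧ 3 / 8 * ε ≤ dist x b' := by
      intro x y' hy' hxy
      rw [Set.compl_union, Set.mem_inter_iff, Set.mem_compl_iff, Set.mem_compl_iff, hB, hC,
        Metric.mem_ball, Metric.mem_ball, not_lt, not_lt] at hy'
      have h1 := dist_triangle y' x b
      have h2 := dist_triangle y' x b'
      rw [dist_comm y' x] at h1 h2
      constructor <;> linarith
    -- By the distances to `b` and `b'`, the entries of `X` come from the list `lA`, `q • z` from
    -- `lB`, and `v` from the surviving density, which vanishes on the forbidden points.
    intro X hX hXE hXb z v hz hzb hv hvb hmem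
    have hYA : ∀ j, ∃ y ∈ lA, dist (X j) y < 2 * ρ := fun j => by
      rcases hsupp _ (hXE j) with h | ⟨z, hz, hxy⟩ | ⟨y, hy, hxy⟩
      · exact h
      · obtain ⟨y', hy', -, h⟩ := hlB' z hz
        have := (hregB _ y' hy' (hnear _ _ _ hxy h)).1
        linarith [(hXb j).1]
      · obtain ⟨y', hy', -, h⟩ := hgC y hy
        have := (hregC _ y' hy' (hnear _ _ _ hxy h)).1
        linarith [(hXb j).2]
    have hzB : ∃ z' ∈ lB, dist (q • z) (q • z') < 2 * ρ := by
      rcases hsupp _ hz with ⟨y, hy, hxy⟩ | h | ⟨y, hy, hxy⟩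
      · obtain ⟨y', hy', -, h⟩ := hlA' y hy
        have := (hregA _ y' hy' (hnear _ _ _ hxy h)).1
        linarith
      · exact h
      · obtain ⟨y', hy', -, h⟩ := hgC y hy
        have := (hregC _ y' hy' (hnear _ _ _ hxy h)).2
        linarith
    have hvC : ∃ y, g y ≠ 0 ∧ dist v y < 2 * ρ := by
      rcases hsupp _ hv with ⟨y, hy, hxy⟩ | ⟨z, hz, hxy⟩ | h
      · obtain ⟨y', hy', -, h⟩ := hlA' y hy
        have := (hregA _ y' hy' (hnear _ _ _ hxy h)).2
        linarith
      · obtain ⟨y', hy', -, h⟩ := hlB' z hz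
        have := (hregB _ y' hy' (hnear _ _ _ hxy h)).2
        linarith
      · exact h
    choose Y hYl hXY using hYA
    obtain ⟨z', hz', hzz⟩ := hzB
    obtain ⟨y, hy, hvy⟩ := hvC
    have hXY' : dist X Y < 2 * ρ := (dist_pi_lt_iff (by positivity)).2 hXY
    have hYW : Y ∈ W' := by
      refine Metric.mem_cthickening_of_dist_le Y X c W hX ?_
      rw [dist_comm]; linarith
    have hbad := sub_zsmul_mem_badSet (W := W') (r := r) (L := L) hq p (by positivity) ?_ hYl hYW
      hXY' (hL X hX Y (by linarith)) hzz hvy hmem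
    · have hkeep := right_ne_zero_of_mul hy
      rw [keep_eq_indicator, Set.indicator_apply_ne_zero] at hkeep
      exact hkeep.1 z' hz' hbad
    · rw [hρ, hθ]
      refine le_of_eq ?_
      have : (0 : ℝ) < L + 2 + |p| := by positivity
      field_simp

/-! ### Generic avoidance and the conclusion -/

/-- Generic sets in `𝒳_β` avoid the pattern. -/
lemma eventually_residual_avoids {n : ℕ} (hn : 2 ≤ n) {α β : ℝ} (hβ : 0 < β) (hβd : β ≤ d)
    (hβα : β * ((n : ℝ) - 1) ≤ d * n - α) {a : ℚ} (ha : a ≠ 0)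
    {V : Set (Fin (n - 2) → Torus d)} (hV : IsOpen V)
    {T : (Fin (n - 2) → Torus d) → Compacts (Torus d)} (hT : LocallyLipschitzOn V T)
    (hdim : LocUnifLowerMinkowski n α V T) :
    ∀ᶠ P in residual (XSpace d β), Avoids hn a V T (P.set : Set (Torus d)) := by
  obtain ⟨F, hFc, hFV, hFU, -⟩ := hV.exists_iUnion_isClosed
  set b := denseSeq (Torus d) with hb
  have hdense : DenseRange b := denseRange_denseSeq _
  have hN : ((n - 2 : ℕ) : ℝ) + 1 = n - 1 := by rw [Nat.cast_sub hn]; push_cast; ring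
  have hdim' : ∀ t, t < β * (((n - 2 : ℕ) : ℝ) + 1) → ∀ W : Set (Fin (n - 2) → Torus d),
      IsClosed W → W ⊆ V → ∃ r : ℕ → ℝ, (∀ i, 0 < r i) ∧ Tendsto r atTop (𝓝 0) ∧ ∀ x ∈ W, ∀ i,
        volume (thickening (r i) (T x : Set (Torus d))) ≤ ENNReal.ofReal (r i ^ t) := by
    intro t ht W hW hWV
    rw [hN] at ht
    -- The value `γ = n d - t` exceeds `α` because `t < β (n - 1) ≤ d n - α`.
    obtain ⟨r, h1, -, h2, h3⟩ := hdim (n * d - t) (by linarith) W hW hWV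
    refine ⟨r, h1, h2, fun x hx i => ?_⟩
    have := h3 x hx i
    rwa [sub_sub_cancel] at this
  have hres : ∀ᶠ P in residual (XSpace d β), ∀ k j i i' : ℕ, 1 / ((j : ℝ) + 1) ≤ dist (b i) (b i') →
      LocalAvoid (a.den : ℤ) a.num T (F k) (b i) (b i') (1 / ((j : ℝ) + 1))
        (P.set : Set (Torus d)) := by
    simp only [eventually_countable_forall]
    intro k j i i' hdist
    have hq : (a.den : ℤ) ≠ 0 := by exact_mod_cast a.den_nz
    exact residual_of_dense_open
      (isOpen_setOf_localAvoid _ _ (hFc k) (hT.continuousOn.mono (hFV k)) _ _ _)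
      (dense_of_smoothApprox hβ hβd (smoothApprox_localAvoid hq (Rat.num_ne_zero.2 ha) hV hT
        (hFc k) (hFV k) (by positivity) hdist hβd hdim'))
  filter_upwards [hres] with P hP
  intro x hxE hxinj hxV y hy hmem
  obtain ⟨z, hz, rfl⟩ := exists_of_mem_ratMul hy
  rw [← hFU, Set.mem_iUnion] at hxV
  obtain ⟨k, hk⟩ := hxV
  obtain ⟨η, hη, hη0⟩ : ∃ η : ℝ, (∀ i j, i ≠ j → η ≤ dist (x i) (x j)) ∧ 0 < η := by
    have h1 : ∀ᶠ η : ℝ in 𝓝[>] 0, ∀ i j, i ≠ j → η ≤ dist (x i) (x j) := by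
      rw [eventually_all]
      intro i
      rw [eventually_all]
      intro j
      by_cases hij : i = j
      · simp [hij]
      · filter_upwards [Ioc_mem_nhdsGT (dist_pos.2 (hxinj.ne hij))] with η hη _
        exact hη.2
    exact (h1.and self_mem_nhdsWithin).exists
  -- With `ε < η / 2` and centres within `ε / 4` of the last two points, the centres are at least `η
  -- - ε / 2 ≥ ε` apart, and the other points are at least `η - ε / 4 ≥ ε` from them.
  obtain ⟨j, hj⟩ := exists_nat_one_div_lt (half_pos hη0)
  set ε : ℝ := 1 / ((j : ℝ) + 1) with hε
  have hε0 : 0 < ε := by positivity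
  set u := x ⟨n - 2, by omega⟩ with hu
  set v := x ⟨n - 1, by omega⟩ with hv
  obtain ⟨i, hi⟩ := hdense.exists_dist_lt u (show 0 < ε / 4 by positivity)
  obtain ⟨i', hi'⟩ := hdense.exists_dist_lt v (show 0 < ε / 4 by positivity)
  have huv : η ≤ dist u v := hη _ _ (by simp only [Ne, Fin.mk.injEq]; omega)
  have hXu : ∀ m : Fin (n - 2), η ≤ dist (x (m.castLE (Nat.sub_le n 2))) u := fun m =>
    hη _ _ (by simp only [Ne, Fin.ext_iff, Fin.val_castLE]; omega)
  have hXv : ∀ m : Fin (n - 2), η ≤ dist (x (m.castLE (Nat.sub_le n 2))) v := fun m =>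
    hη _ _ (by simp only [Ne, Fin.ext_iff, Fin.val_castLE]; omega)
  have hdist : ε ≤ dist (b i) (b i') := by
    have h1 := dist_triangle4 u (b i) (b i') v
    rw [dist_comm (b i') v] at h1
    linarith
  refine hP k j i i' hdist _ hk (fun m => hxE _) (fun m => ⟨?_, ?_⟩) z v (hz ▸ hxE _)
    (hz ▸ hi.le) (hxE _) hi'.le hmem
  · have h1 := dist_triangle_right (x (m.castLE (Nat.sub_le n 2))) u (b i)
    linarith [hXu m]
  · have h1 := dist_triangle_right (x (m.castLE (Nat.sub_le n 2))) v (b i')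
    linarith [hXv m]

/-- Lebesgue measure has no nonzero Fourier coefficients apart from frequency zero. Nonemptiness is
needed to extract a set from a dense family. -/
lemma XSpace.nonempty (d : ℕ) (β : ℝ) : Nonempty (XSpace d β) := by
  refine ⟨⟨⊤, ⟨volume, inferInstance⟩, fun _ _ => trivial, fun s hs _ => ?_⟩⟩
  refine weightedSup_lt_top (C := 1) hs fun ξ => ?_
  change (1 + ‖ξ‖) ^ (s / 2) * ‖∫ x, mFourier (-ξ) x‖ ≤ 1
  rw [integral_mFourier]
  by_cases hξ : ξ = 0 <;> simp [hξ]

end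

end SalemAvoid

theorem theorem3 (d n : ℕ) (hn : 2 ≤ n) (α : ℝ)
    (hα : (d : ℝ) * ((n : ℝ) - 1) ≤ α) (hα' : α < (d : ℝ) * n)
    (a : ℚ) (ha : a ≠ 0)
    (V : Set (Fin (n - 2) → SalemAvoid.Torus d)) (hV : IsOpen V)
    (T : (Fin (n - 2) → SalemAvoid.Torus d) → TopologicalSpace.Compacts (SalemAvoid.Torus d))
    (hT : LocallyLipschitzOn V T)
    (hdim : SalemAvoid.LocUnifLowerMinkowski n α V T)
    (β₀ : ℝ) (hβ₀ : β₀ = min (((d : ℝ) * n - α) / ((n : ℝ) - 1)) d) :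
    (∃ E : TopologicalSpace.Compacts (SalemAvoid.Torus d),
      SalemAvoid.IsSalem (E : Set (SalemAvoid.Torus d)) ∧
      SalemAvoid.fourierDim (E : Set (SalemAvoid.Torus d)) = ENNReal.ofReal β₀ ∧
      SalemAvoid.Avoids hn a V T (E : Set (SalemAvoid.Torus d))) ∧
    ∀ β : ℝ, 0 < β → β ≤ β₀ →
      {p : SalemAvoid.XSpace d β |
        SalemAvoid.IsSalem (p.set : Set (SalemAvoid.Torus d)) ∧
        SalemAvoid.Avoids hn a V T (p.set : Set (SalemAvoid.Torus d))} ∈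
      residual (SalemAvoid.XSpace d β) := by
  have hn1 : (0 : ℝ) < (n : ℝ) - 1 := by
    have : (2 : ℝ) ≤ n := by exact_mod_cast hn
    linarith
  -- For `d = 0` the two bounds on `α` would contradict each other.
  have hd : (0 : ℝ) < d := by
    by_contra! h
    have h0 : (d : ℝ) = 0 := le_antisymm h (Nat.cast_nonneg d)
    rw [h0, zero_mul] at hα hα'
    linarith
  have hpos : 0 < β₀ := by
    rw [hβ₀]
    exact lt_min (div_pos (by linarith) hn1) hd
  have hres : ∀ β : ℝ, 0 < β → β ≤ β₀ → ∀ᶠ p in residual (SalemAvoid.XSpace d β),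
      (SalemAvoid.IsSalem (p.set : Set (SalemAvoid.Torus d)) ∧
        SalemAvoid.fourierDim (p.set : Set (SalemAvoid.Torus d)) = ENNReal.ofReal β) ∧
      SalemAvoid.Avoids hn a V T (p.set : Set (SalemAvoid.Torus d)) := by
    intro β hβ hβ'
    rw [hβ₀, le_min_iff, le_div_iff₀ hn1] at hβ'
    exact (SalemAvoid.eventually_residual_isSalem hβ hβ'.2).and
      (SalemAvoid.eventually_residual_avoids hn hβ hβ'.2 hβ'.1 ha hV hT hdim)
  refine ⟨?_, fun β hβ hβ' => (hres β hβ hβ').mono fun p hp => ⟨hp.1.1, hp.2⟩⟩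
  have := SalemAvoid.XSpace.baireSpace (d := d) hpos
  have := SalemAvoid.XSpace.nonempty d β₀
  obtain ⟨p, hp⟩ := (dense_of_mem_residual (hres β₀ hpos le_rfl)).nonempty
  exact ⟨p.set, hp.1.1, hp.1.2, hp.2⟩
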